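/- **Conventions.** Let $(X,g)$ be a smooth Riemannian manifold (without boundary), $d$ the induced distance. An *$n$-rectifiable current* is an integer multiplicity rectifiable $n$-current on $X$ with finite mass, i.e. a finite-mass functional on smooth compactly supported $n$-forms of the form $T(\alpha)=\sum_i\int_{K_i}\theta_i\, f_i^*\alpha$ (an absolutely convergent countable sum) with $K_i\subset\mathbb R^n$ measurable, $f_i:K_i\to X$ Lipschitz and $\theta_i$ integer-valued and measurable. Write $|T|$ for the mass, $\partial T$ for the boundary ($\partial T(\alpha)=T(d\alpha)$), and $T\llcorner B$ for the restriction to a Borel set $B$. For $A\subset X$, a $1$-cycle in $A$ is a $1$-rectifiable current $\gamma$ with $\partial\gamma=0$ and support contained in $A$; an $n$-rectifiable current with support in $A$ is *null-homologous within $A$* if it is the boundary of an $(n+1)$-rectifiable current with support in $A$; and $H_1(A;\mathbb Z)$ is the group of $1$-cycles in $A$ modulo those null-homologous within $A$. For $L\subset X$ and $R\in(0,\infty]$ let $B_R(L)=\{x: d(x,L)<R\}$, where $d(x,L)=\inf_{y\in L}d(x,y)$. A function $\varphi_L:[0,R)\to[0,\infty)$ is a *filling function $R$-relative to $L$* if there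 is a homomorphism $\eta:H_1(B_R(L);\mathbb Z)\to H_1(L;\mathbb Z)$ with $\eta\circ\iota_*=\mathrm{id}$, where $\iota:L\to B_R(L)$ is the inclusion, such that for every $\varepsilon>0$, $r\in(0,R)$ and $1$-cycle $\gamma$ in $B_r(L)$ there are a $1$-cycle $\gamma'$ in $L$ and a $2$-rectifiable current $C'$ in $X$ with $[\gamma']=\eta([\gamma])$, $\partial C'=\gamma-\gamma'$ and $|C'|<\varphi_L(r)|\gamma|+\varepsilon$. For $Q\ge 1$, a $2$-rectifiable current $C$ whose boundary $\partial C$ is a $1$-rectifiable current supported on $L$ is *$Q$-quasiminimizing relative to $L$* if $|C\llcorner B|\le Q|C'|$ for every Borel set $B\supset L$ and every $2$-rectifiable current $C'$ in $X$ such that $\partial(C\llcorner B-C')$ is a $1$-rectifiable current supported and null-homologous within $L$. **Proposition (Monotonicity).** Let $(X,g)$ be a Riemannian manifold, $L\subset X$, $R\in(0,\infty]$, $Q\ge1$, let $\varphi_L$ be an increasing (i.e. nondecreasing) filling function $R$-relative to $L$, and let $C$ be a $2$-rectifiable current that is $Q$-quasiminimizing relative to $L$. Then for all $0<a<b<R$,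 $$|C\llcorner B_b(L)|\ \ge\ |C\llcorner B_a(L)|\,\exp\Big(\frac1Q\int_a^b\frac{dr}{\varphi_L(r)}\Big),$$ with the conventions $1/0=\infty$, $\exp(\infty)=\infty$ and $0\cdot\infty=0$. -/

import Mathlib

open Set MeasureTheory Topology Manifold Bundle
open scoped ENNReal NNReal ContDiff

noncomputable section

namespace RectCurrent

/-- The Euclidean space `ℝⁿ`. -/
abbrev Euc (n : ℕ) : Type := EuclideanSpace ℝ (Fin n)

/-! ### Smooth compactly supported differential forms on a manifold -/

section Forms

variable {m : ℕ} {X : Type*} [TopologicalSpace X] [ChartedSpace (Euc m) X]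

/-- The expression of a (not necessarily smooth) `n`-form `α` in the chart at `x₀`: the pullback of
`α` under the inverse of that chart. It is meaningful on the target of the chart. -/
def chartRep {n : ℕ} (α : ∀ x : X, TangentSpace (𝓡 m) x [⋀^Fin n]→L[ℝ] ℝ) (x₀ : X) :
    Euc m → Euc m [⋀^Fin n]→L[ℝ] ℝ := fun y =>
  (α ((extChartAt (𝓡 m) x₀).symm y)).compContinuousLinearMap
    (mfderiv 𝓘(ℝ, Euc m) (𝓡 m) (extChartAt (𝓡 m) x₀).symm y)

/-- The exterior derivative of an `n`-form on a manifold: at `x`, it is the exterior derivative in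
the chart at `x`, transported back to the tangent space at `x`. -/
def extD {n : ℕ} (α : ∀ x : X, TangentSpace (𝓡 m) x [⋀^Fin n]→L[ℝ] ℝ) :
    ∀ x : X, TangentSpace (𝓡 m) x [⋀^Fin (n + 1)]→L[ℝ] ℝ := fun x =>
  ContinuousAlternatingMap.compContinuousLinearMap
    (extDeriv (chartRep α x) (extChartAt (𝓡 m) x x) : Euc m [⋀^Fin (n + 1)]→L[ℝ] ℝ)
    (mfderiv (𝓡 m) 𝓘(ℝ, Euc m) (extChartAt (𝓡 m) x) x)

lemma chartRep_add {n : ℕ} (α η : ∀ x : X, TangentSpace (𝓡 m) x [⋀^Fin n]→L[ℝ] ℝ) (x₀ : X) :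
    chartRep (α + η) x₀ = chartRep α x₀ + chartRep η x₀ := rfl

lemma chartRep_smul {n : ℕ} (c : ℝ) (α : ∀ x : X, TangentSpace (𝓡 m) x [⋀^Fin n]→L[ℝ] ℝ)
    (x₀ : X) : chartRep (c • α) x₀ = c • chartRep α x₀ := rfl

lemma chartRep_zero {n : ℕ} (x₀ : X) :
    chartRep (0 : ∀ x : X, TangentSpace (𝓡 m) x [⋀^Fin n]→L[ℝ] ℝ) x₀ = 0 := rfl

variable (m X) in
/-- The space of smooth `n`-forms with compact support on `X`. -/
def TestForm (n : ℕ) : Submodule ℝ (∀ x : X, TangentSpace (𝓡 m) x [⋀^Fin n]→L[ℝ] ℝ) where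
  carrier := {α | (∀ x₀ : X, ContDiffOn ℝ ∞ (chartRep α x₀) (extChartAt (𝓡 m) x₀).target) ∧
    IsCompact (closure {x | α x ≠ 0})}
  zero_mem' := by
    refine ⟨fun x₀ => ?_, ?_⟩
    · rw [chartRep_zero]; exact contDiffOn_const
    · simp
  add_mem' := by
    rintro α η ⟨h1, h2⟩ ⟨h3, h4⟩
    refine ⟨fun x₀ => ?_, ?_⟩
    · rw [chartRep_add]; exact (h1 x₀).add (h3 x₀)
    · refine (h2.union h4).of_isClosed_subset isClosed_closure ?_
      rw [← closure_union]
      refine closure_mono fun x hx => ?_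
      by_contra hcon
      simp only [mem_union, mem_ofPred_eq, not_or, not_not] at hcon
      exact hx (by simp [hcon.1, hcon.2])
  smul_mem' := by
    rintro c α ⟨h1, h2⟩
    refine ⟨fun x₀ => ?_, ?_⟩
    · rw [chartRep_smul]; exact (h1 x₀).const_smul c
    · refine h2.of_isClosed_subset isClosed_closure (closure_mono fun x hx h0 => hx ?_)
      simp [h0]

lemma compCLM_congr {m n : ℕ} {X : Type*} (α : X → Euc m [⋀^Fin n]→L[ℝ] ℝ) {p q : X} (h : p = q)
    {A B : Euc m →L[ℝ] Euc m} (hAB : A = B) :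
    (α p).compContinuousLinearMap A = (α q).compContinuousLinearMap B := by
  subst h; subst hAB; rfl

lemma two_le_smooth : minSmoothness ℝ 2 ≤ (∞ : WithTop ℕ∞) := by
  rw [minSmoothness_of_isRCLikeNormedField]
  exact WithTop.coe_le_coe.2 (le_top : (2 : ℕ∞) ≤ ⊤)

lemma extD_support {n : ℕ} (α : ∀ x : X, TangentSpace (𝓡 m) x [⋀^Fin n]→L[ℝ] ℝ) :
    {x | extD α x ≠ 0} ⊆ closure {x | α x ≠ 0} := by
  intro x hx
  by_contra hcon
  refine hx ?_
  have hev : chartRep α x =ᶠ[𝓝 (extChartAt (𝓡 m) x x)] 0 := by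
    have hc : ContinuousAt (extChartAt (𝓡 m) x).symm (extChartAt (𝓡 m) x x) :=
      continuousAt_extChartAt_symm x
    have hU : (closure {x | α x ≠ 0})ᶜ ∈ 𝓝 ((extChartAt (𝓡 m) x).symm (extChartAt (𝓡 m) x x)) := by
      rw [extChartAt_to_inv]
      exact isClosed_closure.isOpen_compl.mem_nhds hcon
    filter_upwards [hc.preimage_mem_nhds hU] with y hy
    have h0 : α ((extChartAt (𝓡 m) x).symm y) = 0 := by
      by_contra h
      exact hy (subset_closure h)
    ext v
    exact DFunLike.congr_fun h0 _
  have h0 : extDeriv (chartRep α x) (extChartAt (𝓡 m) x x) = 0 := by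
    rw [hev.extDeriv_eq, extDeriv]
    rw [show fderiv ℝ (0 : Euc m → Euc m [⋀^Fin n]→L[ℝ] ℝ) (extChartAt (𝓡 m) x x) = 0 from
      fderiv_const_apply _]
    exact map_zero (ContinuousAlternatingMap.alternatizeUncurryFinCLM ℝ (Euc m) ℝ)
  ext v
  exact DFunLike.congr_fun h0 _

variable [IsManifold (𝓡 m) ∞ X]

/-- The chain rule for a change of charts. -/
lemma fderiv_change (x₀ z : X) {y : Euc m} (hy : y ∈ (extChartAt (𝓡 m) x₀).target)
    (hz : (extChartAt (𝓡 m) x₀).symm y ∈ (extChartAt (𝓡 m) z).source) :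
    fderiv ℝ (extChartAt (𝓡 m) z ∘ (extChartAt (𝓡 m) x₀).symm) y =
      (mfderiv (𝓡 m) 𝓘(ℝ, Euc m) (extChartAt (𝓡 m) z) ((extChartAt (𝓡 m) x₀).symm y)).comp
        (mfderiv 𝓘(ℝ, Euc m) (𝓡 m) (extChartAt (𝓡 m) x₀).symm y) := by
  rw [← mfderiv_eq_fderiv]
  refine mfderiv_comp y (mdifferentiableAt_extChartAt (by simpa using hz)) ?_
  have := mdifferentiableWithinAt_extChartAt_symm hy
  rwa [ModelWithCorners.range_eq_univ, mdifferentiableWithinAt_univ] at this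

/-- Change of charts for the local expressions of a form. -/
lemma chartRep_change {n : ℕ} (α : ∀ x : X, TangentSpace (𝓡 m) x [⋀^Fin n]→L[ℝ] ℝ) (x₀ z : X)
    {y : Euc m} (hy : y ∈ (extChartAt (𝓡 m) x₀).target)
    (hz : (extChartAt (𝓡 m) x₀).symm y ∈ (extChartAt (𝓡 m) z).source) :
    chartRep α x₀ y =
      (chartRep α z ((extChartAt (𝓡 m) z ∘ (extChartAt (𝓡 m) x₀).symm) y)).compContinuousLinearMap
        (fderiv ℝ (extChartAt (𝓡 m) z ∘ (extChartAt (𝓡 m) x₀).symm) y) := by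
  have h1 := mfderivWithin_extChartAt_symm_comp_mfderiv_extChartAt' hz
  rw [ModelWithCorners.range_eq_univ, mfderivWithin_univ] at h1
  rw [fderiv_change x₀ z hy hz]
  refine compCLM_congr (m := m) (n := n) (X := X) α ((extChartAt (𝓡 m) z).left_inv hz).symm
    (A := mfderiv 𝓘(ℝ, Euc m) (𝓡 m) (extChartAt (𝓡 m) x₀).symm y)
    (B := ContinuousLinearMap.comp
      (mfderiv 𝓘(ℝ, Euc m) (𝓡 m) (extChartAt (𝓡 m) z).symm
        (extChartAt (𝓡 m) z ((extChartAt (𝓡 m) x₀).symm y)) : Euc m →L[ℝ] Euc m)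
      (ContinuousLinearMap.comp
        (mfderiv (𝓡 m) 𝓘(ℝ, Euc m) (extChartAt (𝓡 m) z) ((extChartAt (𝓡 m) x₀).symm y) :
          Euc m →L[ℝ] Euc m)
        (mfderiv 𝓘(ℝ, Euc m) (𝓡 m) (extChartAt (𝓡 m) x₀).symm y : Euc m →L[ℝ] Euc m))) ?_
  ext1 v
  have h2 := congrArg (fun L => L (mfderiv 𝓘(ℝ, Euc m) (𝓡 m) (extChartAt (𝓡 m) x₀).symm y v)) h1
  exact h2.symm

lemma chartRep_extD {n : ℕ} (α : ∀ x : X, TangentSpace (𝓡 m) x [⋀^Fin n]→L[ℝ] ℝ)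
    (hα : ∀ x₀ : X, ContDiffOn ℝ ∞ (chartRep α x₀) (extChartAt (𝓡 m) x₀).target) (x₀ : X) :
    EqOn (chartRep (extD α) x₀) (extDeriv (chartRep α x₀)) (extChartAt (𝓡 m) x₀).target := by
  intro y hy
  set z : X := (extChartAt (𝓡 m) x₀).symm y with hzdef
  have hz : (extChartAt (𝓡 m) x₀).symm y ∈ (extChartAt (𝓡 m) z).source := mem_extChartAt_source z
  have hopen : IsOpen (extChartAt (𝓡 m) x₀).target := isOpen_extChartAt_target x₀
  have hcont : ContinuousAt (extChartAt (𝓡 m) x₀).symm y :=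
    (continuousOn_extChartAt_symm x₀).continuousAt (hopen.mem_nhds hy)
  have hev : chartRep α x₀ =ᶠ[𝓝 y] fun y' =>
      (chartRep α z ((extChartAt (𝓡 m) z ∘ (extChartAt (𝓡 m) x₀).symm) y')).compContinuousLinearMap
        (fderiv ℝ (extChartAt (𝓡 m) z ∘ (extChartAt (𝓡 m) x₀).symm) y') := by
    filter_upwards [hopen.mem_nhds hy,
      hcont.preimage_mem_nhds ((isOpen_extChartAt_source z).mem_nhds hz)] with y' h1 h2
    exact chartRep_change α x₀ z h1 h2
  have hsm : ContDiffAt ℝ ∞ (extChartAt (𝓡 m) z ∘ (extChartAt (𝓡 m) x₀).symm) y := by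
    have := contDiffWithinAt_ext_coord_change (I := 𝓡 m) (n := ∞) z x₀ (y := y) ⟨hy, hz⟩
    rwa [ModelWithCorners.range_eq_univ, contDiffWithinAt_univ] at this
  have htgt : (extChartAt (𝓡 m) z ∘ (extChartAt (𝓡 m) x₀).symm) y ∈ (extChartAt (𝓡 m) z).target :=
    (extChartAt (𝓡 m) z).map_source hz
  have hdiff : DifferentiableAt ℝ (chartRep α z)
      ((extChartAt (𝓡 m) z ∘ (extChartAt (𝓡 m) x₀).symm) y) :=
    ((hα z).contDiffAt ((isOpen_extChartAt_target z).mem_nhds htgt)).differentiableAt (by simp)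
  rw [hev.extDeriv_eq, extDeriv_pullback hdiff hsm two_le_smooth, fderiv_change x₀ z hy hz]
  rfl

/-- The exterior derivative on smooth compactly supported forms. -/
def TestForm.d (n : ℕ) : TestForm m X n →ₗ[ℝ] TestForm m X (n + 1) where
  toFun α := ⟨extD α.1, by
    refine ⟨fun x₀ => ?_, ?_⟩
    · refine ContDiffOn.congr ?_ (chartRep_extD α.1 α.2.1 x₀)
      have h := (α.2.1 x₀).fderiv_of_isOpen (isOpen_extChartAt_target x₀) (m := ∞) (by simp)
      exact (ContinuousAlternatingMap.alternatizeUncurryFinCLM ℝ (Euc m) ℝ).contDiff.comp_contDiffOn h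
    · exact α.2.2.of_isClosed_subset isClosed_closure
        (closure_minimal (extD_support α.1) isClosed_closure)⟩
  map_add' α β := by
    ext1
    funext x
    have hd : ∀ γ : TestForm m X n, DifferentiableAt ℝ (chartRep γ.1 x) (extChartAt (𝓡 m) x x) :=
      fun γ => ((γ.2.1 x).contDiffAt ((isOpen_extChartAt_target x).mem_nhds
        (mem_extChartAt_target x))).differentiableAt (by simp)
    change extD (α.1 + β.1) x = extD α.1 x + extD β.1 x
    simp only [extD, chartRep_add]
    rw [extDeriv_add (hd α) (hd β)]
    rfl
  map_smul' c α := by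
    ext1
    funext x
    change extD (c • α.1) x = c • extD α.1 x
    simp only [extD, chartRep_smul]
    rw [extDeriv_smul]
    rfl

end Forms

/-! ### Currents -/

section Currents

variable {m : ℕ} {X : Type*} [EMetricSpace X] [ChartedSpace (Euc m) X]

variable (m X) in
/-- `n`-currents on `X`: linear functionals on the smooth compactly supported `n`-forms. (The
currents that matter below, the rectifiable ones, have finite mass, hence are continuous.) -/
abbrev Current (n : ℕ) : Type _ := TestForm m X n →ₗ[ℝ] ℝ

/-- The boundary `∂T`, defined by `∂T(α) = T(dα)`. -/
def Current.boundary [IsManifold (𝓡 m) ∞ X] {n : ℕ} (T : Current m X (n + 1)) : Current m X n :=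
  T ∘ₗ TestForm.d n

lemma Current.boundary_zero [IsManifold (𝓡 m) ∞ X] {n : ℕ} : (0 : Current m X (n + 1)).boundary = 0 := rfl

lemma Current.boundary_add [IsManifold (𝓡 m) ∞ X] {n : ℕ} (S T : Current m X (n + 1)) :
    (S + T).boundary = S.boundary + T.boundary := rfl

lemma Current.boundary_neg [IsManifold (𝓡 m) ∞ X] {n : ℕ} (T : Current m X (n + 1)) : (-T).boundary = -T.boundary := rfl

/-- The support of a current: the complement of the largest open set on which it vanishes. -/
def Current.support {n : ℕ} (T : Current m X n) : Set X :=
  {x | ∀ U : Set X, IsOpen U → x ∈ U →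
    ∃ α : TestForm m X n, closure {y | α.1 y ≠ 0} ⊆ U ∧ T α ≠ 0}

/-- The mass of a current: the supremum of `T(α)` over the forms `α` of comass at most one, the
comass being taken with respect to the Riemannian metric. -/
def Current.mass [RiemannianBundle (fun x : X => TangentSpace (𝓡 m) x)] {n : ℕ}
    (T : Current m X n) : ℝ≥0∞ :=
  ⨆ (α : TestForm m X n)
    (_ : ∀ (x : X) (v : Fin n → TangentSpace (𝓡 m) x), (∀ j, ‖v j‖ ≤ 1) → |α.1 x v| ≤ 1),
    ENNReal.ofReal (T α)

/-- The function integrated in the pairing of the form `α` with the push-forward under `f` of the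
integer multiplicity `θ` on `K ⊆ ℝⁿ`, that is, `u ↦ θ(u) α_{f(u)}(∂₁f(u), …, ∂ₙf(u))`. If `f` is
Lipschitz on the measurable set `K`, its derivative along `K` exists at almost every point of `K`
(Rademacher), and it is the unique one at almost every point. -/
def pushDensity {n : ℕ} (K : Set (Euc n)) (f : Euc n → X) (θ : Euc n → ℤ) (α : TestForm m X n) :
    Euc n → ℝ := fun u =>
  (θ u : ℝ) * α.1 (f u) (fun j =>
    mfderivWithin 𝓘(ℝ, Euc n) (𝓡 m) f K u (EuclideanSpace.single j (1 : ℝ)))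

variable (m X) in
/-- A parametrization of an integer multiplicity rectifiable `n`-current: countably many Lipschitz
images of measurable subsets of `ℝⁿ`, carrying integer multiplicities, such that the current
`α ↦ ∑ᵢ ∫_{Kᵢ} θᵢ(u) α(∂₁fᵢ(u), …, ∂ₙfᵢ(u)) du` is defined by absolutely convergent integrals. -/
structure RectParam (n : ℕ) where
  /-- The countable index set. -/
  index : Type
  countable_index : Countable index
  /-- The parameter domains `Kᵢ`. -/
  dom : index → Set (Euc n)
  /-- The parametrizations `fᵢ`. -/
  map : index → Euc n → X
  /-- The multiplicities `θᵢ`. -/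
  mult : index → Euc n → ℤ
  measurableSet_dom : ∀ i, MeasurableSet (dom i)
  lipschitz : ∀ i, ∃ c : ℝ≥0, LipschitzOnWith c (map i) (dom i)
  measurable_mult : ∀ i, Measurable (mult i)
  integrable : ∀ (α : TestForm m X n) (i : index),
    IntegrableOn (pushDensity (dom i) (map i) (mult i) α) (dom i)
  summable : ∀ α : TestForm m X n,
    Summable fun i => ∫ u in dom i, |pushDensity (dom i) (map i) (mult i) α u|

namespace RectParam

variable {n : ℕ} (P : RectParam m X n)

lemma summable_integral (α : TestForm m X n) :
    Summable fun i => ∫ u in P.dom i, pushDensity (P.dom i) (P.map i) (P.mult i) α u :=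
  Summable.of_norm_bounded (P.summable α) fun _ => norm_integral_le_integral_norm _

lemma pushDensity_add (K : Set (Euc n)) (f : Euc n → X) (θ : Euc n → ℤ) (α β : TestForm m X n) :
    pushDensity K f θ (α + β) = pushDensity K f θ α + pushDensity K f θ β := by
  funext u
  exact mul_add _ _ _

lemma pushDensity_smul (K : Set (Euc n)) (f : Euc n → X) (θ : Euc n → ℤ) (c : ℝ)
    (α : TestForm m X n) : pushDensity K f θ (c • α) = c • pushDensity K f θ α := by
  funext u
  exact mul_left_comm _ _ _

/-- The current defined by a parametrization. -/
def toCurrent : Current m X n where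
  toFun α := ∑' i, ∫ u in P.dom i, pushDensity (P.dom i) (P.map i) (P.mult i) α u
  map_add' α β := by
    rw [← (P.summable_integral α).tsum_add (P.summable_integral β)]
    refine tsum_congr fun i => ?_
    rw [pushDensity_add]
    exact integral_add (P.integrable α i) (P.integrable β i)
  map_smul' c α := by
    rw [RingHom.id_apply, smul_eq_mul, ← tsum_mul_left]
    refine tsum_congr fun i => ?_
    rw [pushDensity_smul]
    exact integral_const_mul c _

lemma pushDensity_indicator (K S : Set (Euc n)) (f : Euc n → X) (θ : Euc n → ℤ)
    (α : TestForm m X n) :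
    pushDensity K f (S.indicator θ) α = S.indicator (pushDensity K f θ α) := by
  funext u
  by_cases hu : u ∈ S
  · simp only [pushDensity, indicator_of_mem hu]
  · simp only [pushDensity, indicator_of_notMem hu, Int.cast_zero, zero_mul]

lemma measurableSet_inter_preimage [MeasurableSpace X] [BorelSpace X] {B : Set X}
    (hB : MeasurableSet B) (i : P.index) : MeasurableSet (P.dom i ∩ P.map i ⁻¹' B) := by
  obtain ⟨c, hc⟩ := P.lipschitz i
  have h1 : Measurable ((P.dom i).domRestrict (P.map i)) := hc.continuousOn.domRestrict.measurable
  have h2 := (P.measurableSet_dom i).subtype_image (h1 hB)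
  convert! h2 using 1
  ext u
  simp [and_comm]

/-- The restriction of a parametrized current to a Borel set `B`: the multiplicities are set to
zero outside the preimages of `B`. -/
def restrict [MeasurableSpace X] [BorelSpace X] (B : Set X) (hB : MeasurableSet B) :
    RectParam m X n where
  index := P.index
  countable_index := P.countable_index
  dom := P.dom
  map := P.map
  mult i := (P.dom i ∩ P.map i ⁻¹' B).indicator (P.mult i)
  measurableSet_dom := P.measurableSet_dom
  lipschitz := P.lipschitz
  measurable_mult i := (P.measurable_mult i).indicator (P.measurableSet_inter_preimage hB i)
  integrable α i := by
    rw [pushDensity_indicator]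
    exact (P.integrable α i).indicator (P.measurableSet_inter_preimage hB i)
  summable α := by
    refine Summable.of_nonneg_of_le (fun i => integral_nonneg fun u => abs_nonneg _)
      (fun i => ?_) (P.summable α)
    rw [pushDensity_indicator]
    refine integral_mono
      ((P.integrable α i).indicator (P.measurableSet_inter_preimage hB i)).abs
      (P.integrable α i).abs fun u => ?_
    by_cases hu : u ∈ P.dom i ∩ P.map i ⁻¹' B
    · simp only [indicator_of_mem hu, le_refl]
    · simp only [indicator_of_notMem hu, abs_zero, abs_nonneg]

variable (m X n) in
/-- The parametrization of the zero current by no pieces at all. -/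
def empty : RectParam m X n where
  index := Empty
  countable_index := inferInstance
  dom i := i.elim
  map i := i.elim
  mult i := i.elim
  measurableSet_dom i := i.elim
  lipschitz i := i.elim
  measurable_mult i := i.elim
  integrable _ i := i.elim
  summable _ := (hasSum_empty).summable

lemma toCurrent_empty : (empty m X n).toCurrent = 0 := by
  ext α
  exact tsum_empty (β := Empty)

/-- The parametrization of the sum of two parametrized currents. -/
def sum (Q : RectParam m X n) : RectParam m X n where
  index := P.index ⊕ Q.index
  countable_index := by
    have := P.countable_index
    have := Q.countable_index
    infer_instance
  dom := Sum.elim P.dom Q.dom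
  map := Sum.elim P.map Q.map
  mult := Sum.elim P.mult Q.mult
  measurableSet_dom := by
    rintro (i | i)
    exacts [P.measurableSet_dom i, Q.measurableSet_dom i]
  lipschitz := by
    rintro (i | i)
    exacts [P.lipschitz i, Q.lipschitz i]
  measurable_mult := by
    rintro (i | i)
    exacts [P.measurable_mult i, Q.measurable_mult i]
  integrable α := by
    rintro (i | i)
    exacts [P.integrable α i, Q.integrable α i]
  summable α := Summable.sum (fun i : P.index ⊕ Q.index =>
    ∫ u in (Sum.elim P.dom Q.dom i : Set (Euc n)), |pushDensity (Sum.elim P.dom Q.dom i)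
      (Sum.elim P.map Q.map i) (Sum.elim P.mult Q.mult i) α u|) (P.summable α) (Q.summable α)

lemma toCurrent_sum (Q : RectParam m X n) :
    (P.sum Q).toCurrent = P.toCurrent + Q.toCurrent := by
  ext α
  exact Summable.tsum_sum (f := fun i : P.index ⊕ Q.index => ∫ u in (P.sum Q).dom i,
    pushDensity ((P.sum Q).dom i) ((P.sum Q).map i) ((P.sum Q).mult i) α u)
    (P.summable_integral α) (Q.summable_integral α)

lemma pushDensity_neg (K : Set (Euc n)) (f : Euc n → X) (θ : Euc n → ℤ) (α : TestForm m X n) :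
    pushDensity K f (-θ) α = -pushDensity K f θ α := by
  funext u
  simp [pushDensity]

/-- The parametrization of the opposite of a parametrized current. -/
def neg : RectParam m X n where
  index := P.index
  countable_index := P.countable_index
  dom := P.dom
  map := P.map
  mult i := -P.mult i
  measurableSet_dom := P.measurableSet_dom
  lipschitz := P.lipschitz
  measurable_mult i := (P.measurable_mult i).neg
  integrable α i := by
    rw [pushDensity_neg]
    exact (P.integrable α i).neg
  summable α := by
    simp only [pushDensity_neg, Pi.neg_apply, abs_neg]
    exact P.summable α

lemma toCurrent_neg : P.neg.toCurrent = -P.toCurrent := by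
  ext α
  change ∑' i, ∫ u in P.dom i, pushDensity (P.dom i) (P.map i) (-P.mult i) α u =
    -∑' i, ∫ u in P.dom i, pushDensity (P.dom i) (P.map i) (P.mult i) α u
  rw [← tsum_neg]
  refine tsum_congr fun i => ?_
  rw [pushDensity_neg, ← integral_neg]
  rfl

end RectParam

section Rectifiable

variable [RiemannianBundle (fun x : X => TangentSpace (𝓡 m) x)]

/-- Integer multiplicity rectifiable `n`-currents of finite mass. -/
def Current.IsRectifiable {n : ℕ} (T : Current m X n) : Prop :=
  (∃ P : RectParam m X n, P.toCurrent = T) ∧ T.mass < ⊤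

lemma Current.mass_zero {n : ℕ} : (0 : Current m X n).mass = 0 := by
  simp [Current.mass]

lemma Current.mass_add_le {n : ℕ} (S T : Current m X n) : (S + T).mass ≤ S.mass + T.mass := by
  refine iSup₂_le fun α hα => ?_
  rw [LinearMap.add_apply]
  refine ENNReal.ofReal_add_le.trans (add_le_add ?_ ?_)
  · exact le_iSup₂ (f := fun (α : TestForm m X n) _ => ENNReal.ofReal (S α)) α hα
  · exact le_iSup₂ (f := fun (α : TestForm m X n) _ => ENNReal.ofReal (T α)) α hα

lemma Current.mass_neg_le {n : ℕ} (T : Current m X n) : (-T).mass ≤ T.mass := by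
  refine iSup₂_le fun α hα => ?_
  rw [LinearMap.neg_apply, ← map_neg]
  refine le_iSup₂ (f := fun (α : TestForm m X n) _ => ENNReal.ofReal (T α)) (-α) fun x v hv => ?_
  have := hα x v hv
  rwa [← abs_neg] at this

lemma Current.IsRectifiable.zero {n : ℕ} : (0 : Current m X n).IsRectifiable :=
  ⟨⟨_, RectParam.toCurrent_empty⟩, by simp [Current.mass_zero]⟩

lemma Current.IsRectifiable.add {n : ℕ} {S T : Current m X n} (hS : S.IsRectifiable)
    (hT : T.IsRectifiable) : (S + T).IsRectifiable := by
  obtain ⟨⟨P, rfl⟩, hP⟩ := hS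
  obtain ⟨⟨Q, rfl⟩, hQ⟩ := hT
  exact ⟨⟨_, P.toCurrent_sum Q⟩, (mass_add_le _ _).trans_lt (ENNReal.add_lt_top.2 ⟨hP, hQ⟩)⟩

lemma Current.IsRectifiable.neg {n : ℕ} {T : Current m X n} (hT : T.IsRectifiable) :
    (-T).IsRectifiable := by
  obtain ⟨⟨P, rfl⟩, hP⟩ := hT
  exact ⟨⟨_, P.toCurrent_neg⟩, (mass_neg_le _).trans_lt hP⟩

end Rectifiable

lemma Current.support_zero {n : ℕ} : (0 : Current m X n).support = ∅ := by
  ext x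
  simp only [mem_empty_iff_false, iff_false]
  intro hx
  obtain ⟨α, -, h⟩ := hx univ isOpen_univ (mem_univ x)
  exact h rfl

lemma Current.support_add {n : ℕ} (S T : Current m X n) :
    (S + T).support ⊆ S.support ∪ T.support := by
  intro x hx
  by_contra hcon
  simp only [mem_union, not_or, support, mem_ofPred_eq, not_forall, not_exists, not_and,
    not_not] at hcon
  obtain ⟨⟨U, hU, hxU, h1⟩, V, hV, hxV, h2⟩ := hcon
  obtain ⟨α, hα, h⟩ := hx (U ∩ V) (hU.inter hV) ⟨hxU, hxV⟩
  refine h ?_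
  rw [LinearMap.add_apply, h1 α (hα.trans inter_subset_left), h2 α (hα.trans inter_subset_right),
    add_zero]

lemma Current.support_neg {n : ℕ} (T : Current m X n) : (-T).support = T.support := by
  simp [support]

open Classical in
/-- The restriction `T ⌞ B` of a current which has a parametrization to a Borel set `B`. It does
not depend on the parametrization. -/
def Current.restrict [MeasurableSpace X] [BorelSpace X] {n : ℕ} (T : Current m X n) (B : Set X) :
    Current m X n :=
  if h : (∃ P : RectParam m X n, P.toCurrent = T) ∧ MeasurableSet B then
    (h.1.choose.restrict B h.2).toCurrent
  else 0

end Currents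

/-! ### First homology, relative filling functions and quasiminimizing currents -/

section Filling

variable {m : ℕ} {X : Type*} [EMetricSpace X] [ChartedSpace (Euc m) X] [IsManifold (𝓡 m) ∞ X]
  [RiemannianBundle (fun x : X => TangentSpace (𝓡 m) x)]

variable (m) in
/-- The group of rectifiable `1`-cycles in `A`. -/
def oneCycles (A : Set X) : AddSubgroup (Current m X 1) where
  carrier := {T | T.IsRectifiable ∧ T.support ⊆ A ∧ T.boundary = 0}
  zero_mem' := ⟨.zero, by simp [Current.support_zero], Current.boundary_zero⟩
  add_mem' := by
    rintro S T ⟨h1, h2, h3⟩ ⟨h4, h5, h6⟩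
    exact ⟨h1.add h4, (Current.support_add S T).trans (union_subset h2 h5), by
      rw [Current.boundary_add, h3, h6, add_zero]⟩
  neg_mem' := by
    rintro T ⟨h1, h2, h3⟩
    exact ⟨h1.neg, by rwa [Current.support_neg], by rw [Current.boundary_neg, h3, neg_zero]⟩

variable (m) in
/-- The group of rectifiable `n`-currents that are null-homologous within `A`: those supported in
`A` which bound a rectifiable `(n+1)`-current supported in `A`. -/
def boundaries (n : ℕ) (A : Set X) : AddSubgroup (Current m X n) where
  carrier := {T | T.IsRectifiable ∧ T.support ⊆ A ∧
    ∃ D : Current m X (n + 1), D.IsRectifiable ∧ D.support ⊆ A ∧ D.boundary = T}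
  zero_mem' := ⟨.zero, by simp [Current.support_zero], 0, .zero, by simp [Current.support_zero],
    Current.boundary_zero⟩
  add_mem' := by
    rintro S T ⟨h1, h2, D, h3, h4, rfl⟩ ⟨h5, h6, E, h7, h8, rfl⟩
    exact ⟨h1.add h5, (Current.support_add _ _).trans (union_subset h2 h6), D + E, h3.add h7,
      (Current.support_add _ _).trans (union_subset h4 h8), Current.boundary_add D E⟩
  neg_mem' := by
    rintro T ⟨h1, h2, D, h3, h4, rfl⟩
    exact ⟨h1.neg, by rwa [Current.support_neg], -D, h3.neg, by rwa [Current.support_neg],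
      Current.boundary_neg D⟩

variable (m) in
/-- The first homology group `H₁(A; ℤ)` of a subset `A`, computed by the complex of integer
multiplicity rectifiable currents supported in `A`: cycles modulo boundaries. -/
abbrev H₁ (A : Set X) : Type _ := oneCycles m A ⧸ (boundaries m 1 A).addSubgroupOf (oneCycles m A)

/-- The homology class in `H₁(A; ℤ)` of a rectifiable `1`-cycle in `A`. -/
def homologyClass {A : Set X} (γ : Current m X 1) (hγ : γ ∈ oneCycles m A) : H₁ m A :=
  QuotientAddGroup.mk ⟨γ, hγ⟩

lemma oneCycles_mono {A B : Set X} (h : A ⊆ B) : oneCycles m A ≤ oneCycles m B :=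
  fun _ hT => ⟨hT.1, hT.2.1.trans h, hT.2.2⟩

/-- The homomorphism `H₁(A; ℤ) → H₁(B; ℤ)` induced by an inclusion `A ⊆ B`. -/
def inclusionMap {A B : Set X} (h : A ⊆ B) : H₁ m A →+ H₁ m B :=
  QuotientAddGroup.map _ _ (AddSubgroup.inclusion (oneCycles_mono h)) (by
    rintro T ⟨h1, h2, D, h3, h4, h5⟩
    exact ⟨h1, h2.trans h, D, h3, h4.trans h, h5⟩)

/-- The open neighborhood `B_R(L)` of the points at distance less than `R` from `L`. -/
def nhd (L : Set X) (R : ℝ≥0∞) : Set X := {x | Metric.infEDist x L < R}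

lemma subset_nhd (L : Set X) {R : ℝ≥0∞} (hR : 0 < R) : L ⊆ nhd L R := fun x hx => by
  simpa [nhd, Metric.infEDist_zero_of_mem hx] using hR

lemma nhd_mono (L : Set X) {r R : ℝ≥0∞} (h : r ≤ R) : nhd L r ⊆ nhd L R :=
  fun _ hx => lt_of_lt_of_le hx h

variable (m) in
/-- `φ` is a filling function for `X` `R`-relative to `L`; only the values of `φ` on `[0, R)`
matter. -/
def IsRelativeFillingFunction (L : Set X) {R : ℝ≥0∞} (hR : 0 < R) (φ : ℝ → ℝ≥0) : Prop :=
  ∃ η : H₁ m (nhd L R) →+ H₁ m L,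
    (∀ c : H₁ m L, η (inclusionMap (subset_nhd L hR) c) = c) ∧
    ∀ ε : ℝ, 0 < ε → ∀ r : ℝ, 0 < r → ∀ hr : ENNReal.ofReal r < R,
      ∀ (γ : Current m X 1) (hγ : γ ∈ oneCycles m (nhd L (ENNReal.ofReal r))),
      ∃ (γ' : Current m X 1) (hγ' : γ' ∈ oneCycles m L) (C : Current m X 2),
        C.IsRectifiable ∧
        homologyClass γ' hγ' = η (homologyClass γ (oneCycles_mono (nhd_mono L hr.le) hγ)) ∧
        C.boundary = γ - γ' ∧
        C.mass < φ r * γ.mass + ENNReal.ofReal ε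

/-- The rectifiable `(n+1)`-current `C` is `Q`-quasiminimizing relative to `L`. Its boundary is
required to be a (rectifiable) chain, supported on `L`. -/
def IsQuasiminimizing [MeasurableSpace X] [BorelSpace X] {n : ℕ} (L : Set X) (Q : ℝ≥0)
    (C : Current m X (n + 1)) : Prop :=
  C.IsRectifiable ∧ C.boundary.IsRectifiable ∧ C.boundary.support ⊆ L ∧
    ∀ B : Set X, MeasurableSet B → L ⊆ B →
      ∀ C' : Current m X (n + 1), C'.IsRectifiable →
        (C.restrict B - C').boundary ∈ boundaries m n L →
        (C.restrict B).mass ≤ Q * C'.mass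

end Filling

end RectCurrent

end

open Set MeasureTheory Topology Manifold Bundle
open scoped ENNReal NNReal ContDiff

noncomputable section

namespace RectCurrent

/-! ### Calculus of test forms in charts -/

section FormCalculus

variable {m : ℕ} {X : Type*} [TopologicalSpace X] [ChartedSpace (Euc m) X]

/-! Let `τ` be the distance to `L` truncated at `b`, and let `f r` be the mass of `C` in `{τ < r}`.
Everything reduces to the differential inequality `f r ≤ Q φ(r) f'(r)` for almost every `r` in `(a,
b)`. Then `log f` is monotone with derivative at least `1 / (Q φ)` almost everywhere, and a monotone
function increases by at least the integral of its derivative (`ofReal_mul_exp_lintegral_le`).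

For the inequality, put `C_r = C ⌞ {τ < r}` and consider the slice `T = ∂C_r - ∂C`. For almost every
`r` it is a rectifiable cycle of mass at most `f'(r)`, and it lies in `B_{r'}(L)` for each `r' > r`.
The chain `C_r` shows that `T` is homologous in `B_R(L)` to `-∂C`, a cycle in `L`. Filling `T` gives
`C'` with `∂C' = T - γ'` and mass at most `φ(r') f'(r) + ε`. Since `η` is a left inverse of the map
induced by inclusion, `γ' + ∂C = ∂(C_r - C')` bounds within `L`. So `C'` competes with `C_r`, and
quasiminimality gives `f r ≤ Q (φ(r') f'(r) + ε)` (`IsQuasiminimizing.sublevelMass_le`). Then `ε →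
0`, and `r'` decreases to `r` at the points where `φ` is continuous from the right, that is, at all
but countably many.

The bulk of the work is the theory of the slices. Currents act on smooth forms only, while `τ` is
merely Lipschitz, so `τ` is approximated on coordinate patches by smooth `w_k`, uniformly Lipschitz
and with differentials of norm at most `1 + ε` (`exists_smoothing`). For a smooth cutoff `Ψ`,
constant near `(-∞, 0]`, the numbers `C(d(Ψ ∘ w_k) ∧ α)` are evaluated in two ways.

By the Leibniz rule they converge to `c₀ ∂C(α) - C(Ψ(τ) dα)`. Combined over the patches by a
partition of unity, the forms have comass at most `sup |Ψ'| (1 + ε)` (Hadamard's inequality) and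
live in an annulus. When `Ψ` drops from `1` to `0` just below `t`, this bounds the slice at `t` by
the derivative of the mass (`abs_slice_le`).

By weak convergence of the derivatives of uniformly Lipschitz functions, the same numbers on each
patch converge to the integral of `d(Ψ ∘ τ) ∧ f^*α` over the parameter domains, pulled back by the
parametrizations (`IsTame.tsum_integral_wedgeDensity`). These domains are cut into pieces on which
`u ↦ (ℓ u, τ (f u))` is bi-Lipschitz, or on which `d(τ ∘ f)` vanishes. The change of variables
formula and Fubini's theorem then express the integral through Lipschitz pieces of curves on the
level sets. Comparing the two evaluations identifies the slices with these curves for almost every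
`t`, first for a countable family of forms and then, both sides being continuous in the
coefficients, for all (`RectParam.ae_exists_slice`). -/

lemma chartRep_apply {n : ℕ} (α : ∀ x : X, TangentSpace (𝓡 m) x [⋀^Fin n]→L[ℝ] ℝ) (x₀ : X)
    (y : Euc m) (w : Fin n → Euc m) : chartRep α x₀ y w =
      α ((extChartAt (𝓡 m) x₀).symm y)
        (fun i => mfderiv 𝓘(ℝ, Euc m) (𝓡 m) (extChartAt (𝓡 m) x₀).symm y (w i)) := rfl

lemma form_congr {m n : ℕ} {X : Type*} (α : X → Euc m [⋀^Fin n]→L[ℝ] ℝ) {p q : X} (h : p = q)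
    {v w : Fin n → Euc m} (hvw : v = w) : α p v = α q w := by
  subst h; subst hvw; rfl

/-- The differential at `x` of a map from a manifold to a vector space. -/
def dAt {F : Type*} [NormedAddCommGroup F] [NormedSpace ℝ F] (u : X → F) (x : X) :
    TangentSpace (𝓡 m) x →L[ℝ] F := mfderiv (𝓡 m) 𝓘(ℝ, F) u x

/-- The differential at `y` of the inverse of the chart at `x₀`. -/
def sAt (x₀ : X) (y : Euc m) : Euc m →L[ℝ] TangentSpace (𝓡 m) ((extChartAt (𝓡 m) x₀).symm y) :=
  mfderiv 𝓘(ℝ, Euc m) (𝓡 m) (extChartAt (𝓡 m) x₀).symm y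

lemma extD_apply {n : ℕ} (α : ∀ x : X, TangentSpace (𝓡 m) x [⋀^Fin n]→L[ℝ] ℝ) (x : X)
    (v : Fin (n + 1) → TangentSpace (𝓡 m) x) :
    extD α x v = extDeriv (chartRep α x) (extChartAt (𝓡 m) x x)
      (fun i => dAt (extChartAt (𝓡 m) x) x (v i)) := rfl

variable [IsManifold (𝓡 m) ∞ X]

lemma mfderiv_symm_mfderiv_extChartAt {x₀ x : X} (hx : x ∈ (extChartAt (𝓡 m) x₀).source)
    (v : TangentSpace (𝓡 m) x) :
    (mfderiv 𝓘(ℝ, Euc m) (𝓡 m) (extChartAt (𝓡 m) x₀).symm (extChartAt (𝓡 m) x₀ x)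
      (dAt (extChartAt (𝓡 m) x₀) x v) : TangentSpace (𝓡 m) _) =
      (show TangentSpace (𝓡 m) ((extChartAt (𝓡 m) x₀).symm (extChartAt (𝓡 m) x₀ x)) from v) := by
  have h1 := mfderivWithin_extChartAt_symm_comp_mfderiv_extChartAt' hx
  rw [ModelWithCorners.range_eq_univ, mfderivWithin_univ] at h1
  exact congrArg (fun L => L v) h1

/-- A form can be recovered from its expression in any chart. -/
lemma form_apply_eq_chartRep {n : ℕ} (α : ∀ x : X, TangentSpace (𝓡 m) x [⋀^Fin n]→L[ℝ] ℝ)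
    {x₀ x : X} (hx : x ∈ (extChartAt (𝓡 m) x₀).source) (v : Fin n → TangentSpace (𝓡 m) x) :
    α x v = chartRep α x₀ (extChartAt (𝓡 m) x₀ x)
      (fun i => dAt (extChartAt (𝓡 m) x₀) x (v i)) := by
  rw [chartRep_apply]
  refine form_congr (m := m) (X := X) α ((extChartAt (𝓡 m) x₀).left_inv hx).symm ?_
  funext i
  exact (mfderiv_symm_mfderiv_extChartAt hx (v i)).symm

lemma contDiffOn_comp_extChartAt_symm {F : Type*} [NormedAddCommGroup F] [NormedSpace ℝ F]
    {u : X → F} (hu : ContMDiff (𝓡 m) 𝓘(ℝ, F) ∞ u) (x₀ : X) :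
    ContDiffOn ℝ ∞ (u ∘ (extChartAt (𝓡 m) x₀).symm) (extChartAt (𝓡 m) x₀).target := by
  rw [← contMDiffOn_iff_contDiffOn]
  exact hu.comp_contMDiffOn (contMDiffOn_extChartAt_symm x₀)

lemma dAt_eq_fderiv_chart {F : Type*} [NormedAddCommGroup F] [NormedSpace ℝ F]
    {u : X → F} (hu : ContMDiff (𝓡 m) 𝓘(ℝ, F) ∞ u) {x₀ x : X}
    (hx : x ∈ (extChartAt (𝓡 m) x₀).source) (v : TangentSpace (𝓡 m) x) :
    dAt u x v =
      fderiv ℝ (u ∘ (extChartAt (𝓡 m) x₀).symm) (extChartAt (𝓡 m) x₀ x)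
        (dAt (extChartAt (𝓡 m) x₀) x v) := by
  have hev : u =ᶠ[𝓝 x] (u ∘ (extChartAt (𝓡 m) x₀).symm) ∘ extChartAt (𝓡 m) x₀ := by
    filter_upwards [(isOpen_extChartAt_source x₀).mem_nhds hx] with y hy
    simp only [Function.comp, (extChartAt (𝓡 m) x₀).left_inv hy]
  have hd : DifferentiableAt ℝ (u ∘ (extChartAt (𝓡 m) x₀).symm) (extChartAt (𝓡 m) x₀ x) :=
    ((contDiffOn_comp_extChartAt_symm hu x₀).contDiffAt
      ((isOpen_extChartAt_target x₀).mem_nhds ((extChartAt (𝓡 m) x₀).map_source hx))).differentiableAt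
      (by simp)
  have h1 : mfderiv (𝓡 m) 𝓘(ℝ, F) u x = (mfderiv 𝓘(ℝ, Euc m) 𝓘(ℝ, F)
      (u ∘ (extChartAt (𝓡 m) x₀).symm) (extChartAt (𝓡 m) x₀ x)).comp
        (mfderiv (𝓡 m) 𝓘(ℝ, Euc m) (extChartAt (𝓡 m) x₀) x) := by
    rw [hev.mfderiv_eq]
    exact mfderiv_comp x hd.mdifferentiableAt (mdifferentiableAt_extChartAt (by simpa using hx))
  rw [mfderiv_eq_fderiv] at h1
  exact congrArg (fun L => L v) h1

/-- The product of a smooth function and a test form. -/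
def TestForm.fmul {n : ℕ} (u : X → ℝ) (hu : ContMDiff (𝓡 m) 𝓘(ℝ, ℝ) ∞ u) (α : TestForm m X n) :
    TestForm m X n :=
  ⟨fun x => u x • α.1 x, by
    refine ⟨fun x₀ => ?_, ?_⟩
    · exact (contDiffOn_comp_extChartAt_symm hu x₀).smul (α.2.1 x₀)
    · refine α.2.2.of_isClosed_subset isClosed_closure (closure_mono fun x hx h0 => hx ?_)
      change u x • α.1 x = 0
      rw [h0, smul_zero]⟩

@[simp] lemma TestForm.fmul_apply {n : ℕ} (u : X → ℝ) (hu : ContMDiff (𝓡 m) 𝓘(ℝ, ℝ) ∞ u)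
    (α : TestForm m X n) (x : X) (v : Fin n → TangentSpace (𝓡 m) x) :
    (TestForm.fmul u hu α).1 x v = u x * α.1 x v := rfl

/-- The Leibniz rule for the exterior derivative of a function times a form. -/
lemma TestForm.d_fmul_apply {n : ℕ} (u : X → ℝ) (hu : ContMDiff (𝓡 m) 𝓘(ℝ, ℝ) ∞ u)
    (α : TestForm m X n) (x : X) (v : Fin (n + 1) → TangentSpace (𝓡 m) x) :
    (TestForm.d n (TestForm.fmul u hu α)).1 x v = u x * (TestForm.d n α).1 x v +
      ∑ i : Fin (n + 1), (-1) ^ (i : ℕ) *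
        (dAt u x (v i) * α.1 x (i.removeNth v)) := by
  have hx := mem_extChartAt_source (I := 𝓡 m) x
  have hmem : (extChartAt (𝓡 m) x).target ∈ 𝓝 (extChartAt (𝓡 m) x x) :=
    (isOpen_extChartAt_target x).mem_nhds (mem_extChartAt_target x)
  have hd1 : DifferentiableAt ℝ (u ∘ (extChartAt (𝓡 m) x).symm) (extChartAt (𝓡 m) x x) :=
    ((contDiffOn_comp_extChartAt_symm hu x).contDiffAt hmem).differentiableAt (by simp)
  have hd2 : DifferentiableAt ℝ (chartRep α.1 x) (extChartAt (𝓡 m) x x) :=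
    ((α.2.1 x).contDiffAt hmem).differentiableAt (by simp)
  have hux : (u ∘ (extChartAt (𝓡 m) x).symm) (extChartAt (𝓡 m) x x) = u x := by
    simp only [Function.comp, (extChartAt (𝓡 m) x).left_inv hx]
  change extD (TestForm.fmul u hu α).1 x v = u x * extD α.1 x v + _
  rw [extD_apply, extD_apply]
  set w : Fin (n + 1) → Euc m :=
    fun i => dAt (extChartAt (𝓡 m) x) x (v i) with hw
  have hrep : chartRep (TestForm.fmul u hu α).1 x =
      (u ∘ (extChartAt (𝓡 m) x).symm) • chartRep α.1 x := rfl
  rw [hrep, extDeriv, extDeriv, fderiv_smul hd1 hd2, hux]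
  simp only [ContinuousAlternatingMap.alternatizeUncurryFin_apply, _root_.add_apply,
    _root_.smul_apply, ContinuousLinearMap.smulRight_apply,
    ContinuousAlternatingMap.add_apply, ContinuousAlternatingMap.smul_apply, smul_add,
    Finset.sum_add_distrib, Finset.mul_sum]
  congr 1
  · refine Finset.sum_congr rfl fun i _ => ?_
    simp only [smul_eq_mul, zsmul_eq_mul, Int.reduceNeg, Int.cast_pow, Int.cast_neg, Int.cast_one]
    ring
  · refine Finset.sum_congr rfl fun i _ => ?_
    rw [dAt_eq_fderiv_chart hu hx (v i), form_apply_eq_chartRep α.1 hx]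
    simp only [smul_eq_mul, zsmul_eq_mul, Int.reduceNeg, Int.cast_pow, Int.cast_neg, Int.cast_one]
    rfl

/-- The exterior derivative squares to zero. -/
lemma TestForm.d_d {n : ℕ} (α : TestForm m X n) : TestForm.d (n + 1) (TestForm.d n α) = 0 := by
  ext1
  funext x
  change extD (extD α.1) x = 0
  have hmem : (extChartAt (𝓡 m) x).target ∈ 𝓝 (extChartAt (𝓡 m) x x) :=
    (isOpen_extChartAt_target x).mem_nhds (mem_extChartAt_target x)
  have hev : chartRep (extD α.1) x =ᶠ[𝓝 (extChartAt (𝓡 m) x x)] extDeriv (chartRep α.1 x) := by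
    filter_upwards [hmem] with y hy using chartRep_extD α.1 α.2.1 x hy
  ext v
  rw [extD_apply, hev.extDeriv_eq,
    extDeriv_extDeriv_apply ((α.2.1 x).contDiffAt hmem) two_le_smooth]
  rfl

/-- A smooth compactly supported function, as a test form of degree zero. -/
def TestForm.ofFun (u : X → ℝ) (hu : ContMDiff (𝓡 m) 𝓘(ℝ, ℝ) ∞ u) (hc : HasCompactSupport u) :
    TestForm m X 0 :=
  ⟨fun x => ContinuousAlternatingMap.constOfIsEmpty ℝ (TangentSpace (𝓡 m) x) (Fin 0) (u x), by
    refine ⟨fun x₀ => ?_, ?_⟩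
    · have h : chartRep (fun x => ContinuousAlternatingMap.constOfIsEmpty ℝ
          (TangentSpace (𝓡 m) x) (Fin 0) (u x)) x₀ = fun y =>
          ContinuousAlternatingMap.constOfIsEmptyLIE ℝ (Euc m) ℝ (Fin 0)
            ((u ∘ (extChartAt (𝓡 m) x₀).symm) y) := rfl
      rw [h]
      exact (ContinuousAlternatingMap.constOfIsEmptyLIE ℝ (Euc m) ℝ
        (Fin 0)).toContinuousLinearEquiv.contDiff.comp_contDiffOn (contDiffOn_comp_extChartAt_symm hu x₀)
    · refine hc.of_isClosed_subset isClosed_closure (closure_mono fun x hx h0 => hx ?_)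
      ext v
      exact h0⟩

lemma TestForm.d_ofFun_apply (u : X → ℝ) (hu : ContMDiff (𝓡 m) 𝓘(ℝ, ℝ) ∞ u)
    (hc : HasCompactSupport u) (x : X) (v : Fin 1 → TangentSpace (𝓡 m) x) :
    (TestForm.d 0 (TestForm.ofFun u hu hc)).1 x v = dAt u x (v 0) := by
  have hx := mem_extChartAt_source (I := 𝓡 m) x
  change extD (TestForm.ofFun u hu hc).1 x v = _
  rw [extD_apply, dAt_eq_fderiv_chart hu hx (v 0)]
  have h : chartRep (TestForm.ofFun u hu hc).1 x = fun y =>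
      ContinuousAlternatingMap.constOfIsEmpty ℝ (Euc m) (Fin 0)
        ((u ∘ (extChartAt (𝓡 m) x).symm) y) := rfl
  rw [h, extDeriv_constOfIsEmpty]
  rfl

/-- The differential of a smooth compactly supported function, as a test form. -/
def TestForm.dfun (u : X → ℝ) (hu : ContMDiff (𝓡 m) 𝓘(ℝ, ℝ) ∞ u) (hc : HasCompactSupport u) :
    TestForm m X 1 := TestForm.d 0 (TestForm.ofFun u hu hc)

lemma TestForm.dfun_apply (u : X → ℝ) (hu : ContMDiff (𝓡 m) 𝓘(ℝ, ℝ) ∞ u)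
    (hc : HasCompactSupport u) (x : X) (v : Fin 1 → TangentSpace (𝓡 m) x) :
    (TestForm.dfun u hu hc).1 x v = dAt u x (v 0) :=
  TestForm.d_ofFun_apply u hu hc x v

/-- The product `du ∧ α` of the differential of a smooth function and a test form. -/
def TestForm.dwedge (u : X → ℝ) (hu : ContMDiff (𝓡 m) 𝓘(ℝ, ℝ) ∞ u) (α : TestForm m X 1) :
    TestForm m X 2 :=
  TestForm.d 1 (TestForm.fmul u hu α) - TestForm.fmul u hu (TestForm.d 1 α)

lemma TestForm.dwedge_apply (u : X → ℝ) (hu : ContMDiff (𝓡 m) 𝓘(ℝ, ℝ) ∞ u) (α : TestForm m X 1)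
    (x : X) (v : Fin 2 → TangentSpace (𝓡 m) x) :
    (TestForm.dwedge u hu α).1 x v =
      dAt u x (v 0) * α.1 x (fun _ => v 1) -
        dAt u x (v 1) * α.1 x (fun _ => v 0) := by
  have h : (TestForm.dwedge u hu α).1 x v =
      (TestForm.d 1 (TestForm.fmul u hu α)).1 x v - u x * (TestForm.d 1 α).1 x v := rfl
  rw [h, TestForm.d_fmul_apply, Fin.sum_univ_two]
  have h0 : (0 : Fin 2).removeNth v = fun _ => v 1 := by
    funext i; fin_cases i; rfl
  have h1 : (1 : Fin 2).removeNth v = fun _ => v 0 := by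
    funext i; fin_cases i; rfl
  rw [h0, h1]
  simp
  ring

end FormCalculus

/-! ### The boundary of a boundary -/

section Boundary

variable {m : ℕ} {X : Type*} [EMetricSpace X] [ChartedSpace (Euc m) X] [IsManifold (𝓡 m) ∞ X]

lemma Current.boundary_boundary {n : ℕ} (T : Current m X (n + 2)) : T.boundary.boundary = 0 := by
  ext α
  change T (TestForm.d (n + 1) (TestForm.d n α)) = 0
  rw [TestForm.d_d, map_zero]

end Boundary

/-! ### Charts and the Riemannian distance -/

section RiemannianGeometry

variable {m : ℕ} {X : Type*} [EMetricSpace X] [ChartedSpace (Euc m) X] [IsManifold (𝓡 m) ∞ X]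
  [RiemannianBundle (fun x : X => TangentSpace (𝓡 m) x)]
  [IsContinuousRiemannianBundle (Euc m) (fun x : X => TangentSpace (𝓡 m) x)]

/-- The function `N` is the Riemannian norm at `x₀` read in the chart. By continuity of the metric,
near `x₀` the differentials of the chart and of its inverse distort norms by at most `r` relative to
this fixed `N`. The Euclidean norm would only give some constant, not one close to `1`. -/
lemma exists_almost_isometric_chart (x₀ : X) {r : ℝ} (hr : 1 < r) :
    ∃ (N : Euc m → ℝ) (C : ℝ), 0 ≤ C ∧ (∀ e, 0 ≤ N e ∧ N e ≤ C * ‖e‖) ∧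
      (∀ (t : ℝ) e, N (t • e) = |t| * N e) ∧
      (∀ᶠ y in 𝓝 x₀, ∀ v : TangentSpace (𝓡 m) y, N (dAt (extChartAt (𝓡 m) x₀) y v) ≤ r * ‖v‖) ∧
      ∀ᶠ z in 𝓝 (extChartAt (𝓡 m) x₀ x₀), ∀ e : Euc m,
        ‖sAt x₀ z e‖ ≤ r * N e := by
  let E : X → Type := fun x => TangentSpace (𝓡 m) x
  let t := trivializationAt (Euc m) E x₀
  let S : Euc m →L[ℝ] E x₀ := t.symmL ℝ x₀
  have hsmul : ∀ (a : ℝ) (e : Euc m), ‖S (a • e)‖ = |a| * ‖S e‖ := fun a e => by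
    rw [map_smul, norm_smul, Real.norm_eq_abs]
  refine ⟨fun e => ‖S e‖, ‖S‖, S.opNorm_nonneg, fun e => ⟨norm_nonneg (S e), S.le_opNorm e⟩,
    hsmul, ?_, ?_⟩
  · filter_upwards [eventually_norm_symmL_trivializationAt_self_comp_lt (Euc m) E x₀ hr,
      chart_source_mem_nhds (Euc m) x₀] with y hy hy2 v
    have h := (ContinuousLinearMap.le_opNorm (t.symmL ℝ x₀ ∘L t.continuousLinearMapAt ℝ y) v).trans
      (mul_le_mul_of_nonneg_right hy.le (norm_nonneg _))
    have h2 := TangentBundle.continuousLinearMapAt_trivializationAt (I := 𝓡 m) hy2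
    have h3 : dAt (extChartAt (𝓡 m) x₀) y v = t.continuousLinearMapAt ℝ y v :=
      congrArg (fun L => L v) h2.symm
    rw [h3]
    exact h
  · have h1 : ∀ᶠ y in 𝓝 x₀, ∀ e : Euc m, ‖(show E y from sAt x₀ (extChartAt (𝓡 m) x₀ y) e)‖ ≤
          r * ‖S e‖ := by
      filter_upwards [eventually_norm_symmL_trivializationAt_comp_self_lt (Euc m) E x₀ hr,
        chart_source_mem_nhds (Euc m) x₀] with y hy hy2 e
      have h := (ContinuousLinearMap.le_opNorm (t.symmL ℝ y ∘L t.continuousLinearMapAt ℝ x₀)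
        (S e)).trans (mul_le_mul_of_nonneg_right hy.le (norm_nonneg _))
      have h0 : t.continuousLinearMapAt ℝ x₀ (S e) = e :=
        t.continuousLinearMapAt_symmL (FiberBundle.mem_baseSet_trivializationAt' x₀) e
      have h2 := TangentBundle.symmL_trivializationAt (𝕜 := ℝ) (I := 𝓡 m) hy2
      rw [ModelWithCorners.range_eq_univ, mfderivWithin_univ] at h2
      rw [ContinuousLinearMap.comp_apply, h0] at h
      have h3 : ‖t.symmL ℝ y e‖ = ‖(show E y from sAt x₀ (extChartAt (𝓡 m) x₀ y) e)‖ :=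
        congrArg (fun L : Euc m →L[ℝ] Euc m => ‖(show E y from L e)‖) h2
      rw [← h3]
      exact h
    have hc : Filter.Tendsto (extChartAt (𝓡 m) x₀).symm (𝓝 (extChartAt (𝓡 m) x₀ x₀)) (𝓝 x₀) := by
      have := continuousAt_extChartAt_symm (I := 𝓡 m) x₀
      rwa [ContinuousAt, extChartAt_to_inv] at this
    filter_upwards [hc.eventually h1,
      (isOpen_extChartAt_target x₀).mem_nhds (mem_extChartAt_target x₀)] with z hz hz2 e
    have h5 := hz e
    -- The two points are only propositionally equal, and the fibres depend on them; the claim is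
    -- stated for a variable `z'` so that the equality can be substituted.
    have h6 : ∀ z' (h : z' = z), ‖(show E ((extChartAt (𝓡 m) x₀).symm z) from sAt x₀ z' e)‖ =
        ‖sAt x₀ z e‖ := by
      rintro z' rfl; rfl
    rwa [h6 _ ((extChartAt (𝓡 m) x₀).right_inv hz2)] at h5

variable [IsRiemannianManifold (𝓡 m) X]

/-- A smooth map whose differential has norm at most `C > 0` is `C`-Lipschitz for the Riemannian
distance. -/
lemma lipschitzWith_of_dAt_le {F : Type*} [NormedAddCommGroup F] [NormedSpace ℝ F] {u : X → F}
    (hu : ContMDiff (𝓡 m) 𝓘(ℝ, F) ∞ u) {C : ℝ≥0} (hC : 0 < C)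
    (h : ∀ x (v : TangentSpace (𝓡 m) x), ‖dAt u x v‖ ≤ C * ‖v‖) : LipschitzWith C u := by
  intro x y
  have hC0 : (C : ℝ≥0∞) ≠ 0 := by simpa using hC.ne'
  rw [← ENNReal.div_le_iff' hC0 ENNReal.coe_ne_top, IsRiemannianManifold.out (I := 𝓡 m) x y]
  -- The distance is an infimum of lengths of `C¹` paths. Along a path of length less than `r`, the
  -- increment of `u` is at most the integral of `‖du(γ')‖`, hence at most `C r`.
  refine le_of_forall_gt_imp_ge_of_dense fun r hr => ?_
  rw [ENNReal.div_le_iff' hC0 ENNReal.coe_ne_top]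
  obtain ⟨γ, h0, h1, hγ, hlen⟩ := exists_lt_of_riemannianEDist_lt hr
  refine le_trans ?_ (mul_le_mul_right hlen.le _)
  have hsm : ContDiffOn ℝ 1 (u ∘ γ) (Icc 0 1) := by
    rw [← contMDiffOn_iff_contDiffOn]
    exact (hu.of_le (by exact_mod_cast le_top)).comp_contMDiffOn hγ
  rw [edist_comm, edist_eq_enorm_sub, ← h0, ← h1]
  refine (enorm_sub_le_lintegral_derivWithin_Icc_of_contDiffOn_Icc hsm zero_le_one).trans ?_
  rw [pathELength_eq_lintegral_mfderivWithin_Icc, ← lintegral_const_mul' _ _ ENNReal.coe_ne_top]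
  refine setLIntegral_mono' measurableSet_Icc fun t ht => ?_
  have hd : mfderivWithin 𝓘(ℝ, ℝ) 𝓘(ℝ, F) (u ∘ γ) (Icc 0 1) t =
      (mfderiv (𝓡 m) 𝓘(ℝ, F) u (γ t)).comp (mfderivWithin 𝓘(ℝ, ℝ) (𝓡 m) γ (Icc 0 1) t) := by
    refine mfderiv_comp_mfderivWithin t (hu.mdifferentiable (by simp) _)
      (hγ.mdifferentiableOn one_ne_zero t ht) ?_
    rw [uniqueMDiffWithinAt_iff_uniqueDiffWithinAt]
    exact uniqueDiffOn_Icc zero_lt_one t ht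
  rw [mfderivWithin_eq_fderivWithin] at hd
  have hd2 : derivWithin (u ∘ γ) (Icc 0 1) t =
      dAt u (γ t) (mfderivWithin 𝓘(ℝ, ℝ) (𝓡 m) γ (Icc 0 1) t 1) :=
    congrArg (fun L => L (1 : ℝ)) hd
  rw [hd2]
  have h3 := h (γ t) (mfderivWithin 𝓘(ℝ, ℝ) (𝓡 m) γ (Icc 0 1) t 1)
  rw [← ofReal_norm, ← ofReal_norm, ← ENNReal.ofReal_coe_nnreal,
    ← ENNReal.ofReal_mul C.coe_nonneg]
  exact ENNReal.ofReal_le_ofReal h3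

-- In the chart, `du` is the derivative of `u ∘ chart⁻¹`, which is continuous, composed with the
-- differential of the chart, which is locally bounded because the metric is continuous.
omit [IsRiemannianManifold (𝓡 m) X] in
lemma eventually_dAt_le {F : Type*} [NormedAddCommGroup F] [NormedSpace ℝ F] {u : X → F}
    (hu : ContMDiff (𝓡 m) 𝓘(ℝ, F) ∞ u) (x₀ : X) :
    ∃ C : ℝ, ∀ᶠ x in 𝓝 x₀, ∀ v : TangentSpace (𝓡 m) x, ‖dAt u x v‖ ≤ C * ‖v‖ := by
  obtain ⟨C, hC, h⟩ : ∃ C > 0, ∀ᶠ y in 𝓝 x₀, ∀ v : TangentSpace (𝓡 m) y,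
      ‖dAt (extChartAt (𝓡 m) x₀) y v‖ ≤ C * ‖v‖ := by
    let E : X → Type := fun x => TangentSpace (𝓡 m) x
    let t := trivializationAt (Euc m) E x₀
    obtain ⟨C, hC, h⟩ := eventually_norm_trivializationAt_lt (Euc m) E x₀
    refine ⟨C, hC, ?_⟩
    filter_upwards [h, chart_source_mem_nhds (Euc m) x₀] with y hy hy2 v
    have h := (ContinuousLinearMap.le_opNorm (t.continuousLinearMapAt ℝ y) v).trans
      (mul_le_mul_of_nonneg_right hy.le (norm_nonneg _))
    have h2 := TangentBundle.continuousLinearMapAt_trivializationAt (I := 𝓡 m) hy2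
    have h3 : dAt (extChartAt (𝓡 m) x₀) y v = t.continuousLinearMapAt ℝ y v :=
      congrArg (fun L => L v) h2.symm
    rw [h3]
    exact h
  set w := u ∘ (extChartAt (𝓡 m) x₀).symm
  have hcont : ContinuousAt (fun x => ‖fderiv ℝ w (extChartAt (𝓡 m) x₀ x)‖) x₀ := by
    have h1 : ContinuousOn (fderiv ℝ w) (extChartAt (𝓡 m) x₀).target :=
      (contDiffOn_comp_extChartAt_symm hu x₀).continuousOn_fderiv_of_isOpen
        (isOpen_extChartAt_target x₀) (by simp)
    have h2 := h1.continuousAt ((isOpen_extChartAt_target x₀).mem_nhds (mem_extChartAt_target x₀))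
    exact (ContinuousAt.comp (g := fderiv ℝ w) h2 (continuousAt_extChartAt x₀)).norm
  refine ⟨(‖fderiv ℝ w (extChartAt (𝓡 m) x₀ x₀)‖ + 1) * C, ?_⟩
  filter_upwards [h, hcont.eventually (gt_mem_nhds (lt_add_one _)),
    extChartAt_source_mem_nhds (I := 𝓡 m) x₀] with x h1 h2 h3 v
  rw [dAt_eq_fderiv_chart hu h3, mul_assoc]
  exact (ContinuousLinearMap.le_opNorm _ _).trans
    (mul_le_mul h2.le (h1 v) (norm_nonneg _) (by positivity))

omit [IsRiemannianManifold (𝓡 m) X] in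
/-- On a compact set, the differential of a smooth map is bounded. -/
lemma exists_dAt_le_of_isCompact {F : Type*} [NormedAddCommGroup F] [NormedSpace ℝ F] {u : X → F}
    (hu : ContMDiff (𝓡 m) 𝓘(ℝ, F) ∞ u) {Z : Set X} (hZ : IsCompact Z) :
    ∃ C : ℝ≥0, 0 < C ∧ ∀ x ∈ Z, ∀ v : TangentSpace (𝓡 m) x, ‖dAt u x v‖ ≤ C * ‖v‖ := by
  refine hZ.induction_on (p := fun Z => ∃ C : ℝ≥0, 0 < C ∧ ∀ x ∈ Z, ∀ v : TangentSpace (𝓡 m) x,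
    ‖dAt u x v‖ ≤ C * ‖v‖) ⟨1, one_pos, by simp⟩ ?_ ?_ ?_
  · rintro s t hst ⟨C, hC, h⟩
    exact ⟨C, hC, fun x hx => h x (hst hx)⟩
  · rintro s t ⟨C, hC, h⟩ ⟨D, hD, h'⟩
    refine ⟨max C D, lt_max_of_lt_left hC, ?_⟩
    rintro x (hx | hx) v
    · exact (h x hx v).trans (mul_le_mul_of_nonneg_right (by simp) (norm_nonneg _))
    · exact (h' x hx v).trans (mul_le_mul_of_nonneg_right (by simp) (norm_nonneg _))
  · intro x _
    obtain ⟨C, hC⟩ := eventually_dAt_le hu x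
    refine ⟨_, mem_nhdsWithin_of_mem_nhds hC, (Real.toNNReal C + 1), by positivity,
      fun y hy v => (hy v).trans (mul_le_mul_of_nonneg_right ?_ (norm_nonneg _))⟩
    push_cast
    exact (Real.le_coe_toNNReal C).trans (by linarith)

/-- The differential is bounded on the compact support and zero off it, so the bound is global. -/
lemma exists_lipschitzWith_of_hasCompactSupport {F : Type*} [NormedAddCommGroup F]
    [NormedSpace ℝ F] {u : X → F} (hu : ContMDiff (𝓡 m) 𝓘(ℝ, F) ∞ u) (hc : HasCompactSupport u) :
    ∃ C : ℝ≥0, LipschitzWith C u := by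
  obtain ⟨C, hC, h⟩ := exists_dAt_le_of_isCompact hu hc
  refine ⟨C, lipschitzWith_of_dAt_le hu hC fun x v => ?_⟩
  by_cases hx : x ∈ tsupport u
  · exact h x hx v
  · have hev : u =ᶠ[𝓝 x] fun _ => 0 := by
      filter_upwards [(isClosed_tsupport u).isOpen_compl.mem_nhds hx] with y hy
      exact image_eq_zero_of_notMem_tsupport hy
    have : dAt u x v = 0 := by
      have h1 := hev.mfderiv_eq (I := 𝓡 m) (I' := 𝓘(ℝ, F))
      rw [mfderiv_const] at h1
      exact congrArg (fun L => L v) h1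
    rw [this, norm_zero]
    positivity

/-- Around every point there is a smooth, compactly supported and Lipschitz map to the model space
which coincides with the chart near that point. -/
lemma exists_lipschitz_chart_extension (x₀ : X) :
    ∃ u : X → Euc m, ContMDiff (𝓡 m) 𝓘(ℝ, Euc m) ∞ u ∧ HasCompactSupport u ∧
      (∃ C : ℝ≥0, LipschitzWith C u) ∧ ∀ᶠ x in 𝓝 x₀, u x = extChartAt (𝓡 m) x₀ x := by
  obtain ⟨χ⟩ : Nonempty (SmoothBumpFunction (𝓡 m) x₀) := inferInstance
  have hu := χ.contMDiff_smul (g := extChartAt (𝓡 m) x₀) (G := Euc m) contMDiffOn_extChartAt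
  have hc : HasCompactSupport fun x => χ x • extChartAt (𝓡 m) x₀ x := χ.hasCompactSupport.smul_right
  refine ⟨_, hu, hc, exists_lipschitzWith_of_hasCompactSupport hu hc, ?_⟩
  filter_upwards [χ.eventuallyEq_one] with x hx
  rw [hx, Pi.one_apply, one_smul]

/-- The inverse chart carries the segment to a path of speed `‖sAt x₀ y (z' - z)‖`, hence of length
at most `C`. -/
lemma edist_extChartAt_symm_le (x₀ : X) {z z' : Euc m} {C : ℝ}
    (hseg : segment ℝ z z' ⊆ (extChartAt (𝓡 m) x₀).target)
    (hC : ∀ y ∈ segment ℝ z z', ‖sAt x₀ y (z' - z)‖ ≤ C) :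
    edist ((extChartAt (𝓡 m) x₀).symm z) ((extChartAt (𝓡 m) x₀).symm z') ≤ ENNReal.ofReal C := by
  rw [IsRiemannianManifold.out (I := 𝓡 m)]
  let η := ContinuousAffineMap.lineMap (R := ℝ) z z'
  have hη : ∀ t ∈ Icc (0 : ℝ) 1, η t ∈ segment ℝ z z' := by
    intro t ht
    rw [segment_eq_image_lineMap]
    exact ⟨t, ht, rfl⟩
  set γ := (extChartAt (𝓡 m) x₀).symm ∘ η
  have η_smooth : ContMDiffOn 𝓘(ℝ, ℝ) 𝓘(ℝ, Euc m) 1 η (Icc 0 1) := by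
    apply ContMDiff.contMDiffOn
    rw [contMDiff_iff_contDiff]
    exact ContinuousAffineMap.contDiff _
  have hlen : riemannianEDist (𝓡 m) ((extChartAt (𝓡 m) x₀).symm z)
      ((extChartAt (𝓡 m) x₀).symm z') ≤ pathELength (𝓡 m) γ 0 1 := by
    apply riemannianEDist_le_pathELength _ _ _ zero_le_one
    · exact (contMDiffOn_extChartAt_symm x₀).comp η_smooth fun t ht => hseg (hη t ht)
    · simp [γ, η, ContinuousAffineMap.coe_lineMap_eq]
    · simp [γ, η, ContinuousAffineMap.coe_lineMap_eq]
  refine hlen.trans ?_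
  rw [pathELength_eq_lintegral_mfderivWithin_Icc]
  have h1 : ∫⁻ t in Icc (0 : ℝ) 1, ENNReal.ofReal C = ENNReal.ofReal C := by simp
  rw [← h1]
  refine setLIntegral_mono' measurableSet_Icc fun t ht => ?_
  have hd : mfderivWithin 𝓘(ℝ, ℝ) (𝓡 m) γ (Icc 0 1) t =
      (mfderiv 𝓘(ℝ, Euc m) (𝓡 m) (extChartAt (𝓡 m) x₀).symm (η t)).comp
        (mfderivWithin 𝓘(ℝ, ℝ) 𝓘(ℝ, Euc m) η (Icc 0 1) t) := by
    refine mfderiv_comp_mfderivWithin t ?_ (η_smooth.mdifferentiableOn one_ne_zero t ht) ?_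
    · have := mdifferentiableWithinAt_extChartAt_symm (I := 𝓡 m) (hseg (hη t ht))
      rwa [ModelWithCorners.range_eq_univ, mdifferentiableWithinAt_univ] at this
    · rw [uniqueMDiffWithinAt_iff_uniqueDiffWithinAt]
      exact uniqueDiffOn_Icc zero_lt_one t ht
  have hd2 : fderivWithin ℝ η (Icc 0 1) t 1 = z' - z := by
    rw [fderivWithin_eq_fderiv (uniqueDiffOn_Icc zero_lt_one _ ht)
      (ContinuousAffineMap.differentiableAt _)]
    simp [η]
  have hd3 : (mfderivWithin 𝓘(ℝ, ℝ) (𝓡 m) γ (Icc 0 1) t 1 : TangentSpace (𝓡 m) (γ t)) =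
      sAt x₀ (η t) (z' - z) := by
    rw [mfderivWithin_eq_fderivWithin] at hd
    rw [← hd2]
    exact congrArg (fun L => L (1 : ℝ)) hd
  rw [hd3, ← ofReal_norm]
  exact ENNReal.ofReal_le_ofReal (hC _ (hη t ht))

end RiemannianGeometry

/-! ### Smooth approximation of Lipschitz functions -/

section Smoothing

/-- Mollification of a Lipschitz function. -/
lemma exists_mollification {n : ℕ} {g : Euc n → ℝ} {C : ℝ≥0} (hg : LipschitzWith C g) {δ : ℝ}
    (hδ : 0 < δ) : ∃ w : Euc n → ℝ, ContDiff ℝ ∞ w ∧ LipschitzWith C w ∧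
      (∀ y, |w y - g y| ≤ C * δ) ∧
      ∀ y e b, (∀ z, dist z y < δ → |g (z + e) - g z| ≤ b) → |w (y + e) - w y| ≤ b := by
  let φ : ContDiffBump (0 : Euc n) := ⟨δ / 2, δ, half_pos hδ, half_lt_self hδ⟩
  let k : Euc n → ℝ := φ.normed volume
  have hk0 : ∀ t, 0 ≤ k t := φ.nonneg_normed
  have hkc : HasCompactSupport k := φ.hasCompactSupport_normed
  have hks : ContDiff ℝ ∞ k := φ.contDiff_normed
  have hki : ∫ t, k t = 1 := φ.integral_normed
  have hsupp : ∀ t, k t ≠ 0 → ‖t‖ < δ := by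
    intro t ht
    have : t ∈ Function.support k := ht
    rw [φ.support_normed_eq, mem_ball_zero_iff] at this
    exact this
  let w : Euc n → ℝ := convolution k g (ContinuousLinearMap.lsmul ℝ ℝ) volume
  have hw : ∀ y, w y = ∫ t, k t * g (y - t) := fun y => rfl
  have hint : ∀ y, Integrable fun t => k t * g (y - t) := fun y =>
    (hks.continuous.mul (hg.continuous.comp (continuous_const.sub continuous_id))
      ).integrable_of_hasCompactSupport hkc.mul_right
  have hkint : Integrable k := hks.continuous.integrable_of_hasCompactSupport hkc
  -- Mollification averages the increments of `g` in the fixed direction `e` over points at distance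
  -- less than `δ` from `y`. Any bound for them, in particular one that depends on the direction and
  -- holds only near `y`, is inherited by `w`.
  have key : ∀ y e b, (∀ z, dist z y < δ → |g (z + e) - g z| ≤ b) → |w (y + e) - w y| ≤ b := by
    intro y e b hb
    rw [hw, hw, ← integral_sub (hint _) (hint _), ← Real.norm_eq_abs]
    have hle : ∀ t, ‖k t * g (y + e - t) - k t * g (y - t)‖ ≤ k t * b := by
      intro t
      by_cases ht : k t = 0
      · simp [ht]
      · rw [← mul_sub, norm_mul, Real.norm_eq_abs, abs_of_nonneg (hk0 t), Real.norm_eq_abs]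
        refine mul_le_mul_of_nonneg_left ?_ (hk0 t)
        have := hb (y - t) (by simpa [dist_eq_norm] using hsupp t ht)
        rwa [sub_add_eq_add_sub] at this
    refine (norm_integral_le_of_norm_le (hkint.mul_const b) (Filter.Eventually.of_forall hle)).trans ?_
    rw [integral_mul_const, hki, one_mul]
  refine ⟨w, hkc.contDiff_convolution_left _ hks hg.continuous.locallyIntegrable, ?_, ?_, key⟩
  · refine LipschitzWith.of_dist_le_mul fun x y => ?_
    have := key y (x - y) (C * dist x y) fun z _ => by
      have := hg.dist_le_mul (z + (x - y)) z
      rwa [Real.dist_eq, dist_eq_norm, add_sub_cancel_left, ← dist_eq_norm] at this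
    rwa [add_sub_cancel, ← Real.dist_eq] at this
  · intro y
    refine φ.dist_normed_convolution_le (μ := volume) hg.continuous.aestronglyMeasurable
      fun x hx => ?_
    refine (hg.dist_le_mul x y).trans (mul_le_mul_of_nonneg_left ?_ C.coe_nonneg)
    exact (Metric.mem_ball.1 hx).le

variable {m : ℕ} {X : Type*} [EMetricSpace X] [ChartedSpace (Euc m) X] [IsManifold (𝓡 m) ∞ X]
  [RiemannianBundle (fun x : X => TangentSpace (𝓡 m) x)]
  [IsContinuousRiemannianBundle (Euc m) (fun x : X => TangentSpace (𝓡 m) x)]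
  [IsRiemannianManifold (𝓡 m) X]

/-- Near every point, real `1`-Lipschitz functions are uniform limits of smooth, uniformly Lipschitz
functions with differentials of norm at most `1 + ε`. -/
lemma exists_smoothing (x₀ : X) {ε : ℝ} (hε : 0 < ε) :
    ∃ (U : Set X) (K : ℝ≥0), IsOpen U ∧ x₀ ∈ U ∧ ∀ τ : X → ℝ, LipschitzWith 1 τ → ∀ δ > 0,
      ∃ w : X → ℝ, ContMDiff (𝓡 m) 𝓘(ℝ, ℝ) ∞ w ∧ LipschitzWith K w ∧ (∀ x ∈ U, |w x - τ x| ≤ δ) ∧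
        ∀ x ∈ U, ∀ v : TangentSpace (𝓡 m) x, |dAt w x v| ≤ (1 + ε) * ‖v‖ := by
  obtain ⟨r, hr1, hr2⟩ : ∃ r : ℝ, 1 < r ∧ r * r ≤ 1 + ε := by
    -- One factor `r` is lost in comparing `τ` with `N` in the chart, another in comparing `N` with
    -- the Riemannian norm.
    refine ⟨√(1 + ε), ?_, (Real.mul_self_sqrt (by linarith)).le⟩
    rw [Real.lt_sqrt zero_le_one]; linarith
  have hr0 : 0 < r := zero_lt_one.trans hr1
  obtain ⟨N, C, hC0, hN, hNs, hN1, hN2⟩ := exists_almost_isometric_chart (m := m) x₀ hr1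
  obtain ⟨u, hu, huc, ⟨Cu, hCu⟩, hux⟩ := exists_lipschitz_chart_extension (m := m) x₀
  set φ := extChartAt (𝓡 m) x₀ with hφ
  -- Three times `ρ`: once for the point, once for the radius of mollification, once for the
  -- increment `t • e`.
  obtain ⟨ρ, hρ, hball⟩ : ∃ ρ > 0, Metric.ball (φ x₀) (3 * ρ) ⊆
      {z | z ∈ φ.target ∧ ∀ e : Euc m, ‖sAt x₀ z e‖ ≤ r * N e} := by
    obtain ⟨ρ, hρ, h⟩ := Metric.mem_nhds_iff.1
      (Filter.inter_mem ((isOpen_extChartAt_target x₀).mem_nhds (mem_extChartAt_target x₀)) hN2)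
    refine ⟨ρ / 3, by positivity, ?_⟩
    rw [mul_div_cancel₀ _ (by norm_num : (3 : ℝ) ≠ 0)]
    exact h
  obtain ⟨W, hW, hWo, hxW⟩ := mem_nhds_iff.1 (Filter.inter_mem hN1 (Filter.inter_mem hux
    (Filter.inter_mem (extChartAt_source_mem_nhds (I := 𝓡 m) x₀)
    ((continuousAt_extChartAt (I := 𝓡 m) x₀).preimage_mem_nhds (Metric.ball_mem_nhds _ hρ)))))
  set CL : ℝ≥0 := Real.toNNReal (r * C) with hCL
  refine ⟨W, CL * Cu, hWo, hxW, fun τ hτ δ hδ => ?_⟩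
  have hτ2 : ∀ z ∈ Metric.ball (φ x₀) (3 * ρ), ∀ z' ∈ Metric.ball (φ x₀) (3 * ρ),
      |τ (φ.symm z') - τ (φ.symm z)| ≤ r * N (z' - z) := by
    intro z hz z' hz'
    have hseg : segment ℝ z z' ⊆ Metric.ball (φ x₀) (3 * ρ) :=
      (convex_ball _ _).segment_subset hz hz'
    have h1 := edist_extChartAt_symm_le x₀ (fun y hy => (hball (hseg hy)).1)
      (fun y hy => (hball (hseg hy)).2 (z' - z))
    have h2 : edist (τ (φ.symm z)) (τ (φ.symm z')) ≤ ENNReal.ofReal (r * N (z' - z)) :=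
      (hτ _ _).trans (by rw [ENNReal.coe_one, one_mul]; exact h1)
    have h3 : 0 ≤ r * N (z' - z) := mul_nonneg hr0.le (hN _).1
    rw [edist_dist, ENNReal.ofReal_le_ofReal_iff h3, Real.dist_eq, abs_sub_comm] at h2
    exact h2
  have hlip : LipschitzOnWith CL (τ ∘ φ.symm) (Metric.ball (φ x₀) (3 * ρ)) := by
    refine LipschitzOnWith.of_dist_le_mul fun z hz z' hz' => ?_
    rw [hCL, Real.coe_toNNReal _ (by positivity), dist_eq_norm z, Real.dist_eq, mul_assoc]
    exact (hτ2 z' hz' z hz).trans (mul_le_mul_of_nonneg_left (hN _).2 hr0.le)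
  obtain ⟨g, hg, hgeq⟩ := hlip.extend_real
  obtain ⟨δ', hδ'0, hδ'ρ, hδ'⟩ : ∃ δ' : ℝ, 0 < δ' ∧ δ' ≤ ρ ∧ CL * δ' ≤ δ := by
    refine ⟨min ρ (δ / (CL + 1)), by positivity, min_le_left _ _, ?_⟩
    calc (CL : ℝ) * min ρ (δ / (CL + 1)) ≤ (CL + 1) * (δ / (CL + 1)) :=
          mul_le_mul (by linarith) (min_le_right _ _) (by positivity) (by positivity)
      _ = δ := by field_simp
  obtain ⟨w, hw, hwl, hwg, hwd⟩ := exists_mollification hg hδ'0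
  have hwu : ContMDiff (𝓡 m) 𝓘(ℝ, ℝ) ∞ (w ∘ u) := hw.contMDiff.comp hu
  refine ⟨w ∘ u, hwu, hwl.comp hCu, fun x hx => ?_, fun x hx v => ?_⟩
  · obtain ⟨-, h2, h3, h4⟩ := hW hx
    have h2' : u x = φ x := h2
    have h5 : g (φ x) = τ x := by
      rw [← hgeq (Metric.ball_subset_ball (by linarith) h4), Function.comp, φ.left_inv h3]
    have := hwg (φ x)
    rw [h5] at this
    rw [Function.comp, h2']
    exact this.trans hδ'
  · obtain ⟨h1, h2, h3, h4⟩ := hW hx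
    -- The derivative is estimated by `N`, one direction at a time; the Lipschitz constant `CL` of
    -- `w` would not give a constant close to `1`.
    have hfd : ∀ e : Euc m, |fderiv ℝ w (φ x) e| ≤ r * N e := by
      intro e
      have hd : HasDerivAt (fun t : ℝ => w (φ x + t • e)) (fderiv ℝ w (φ x) e) 0 := by
        have hl : HasDerivAt (fun t : ℝ => φ x + t • e) e 0 := by
          simpa using ((hasDerivAt_id (0 : ℝ)).smul_const e).const_add (φ x)
        have hw' : HasFDerivAt w (fderiv ℝ w (φ x)) (φ x + (0 : ℝ) • e) := by
          rw [zero_smul, add_zero]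
          exact (hw.differentiable (by simp) _).hasFDerivAt
        exact hw'.comp_hasDerivAt (0 : ℝ) hl
      refine hd.le_of_lip' (mul_nonneg hr0.le (hN _).1) ?_
      have ht : ∀ᶠ t : ℝ in 𝓝 0, ‖t • e‖ < ρ := by
        have : Filter.Tendsto (fun t : ℝ => ‖t • e‖) (𝓝 0) (𝓝 0) := by
          have h : Continuous fun t : ℝ => ‖t • e‖ := by fun_prop
          simpa using h.tendsto 0
        exact this.eventually (gt_mem_nhds hρ)
      filter_upwards [ht] with t ht
      have := hwd (φ x) (t • e) (r * N (t • e)) fun z hz => by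
        have h4' : dist (φ x) (φ x₀) < ρ := h4
        have hz1 : z ∈ Metric.ball (φ x₀) (3 * ρ) := by
          rw [Metric.mem_ball]
          linarith [dist_triangle z (φ x) (φ x₀)]
        have hz2 : z + t • e ∈ Metric.ball (φ x₀) (3 * ρ) := by
          rw [Metric.mem_ball]
          have : dist (z + t • e) z = ‖t • e‖ := by simp [dist_eq_norm]
          linarith [dist_triangle z (φ x) (φ x₀), dist_triangle (z + t • e) z (φ x₀)]
        rw [← hgeq hz1, ← hgeq hz2]
        simpa using hτ2 z hz1 _ hz2
      rw [hNs] at this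
      simp only [zero_smul, add_zero, sub_zero, Real.norm_eq_abs]
      linarith
    have hev : (w ∘ u) ∘ φ.symm =ᶠ[𝓝 (φ x)] w := by
      have hc : ContinuousAt φ.symm (φ x) :=
        (continuousOn_extChartAt_symm x₀).continuousAt
          ((isOpen_extChartAt_target x₀).mem_nhds (φ.map_source h3))
      have hWx : W ∈ 𝓝 (φ.symm (φ x)) := by
        rw [φ.left_inv h3]; exact hWo.mem_nhds hx
      filter_upwards [hc.preimage_mem_nhds hWx,
        (isOpen_extChartAt_target x₀).mem_nhds (φ.map_source h3)] with y hy hy2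
      obtain ⟨-, h2', -, -⟩ := hW hy
      have h2'' : u (φ.symm y) = φ (φ.symm y) := h2'
      simp only [Function.comp]
      rw [h2'', φ.right_inv hy2]
    rw [dAt_eq_fderiv_chart hwu h3, hev.fderiv_eq]
    calc |fderiv ℝ w (φ x) (dAt φ x v)| ≤ r * N (dAt φ x v) := hfd _
      _ ≤ r * (r * ‖v‖) := mul_le_mul_of_nonneg_left (h1 v) hr0.le
      _ ≤ (1 + ε) * ‖v‖ := by
        rw [← mul_assoc]; exact mul_le_mul_of_nonneg_right hr2 (norm_nonneg _)

end Smoothing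

/-! ### Derivatives along measurable sets and their weak convergence -/

section LipschitzCalculus

variable {n : ℕ}

/-- At almost every point of a set, every direction is tangent to the set. -/
lemma ae_tangentConeAt_eq_univ (s : Set (Euc n)) :
    ∀ᵐ x ∂(volume.restrict s), x ∈ closure s ∧ tangentConeAt ℝ s x = univ := by
  filter_upwards [Besicovitch.ae_tendsto_measure_inter_div volume s] with x hx
  -- At a density point `x`, every sufficiently small rescaled copy, based at `x`, of a ball around
  -- `y` meets `s`; this produces points of `s` in directions arbitrarily close to `y`.
  have hne : ∀ (y : Euc n) (ε : ℝ), 0 < ε → ∃ r : ℝ, 0 < r ∧ r < ε ∧ ∃ a, dist a y ≤ ε ∧ x + r • a ∈ s := by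
    intro y ε hε
    have B := Measure.eventually_nonempty_inter_smul_of_density_one volume s x hx
      (Metric.closedBall y ε) measurableSet_closedBall (Metric.measure_closedBall_pos volume y hε).ne'
    obtain ⟨r, ⟨z, hz, hz2⟩, hr0, hr⟩ := (B.and (Ioo_mem_nhdsGT hε)).exists
    simp only [mem_smul_set, image_add_left, mem_preimage, singleton_add] at hz2
    obtain ⟨a, ha, ha2⟩ := hz2
    refine ⟨r, hr0, hr, a, ha, ?_⟩
    rw [ha2]; simpa using hz
  refine ⟨?_, eq_univ_of_forall fun y => ?_⟩
  · rw [Metric.mem_closure_iff]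
    intro ε hε
    obtain ⟨r, hr0, hr, a, ha, hs⟩ := hne 0 (min ε 1) (by positivity)
    refine ⟨_, hs, ?_⟩
    rw [dist_zero_right] at ha
    simp only [dist_self_add_right, norm_smul, Real.norm_eq_abs, abs_of_pos hr0]
    calc r * ‖a‖ ≤ r * 1 := by gcongr; exact ha.trans (min_le_right _ _)
      _ < ε := by rw [mul_one]; exact hr.trans_le (min_le_left _ _)
  · choose r hr0 hr a ha hs using fun k : ℕ => hne y (1 / ((k : ℝ) + 1)) (by positivity)
    have hr' : Filter.Tendsto r Filter.atTop (𝓝 0) :=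
      squeeze_zero (fun k => (hr0 k).le) (fun k => (hr k).le) tendsto_one_div_add_atTop_nhds_zero_nat
    have ha' : Filter.Tendsto a Filter.atTop (𝓝 y) := by
      rw [tendsto_iff_dist_tendsto_zero]
      exact squeeze_zero (fun k => dist_nonneg) ha tendsto_one_div_add_atTop_nhds_zero_nat
    refine mem_tangentConeAt_of_seq Filter.atTop (fun k => (r k)⁻¹) (fun k => r k • a k) ?_
      (Filter.Eventually.of_forall hs) ?_
    · simpa using hr'.smul ha'
    · refine ha'.congr fun k => ?_
      rw [smul_smul, inv_mul_cancel₀ (hr0 k).ne', one_smul]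

/-- Almost every point of a set is a point of unique differentiability. -/
lemma ae_uniqueDiffWithinAt (s : Set (Euc n)) :
    ∀ᵐ x ∂(volume.restrict s), UniqueDiffWithinAt ℝ s x := by
  filter_upwards [ae_tangentConeAt_eq_univ s] with x hx
  exact ⟨by rw [hx.2]; simp, hx.1⟩

/-- Domination of increments gives domination of derivatives. -/
lemma norm_fderivWithin_apply_le {F G : Type*} [NormedAddCommGroup F] [NormedSpace ℝ F]
    [NormedAddCommGroup G] [NormedSpace ℝ G] {s : Set (Euc n)} {x : Euc n}
    (hs : tangentConeAt ℝ s x = univ) {g : Euc n → F} {Φ : Euc n → G}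
    {g' : Euc n →L[ℝ] F} {Φ' : Euc n →L[ℝ] G} (hg : HasFDerivWithinAt g g' s x)
    (hΦ : HasFDerivWithinAt Φ Φ' s x) {a : ℝ} (h : ∀ᶠ y in 𝓝[s] x, ‖g y - g x‖ ≤ a * ‖Φ y - Φ x‖)
    (e : Euc n) : ‖g' e‖ ≤ a * ‖Φ' e‖ := by
  obtain ⟨c, d, hd, hmem, hcd⟩ := mem_tangentConeAt_iff_exists_seq.1 (hs ▸ mem_univ e)
  have h1 := hg.lim hd hmem hcd
  have h2 := hΦ.lim hd hmem hcd
  refine le_of_tendsto_of_tendsto h1.norm (h2.norm.const_mul a) ?_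
  have hlim : Filter.Tendsto (fun k => x + d k) Filter.atTop (𝓝[s] x) := by
    refine tendsto_nhdsWithin_iff.2 ⟨?_, hmem⟩
    simpa using hd.const_add x
  filter_upwards [hlim.eventually h] with k hk
  rw [norm_smul, norm_smul, mul_left_comm]
  exact mul_le_mul_of_nonneg_left hk (norm_nonneg _)

/-- A bounded real function which is Lipschitz on a set extends to a Lipschitz function with the
same bounds. -/
lemma exists_lipschitz_extension_of_bounded {S : Set (Euc n)} {d : Euc n → ℝ} {c : ℝ≥0} {η : ℝ}
    (hη : 0 ≤ η) (hd : LipschitzOnWith c d S) (hb : ∀ u ∈ S, |d u| ≤ η) :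
    ∃ g : Euc n → ℝ, LipschitzWith c g ∧ EqOn d g S ∧ ∀ u, |g u| ≤ η := by
  obtain ⟨g, hg, hgd⟩ := hd.extend_real
  refine ⟨fun u => max (-η) (min η (g u)), (hg.const_min η).const_max (-η), fun u hu => ?_, fun u => ?_⟩
  · have := abs_le.1 (hb u hu)
    rw [hgd hu] at this
    simp only
    rw [min_eq_right this.2, max_eq_right this.1, hgd hu]
  · rw [abs_le]
    exact ⟨le_max_left _ _, max_le (by linarith) (min_le_left _ _)⟩

/-- The derivatives of a function along a set and of a Lipschitz extension agree almost
everywhere. -/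
lemma ae_fderivWithin_eq_fderiv {F : Type*} [NormedAddCommGroup F] [NormedSpace ℝ F]
    [FiniteDimensional ℝ F] {S : Set (Euc n)} (hS : MeasurableSet S) {d g : Euc n → F} {c : ℝ≥0}
    (hg : LipschitzWith c g) (h : EqOn d g S) :
    ∀ᵐ u ∂(volume.restrict S), HasFDerivWithinAt d (fderiv ℝ g u) S u ∧ HasFDerivAt g (fderiv ℝ g u) u ∧
      fderivWithin ℝ d S u = fderiv ℝ g u := by
  filter_upwards [ae_uniqueDiffWithinAt S, ae_restrict_mem hS,
    ae_restrict_of_ae hg.ae_differentiableAt] with u h1 h2 h3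
  have h4 : HasFDerivWithinAt d (fderiv ℝ g u) S u :=
    h3.hasFDerivAt.hasFDerivWithinAt.congr h (h h2)
  exact ⟨h4, h3.hasFDerivAt, h4.fderivWithin h1⟩

/-- Weak convergence of the derivatives of a uniformly convergent, uniformly Lipschitz sequence. -/
lemma tendsto_integral_fderivWithin {S : Set (Euc n)} (hS : MeasurableSet S) {w : ℕ → Euc n → ℝ}
    {w₀ : Euc n → ℝ} {c : ℝ≥0} (hw : ∀ k, LipschitzOnWith c (w k) S) (hw₀ : LipschitzOnWith c w₀ S)
    {η : ℕ → ℝ} (hη : Filter.Tendsto η Filter.atTop (𝓝 0)) (hη0 : ∀ k, 0 ≤ η k)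
    (hb : ∀ k, ∀ u ∈ S, |w k u - w₀ u| ≤ η k) {b : Euc n → ℝ} (hbi : IntegrableOn b S) (e : Euc n) :
    Filter.Tendsto (fun k => ∫ u in S, fderivWithin ℝ (w k) S u e * b u) Filter.atTop
      (𝓝 (∫ u in S, fderivWithin ℝ w₀ S u e * b u)) := by
  have hd : ∀ k, LipschitzOnWith (c + c) (fun u => w k u - w₀ u) S := fun k => (hw k).sub hw₀
  -- The difference `w k - w₀` is extended to the whole space with the same small bound `η k`, so
  -- that it can be integrated by parts.
  choose g hg hgd hgb using fun k =>
    exists_lipschitz_extension_of_bounded (hη0 k) (hd k) (hb k)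
  choose gw hgw hgwd using fun k => (hw k).extend_real
  obtain ⟨gw₀, hgw₀, hgwd₀⟩ := hw₀.extend_real
  set β : Euc n → ℝ := S.indicator b with hβ
  have hβi : Integrable β := hbi.integrable_indicator hS
  have hfb : ∀ k u, |fderiv ℝ (g k) u e| ≤ (c + c : ℝ≥0) * ‖e‖ := fun k u =>
    (ContinuousLinearMap.le_opNorm _ e).trans
      (mul_le_mul_of_nonneg_right (norm_fderiv_le_of_lipschitz ℝ (hg k)) (norm_nonneg _))
  have hmeas : ∀ (h : Euc n → ℝ), Measurable fun u => fderiv ℝ h u e := fun h =>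
    measurable_fderiv_apply_const ℝ h e
  have hmul : ∀ {h : Euc n → ℝ} {c' : ℝ≥0} (_ : LipschitzWith c' h) {β : Euc n → ℝ} {μ : Measure (Euc n)}
      (_ : Integrable β μ), Integrable (fun u => fderiv ℝ h u e * β u) μ := by
    intro h c' hh β μ hβ
    refine hβ.bdd_mul (c := c' * ‖e‖) (hmeas h).aestronglyMeasurable
      (Filter.Eventually.of_forall fun u => ?_)
    exact (ContinuousLinearMap.le_opNorm _ e).trans
      (mul_le_mul_of_nonneg_right (norm_fderiv_le_of_lipschitz ℝ hh) (norm_nonneg _))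
  have hdiff : ∀ k, (∫ u in S, fderivWithin ℝ (w k) S u e * b u) -
      ∫ u in S, fderivWithin ℝ w₀ S u e * b u = ∫ u, fderiv ℝ (g k) u e * β u := by
    intro k
    have e1 : ∫ u in S, fderivWithin ℝ (w k) S u e * b u = ∫ u in S, fderiv ℝ (gw k) u e * b u :=
      integral_congr_ae (by
        filter_upwards [ae_fderivWithin_eq_fderiv hS (hgw k) (hgwd k)] with u hu
        rw [hu.2.2])
    have e2 : ∫ u in S, fderivWithin ℝ w₀ S u e * b u = ∫ u in S, fderiv ℝ gw₀ u e * b u :=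
      integral_congr_ae (by
        filter_upwards [ae_fderivWithin_eq_fderiv hS hgw₀ hgwd₀] with u hu
        rw [hu.2.2])
    have e3 : ∫ u, fderiv ℝ (g k) u e * β u = ∫ u in S, fderiv ℝ (g k) u e * b u := by
      rw [← integral_indicator hS]
      congr 1; funext u
      by_cases hu : u ∈ S <;> simp [hβ, hu]
    rw [e1, e2, e3, ← integral_sub (hmul (hgw k) hbi) (hmul hgw₀ hbi)]
    refine integral_congr_ae ?_
    filter_upwards [ae_uniqueDiffWithinAt S, ae_fderivWithin_eq_fderiv hS (hgw k) (hgwd k),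
      ae_fderivWithin_eq_fderiv hS hgw₀ hgwd₀, ae_fderivWithin_eq_fderiv hS (hg k) (hgd k)]
      with u h0 h1 h2 h3
    have := h0.eq h3.1 (h1.1.sub h2.1)
    rw [this, _root_.sub_apply]
    ring
  suffices hlim : Filter.Tendsto (fun k => ∫ u, fderiv ℝ (g k) u e * β u) Filter.atTop (𝓝 0) by
    have := hlim.add_const (∫ u in S, fderivWithin ℝ w₀ S u e * b u)
    rw [zero_add] at this
    refine this.congr fun k => ?_
    rw [← hdiff]; ring
  rw [Metric.tendsto_atTop]
  intro ε hε
  set A : ℝ := (c + c : ℝ≥0) * ‖e‖ with hA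
  have hA0 : 0 ≤ A := by positivity
  -- Replacing the merely integrable `β` by a smooth `φ` costs at most the uniform bound `A` for the
  -- derivatives times the distance in `L¹`.
  obtain ⟨φ, hφc, hφs, hφ⟩ := (memLp_one_iff_integrable.2 hβi).exist_eLpNorm_sub_le
    ENNReal.one_ne_top le_rfl (ε := ε / (2 * (A + 1))) (by positivity)
  have hφi : Integrable φ := hφs.continuous.integrable_of_hasCompactSupport hφc
  obtain ⟨cφ, hcφ⟩ := (hφs.of_le (by exact_mod_cast le_top : (1 : WithTop ℕ∞) ≤ ((⊤ : ℕ∞) : WithTop ℕ∞))).lipschitzWith_of_hasCompactSupport hφc one_ne_zero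
  have hφ1 : ∫ u, |β u - φ u| ≤ ε / (2 * (A + 1)) := by
    rw [eLpNorm_one_eq_lintegral_enorm] at hφ
    have h1 := ofReal_integral_norm_eq_lintegral_enorm (hβi.sub hφi)
    rw [← h1] at hφ
    exact (ENNReal.ofReal_le_ofReal_iff (by positivity)).1 hφ
  set D : ℝ := ∫ u, |fderiv ℝ φ u e| with hD
  have hDi : Integrable fun u => fderiv ℝ φ u e :=
    ((hφs.continuous_fderiv (by simp)).clm_apply continuous_const).integrable_of_hasCompactSupport
      (hφc.fderiv_apply ℝ e)
  have hD0 : 0 ≤ D := integral_nonneg fun u => abs_nonneg _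
  obtain ⟨K, hK⟩ := (Metric.tendsto_atTop.1 hη) (ε / (2 * (D + 1))) (by positivity)
  refine ⟨K, fun k hk => ?_⟩
  have hηk : η k < ε / (2 * (D + 1)) := by
    have := hK k hk
    rwa [Real.dist_eq, sub_zero, abs_of_nonneg (hη0 k)] at this
  have hβφ : Integrable fun u => β u - φ u := hβi.sub hφi
  have hsplit : ∫ u, fderiv ℝ (g k) u e * β u =
      (∫ u, fderiv ℝ (g k) u e * (β u - φ u)) + ∫ u, fderiv ℝ (g k) u e * φ u := by
    rw [← integral_add (hmul (hg k) hβφ) (hmul (hg k) hφi)]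
    congr 1; funext u; ring
  have hp1 : |∫ u, fderiv ℝ (g k) u e * (β u - φ u)| ≤ A * (ε / (2 * (A + 1))) := by
    have hle : ∀ u, ‖fderiv ℝ (g k) u e * (β u - φ u)‖ ≤ A * |β u - φ u| := by
      intro u
      rw [norm_mul]
      exact mul_le_mul_of_nonneg_right (hfb k u) (abs_nonneg _)
    refine (norm_integral_le_of_norm_le (hβφ.abs.const_mul A)
      (Filter.Eventually.of_forall hle)).trans ?_
    rw [integral_const_mul]
    gcongr
  have hp2 : |∫ u, fderiv ℝ (g k) u e * φ u| ≤ η k * D := by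
    have e1 : ∫ u, fderiv ℝ (g k) u e * φ u = ∫ u, lineDeriv ℝ (g k) u e * φ u := by
      refine integral_congr_ae ?_
      filter_upwards [(hg k).ae_differentiableAt (μ := volume)] with u hu
      rw [hu.lineDeriv_eq_fderiv]
    -- The derivative moves to the fixed function `φ`, leaving `g k`, which is bounded by `η k`.
    rw [e1, (hg k).integral_lineDeriv_mul_eq hcφ hφc e]
    have hle : ∀ u, ‖lineDeriv ℝ φ u (-e) * g k u‖ ≤ η k * |fderiv ℝ φ u e| := by
      intro u
      rw [(hφs.differentiable (by simp) u).lineDeriv_eq_fderiv, map_neg, norm_mul, norm_neg,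
        mul_comm]
      exact mul_le_mul_of_nonneg_right (hgb k u) (norm_nonneg _)
    refine (norm_integral_le_of_norm_le (hDi.abs.const_mul (η k)) (Filter.Eventually.of_forall hle)).trans ?_
    rw [integral_const_mul]
  have hA2 : A * (ε / (2 * (A + 1))) < ε / 2 := by
    rw [mul_div_assoc', div_lt_div_iff₀ (by positivity) two_pos]; nlinarith
  have hD2 : η k * D < ε / 2 := by
    calc η k * D ≤ ε / (2 * (D + 1)) * D := by gcongr
      _ < ε / 2 := by rw [div_mul_eq_mul_div, div_lt_div_iff₀ (by positivity) two_pos]; nlinarith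
  rw [Real.dist_eq, sub_zero, hsplit]
  exact (abs_add_le _ _).trans_lt (by linarith)

end LipschitzCalculus

/-! ### Linear algebra of parallelograms -/

section PlaneAlgebra

/-- If a linear form on the plane spanned by `v` and `w`, with values `p` and `q` at `v` and `w`, has
norm at most `a`, then `p w - q v` has norm at most `a` times the area of the parallelogram. -/
lemma norm_sq_smul_sub_smul_le {E : Type*} [NormedAddCommGroup E] [InnerProductSpace ℝ E]
    {v w : E} {p q a : ℝ} (h : ∀ x y : ℝ, |x * p + y * q| ≤ a * ‖x • v + y • w‖) :
    ‖p • w - q • v‖ ^ 2 ≤ a ^ 2 * (‖v‖ ^ 2 * ‖w‖ ^ 2 - inner ℝ v w ^ 2) := by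
  set V := ‖v‖ ^ 2 with hV
  set W := ‖w‖ ^ 2 with hW
  set c : ℝ := inner ℝ v w with hc
  have hsq : ∀ x y : ℝ, ‖x • v + y • w‖ ^ 2 = x ^ 2 * V + 2 * x * y * c + y ^ 2 * W := by
    intro x y
    rw [norm_add_sq_real, norm_smul, norm_smul, real_inner_smul_left, real_inner_smul_right, mul_pow,
      mul_pow, Real.norm_eq_abs, Real.norm_eq_abs, sq_abs, sq_abs]
    ring
  have hN : ‖p • w - q • v‖ ^ 2 = p ^ 2 * W - 2 * p * q * c + q ^ 2 * V := by
    have := hsq (-q) p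
    rw [show -q • v + p • w = p • w - q • v by rw [neg_smul]; abel] at this
    rw [this]; ring
  have hG : 0 ≤ V * W - c ^ 2 := by
    have := abs_real_inner_le_norm v w
    have h2 : c ^ 2 ≤ (‖v‖ * ‖w‖) ^ 2 := by
      rw [← sq_abs]; exact pow_le_pow_left₀ (abs_nonneg _) this 2
    rw [mul_pow] at h2
    linarith
  set N := ‖p • w - q • v‖ ^ 2 with hNdef
  have hN0 : 0 ≤ N := sq_nonneg _
  -- The coefficients are the adjugate of the Gram matrix applied to `(p, q)`. At this vector the
  -- linear form takes the value `N`, and the squared norm is the squared area times `N`.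
  have h1 := h (p * W - q * c) (q * V - p * c)
  have h2 : N ^ 2 ≤ a ^ 2 * ((V * W - c ^ 2) * N) := by
    have h3 : (p * W - q * c) * p + (q * V - p * c) * q = N := by rw [hN]; ring
    have h4 : ‖(p * W - q * c) • v + (q * V - p * c) • w‖ ^ 2 = (V * W - c ^ 2) * N := by
      rw [hsq, hN]; ring
    rw [h3, abs_of_nonneg hN0] at h1
    rw [← h4, ← mul_pow]
    exact pow_le_pow_left₀ hN0 h1 2
  rcases hN0.eq_or_lt with h0 | h0
  · rw [← h0]; positivity
  · have : N * N ≤ a ^ 2 * (V * W - c ^ 2) * N := by nlinarith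
    exact le_of_mul_le_mul_right this h0

/-- Hadamard's inequality for the wedge product of two covectors. -/
lemma abs_wedge_le {E : Type*} [NormedAddCommGroup E] [InnerProductSpace ℝ E] {A B : E →ₗ[ℝ] ℝ}
    {a b : ℝ} (ha : 0 ≤ a) (hb : 0 ≤ b) (hA : ∀ v, |A v| ≤ a * ‖v‖) (hB : ∀ v, |B v| ≤ b * ‖v‖)
    {v w : E} (hv : ‖v‖ ≤ 1) (hw : ‖w‖ ≤ 1) : |A v * B w - A w * B v| ≤ a * b := by
  -- The wedge product is a single value of `B`, at a vector whose norm is controlled by the bound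
  -- for `A` and the area.
  have h1 : A v * B w - A w * B v = B (A v • w - A w • v) := by simp
  have h2 := norm_sq_smul_sub_smul_le (v := v) (w := w) (p := A v) (q := A w) (a := a) fun x y => by
    simpa using hA (x • v + y • w)
  have h3 : ‖A v • w - A w • v‖ ≤ a := by
    refine le_of_sq_le_sq ?_ ha
    refine h2.trans (mul_le_of_le_one_right (sq_nonneg a) ?_)
    have hv2 : ‖v‖ ^ 2 ≤ 1 := pow_le_one₀ (norm_nonneg _) hv
    have hw2 : ‖w‖ ^ 2 ≤ 1 := pow_le_one₀ (norm_nonneg _) hw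
    nlinarith [sq_nonneg (inner ℝ v w : ℝ), mul_le_one₀ hv2 (sq_nonneg ‖w‖) hw2]
  rw [h1]
  refine (hB _).trans ?_
  rw [mul_comm a b]
  exact mul_le_mul_of_nonneg_left h3 hb

lemma lagrange_identity {n : ℕ} (v w : Euc n) :
    ‖v‖ ^ 2 * ‖w‖ ^ 2 - inner ℝ v w ^ 2 = (∑ i, ∑ j, (v i * w j - v j * w i) ^ 2) / 2 := by
  have hv : ‖v‖ ^ 2 = ∑ i, v i * v i := by
    rw [EuclideanSpace.real_norm_sq_eq]; exact Finset.sum_congr rfl fun i _ => sq _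
  have hw : ‖w‖ ^ 2 = ∑ i, w i * w i := by
    rw [EuclideanSpace.real_norm_sq_eq]; exact Finset.sum_congr rfl fun i _ => sq _
  have hi : (inner ℝ v w : ℝ) = ∑ i, v i * w i := by
    rw [PiLp.inner_apply]; exact Finset.sum_congr rfl fun i _ => by simp [mul_comm]
  have h : ∑ i, ∑ j, (v i * w j - v j * w i) ^ 2 =
      (∑ i, v i * v i) * (∑ j, w j * w j) + (∑ i, w i * w i) * (∑ j, v j * v j) -
        2 * ((∑ i, v i * w i) * (∑ j, v j * w j)) := by
    rw [Finset.sum_mul_sum, Finset.sum_mul_sum, Finset.sum_mul_sum, Finset.mul_sum,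
      ← Finset.sum_add_distrib, ← Finset.sum_sub_distrib]
    refine Finset.sum_congr rfl fun i _ => ?_
    rw [Finset.mul_sum, ← Finset.sum_add_distrib, ← Finset.sum_sub_distrib]
    exact Finset.sum_congr rfl fun j _ => by ring
  rw [h, hv, hw, hi]; ring

/-- By Lagrange's identity the area is bounded by the sum of the absolute values of the minors.
These are the values of coordinate `2`-forms, and integrability of a parametrization is only
available for the pull-backs of test forms; hence this substitute for the area. -/
lemma norm_smul_sub_smul_le_sum {n : ℕ} {v w : Euc n} {p q a : ℝ} (ha : 0 ≤ a)
    (h : ∀ x y : ℝ, |x * p + y * q| ≤ a * ‖x • v + y • w‖) :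
    ‖p • w - q • v‖ ≤ a * ∑ i, ∑ j, |v i * w j - v j * w i| := by
  have hS : 0 ≤ ∑ i, ∑ j, |v i * w j - v j * w i| :=
    Finset.sum_nonneg fun i _ => Finset.sum_nonneg fun j _ => abs_nonneg _
  refine le_of_sq_le_sq ?_ (mul_nonneg ha hS)
  refine (norm_sq_smul_sub_smul_le h).trans ?_
  rw [lagrange_identity, mul_pow]
  refine mul_le_mul_of_nonneg_left ?_ (sq_nonneg a)
  have h1 : ∑ i, ∑ j, (v i * w j - v j * w i) ^ 2 ≤ (∑ i, ∑ j, |v i * w j - v j * w i|) ^ 2 := by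
    have : ∀ (f : Fin n × Fin n → ℝ), ∑ x, f x ^ 2 ≤ (∑ x, |f x|) ^ 2 := by
      intro f
      rw [show ∑ x, f x ^ 2 = ∑ x, |f x| ^ 2 from Finset.sum_congr rfl fun x _ => (sq_abs _).symm]
      exact Finset.sum_sq_le_sq_sum_of_nonneg fun x _ => abs_nonneg _
    simpa only [Fintype.sum_prod_type] using this fun x => v x.1 * w x.2 - v x.2 * w x.1
  have h2 : 0 ≤ ∑ i, ∑ j, (v i * w j - v j * w i) ^ 2 :=
    Finset.sum_nonneg fun i _ => Finset.sum_nonneg fun j _ => sq_nonneg _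
  linarith

end PlaneAlgebra

/-! ### Coordinate patches -/

section Patches

variable {m : ℕ} {X : Type*} [EMetricSpace X] [ChartedSpace (Euc m) X]
  [RiemannianBundle (fun x : X => TangentSpace (𝓡 m) x)]

/-- A coordinate neighborhood of `x₀` on which the chart is bilipschitz and on which Lipschitz
functions can be smoothed with a small loss `ε` on the Lipschitz constant. -/
structure ChartPatch (m : ℕ) {X : Type*} [EMetricSpace X] [ChartedSpace (Euc m) X]
    [RiemannianBundle (fun x : X => TangentSpace (𝓡 m) x)] (ε : ℝ) (x₀ : X) where
  /-- a global smooth Lipschitz extension of the chart -/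
  coord : X → Euc m
  contMDiff_coord : ContMDiff (𝓡 m) 𝓘(ℝ, Euc m) ∞ coord
  hasCompactSupport_coord : HasCompactSupport coord
  /-- a Lipschitz constant of `coord` -/
  lipConst : ℝ≥0
  lipschitz_coord : LipschitzWith lipConst coord
  /-- the neighborhood -/
  dom : Set X
  isOpen_dom : IsOpen dom
  mem_dom : x₀ ∈ dom
  isCompact_closure : IsCompact (closure dom)
  closure_subset : closure dom ⊆ (extChartAt (𝓡 m) x₀).source
  coord_eventuallyEq : ∀ x ∈ closure dom, coord =ᶠ[𝓝 x] extChartAt (𝓡 m) x₀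
  /-- a bound for the distortion of the chart -/
  distortion : ℝ
  distortion_nonneg : 0 ≤ distortion
  norm_le : ∀ x ∈ dom, ∀ v : TangentSpace (𝓡 m) x, ‖v‖ ≤ distortion * ‖dAt coord x v‖
  edist_le : ∀ x ∈ dom, ∀ y ∈ dom, edist x y ≤ ENNReal.ofReal (distortion * dist (coord x) (coord y))
  smoothing : ∃ K : ℝ≥0, ∀ τ : X → ℝ, LipschitzWith 1 τ → ∀ δ > 0,
    ∃ w : X → ℝ, ContMDiff (𝓡 m) 𝓘(ℝ, ℝ) ∞ w ∧ LipschitzWith K w ∧ (∀ x ∈ dom, |w x - τ x| ≤ δ) ∧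
      ∀ x ∈ dom, ∀ v : TangentSpace (𝓡 m) x, |dAt w x v| ≤ (1 + ε) * ‖v‖

variable [IsManifold (𝓡 m) ∞ X]
  [IsContinuousRiemannianBundle (Euc m) (fun x : X => TangentSpace (𝓡 m) x)]
  [IsRiemannianManifold (𝓡 m) X]

/-- The patch is the chart preimage of a small ball. The ball is convex, so integration along
segments bounds the distances; its preimage lies in a compact set where the cut-off coordinates
agree with the chart and the smoothing is available. -/
lemma nonempty_chartPatch {ε : ℝ} (hε : 0 < ε) (x₀ : X) : Nonempty (ChartPatch m ε x₀) := by
  have : LocallyCompactSpace X := ChartedSpace.locallyCompactSpace (Euc m) X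
  obtain ⟨U, K, hUo, hxU, hU⟩ := exists_smoothing (m := m) x₀ hε
  obtain ⟨u, hu, huc, ⟨Cu, hCu⟩, hux⟩ := exists_lipschitz_chart_extension (m := m) x₀
  obtain ⟨N, C, hC0, hN, -, -, hN2⟩ := exists_almost_isometric_chart (m := m) x₀ one_lt_two
  set φ := extChartAt (𝓡 m) x₀ with hφ
  obtain ⟨V, hV, hVo, hxV⟩ := mem_nhds_iff.1 hux
  obtain ⟨Z, hZ, hZsub, hZc⟩ := local_compact_nhds
    ((isOpen_extChartAt_source (I := 𝓡 m) x₀).inter (hVo.inter hUo) |>.mem_nhds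
      ⟨mem_extChartAt_source x₀, hxV, hxU⟩)
  have hpre : φ.symm ⁻¹' (interior Z) ∈ 𝓝 (φ x₀) := by
    refine (continuousAt_extChartAt_symm x₀).preimage_mem_nhds ?_
    rw [extChartAt_to_inv]
    exact interior_mem_nhds.2 hZ
  obtain ⟨ρ, hρ, hball⟩ := Metric.mem_nhds_iff.1 (Filter.inter_mem hN2 (Filter.inter_mem hpre
    ((isOpen_extChartAt_target x₀).mem_nhds (mem_extChartAt_target x₀))))
  set W : Set X := φ.source ∩ φ ⁻¹' Metric.ball (φ x₀) ρ with hWdef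
  have hWZ : W ⊆ Z := by
    rintro x ⟨hx1, hx2⟩
    have := (hball hx2).2.1
    rw [mem_preimage, φ.left_inv hx1] at this
    exact interior_subset this
  have hclZ : closure W ⊆ Z := closure_minimal hWZ hZc.isClosed
  have hWo : IsOpen W := (continuousOn_extChartAt x₀).isOpen_inter_preimage
    (isOpen_extChartAt_source x₀) Metric.isOpen_ball
  have hev : ∀ x ∈ closure W, u =ᶠ[𝓝 x] φ := fun x hx => by
    filter_upwards [hVo.mem_nhds (hZsub (hclZ hx)).2.1] with y hy using hV hy
  have hsb : ∀ y ∈ Metric.ball (φ x₀) ρ, ∀ e : Euc m, ‖sAt x₀ y e‖ ≤ (2 * C) * ‖e‖ := by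
    intro y hy e
    refine ((hball hy).1 e).trans ?_
    rw [mul_assoc]
    exact mul_le_mul_of_nonneg_left (hN e).2 zero_le_two
  refine ⟨⟨u, hu, huc, Cu, hCu, W, hWo, ⟨mem_extChartAt_source x₀, Metric.mem_ball_self hρ⟩,
    hZc.of_isClosed_subset isClosed_closure hclZ, fun x hx => (hZsub (hclZ hx)).1, hev, 2 * C,
    by positivity, ?_, ?_, K, fun τ hτ δ hδ => ?_⟩⟩
  · intro x hx v
    have h1 : dAt u x v = dAt φ x v :=
      congrArg (fun L : Euc m →L[ℝ] Euc m => L v) (hev x (subset_closure hx)).mfderiv_eq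
    have h2 := hsb (φ x) hx.2 (dAt φ x v)
    have h3 : ∀ (p : X) (_ : p = x) (v' : Euc m) (_ : v' = v),
        ‖(show TangentSpace (𝓡 m) p from v')‖ = ‖v‖ := by
      rintro p rfl v' rfl; rfl
    have h4 := h3 _ (φ.left_inv hx.1) _ (mfderiv_symm_mfderiv_extChartAt hx.1 v)
    rw [h1, ← h4]
    exact h2
  · intro x hx y hy
    have hseg : segment ℝ (φ x) (φ y) ⊆ Metric.ball (φ x₀) ρ :=
      (convex_ball _ _).segment_subset hx.2 hy.2
    have h1 := edist_extChartAt_symm_le x₀ (fun z hz => (hball (hseg hz)).2.2)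
      (fun z hz => hsb z (hseg hz) (φ y - φ x))
    rw [φ.left_inv hx.1, φ.left_inv hy.1] at h1
    rw [(hev x (subset_closure hx)).eq_of_nhds, (hev y (subset_closure hy)).eq_of_nhds, dist_comm,
      dist_eq_norm]
    exact h1
  · obtain ⟨w, h1, h2, h3, h4⟩ := hU τ hτ δ hδ
    exact ⟨w, h1, h2, fun x hx => h3 x (hZsub (hWZ hx)).2.2, fun x hx => h4 x (hZsub (hWZ hx)).2.2⟩

end Patches

section Patches

variable {m : ℕ} {X : Type*} [EMetricSpace X] [ChartedSpace (Euc m) X]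
  [RiemannianBundle (fun x : X => TangentSpace (𝓡 m) x)] {ε : ℝ} {x₀ : X}

namespace ChartPatch

variable (p : ChartPatch m ε x₀)

lemma coord_eq {x : X} (hx : x ∈ closure p.dom) : p.coord x = extChartAt (𝓡 m) x₀ x :=
  (p.coord_eventuallyEq x hx).eq_of_nhds

lemma dAt_coord {x : X} (hx : x ∈ closure p.dom) (v : TangentSpace (𝓡 m) x) :
    dAt p.coord x v = dAt (extChartAt (𝓡 m) x₀) x v :=
  congrArg (fun L : Euc m →L[ℝ] Euc m => L v) (p.coord_eventuallyEq x hx).mfderiv_eq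

lemma symm_coord {x : X} (hx : x ∈ closure p.dom) : (extChartAt (𝓡 m) x₀).symm (p.coord x) = x := by
  rw [p.coord_eq hx, (extChartAt (𝓡 m) x₀).left_inv (p.closure_subset hx)]

lemma coord_mem_target {x : X} (hx : x ∈ closure p.dom) :
    p.coord x ∈ (extChartAt (𝓡 m) x₀).target := by
  rw [p.coord_eq hx]; exact (extChartAt (𝓡 m) x₀).map_source (p.closure_subset hx)

lemma contMDiff_coord_apply (b : Fin m) : ContMDiff (𝓡 m) 𝓘(ℝ, ℝ) ∞ fun x => p.coord x b :=
  ((EuclideanSpace.proj b : Euc m →L[ℝ] ℝ).contDiff.contMDiff).comp p.contMDiff_coord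

lemma hasCompactSupport_coord_apply (b : Fin m) : HasCompactSupport fun x => p.coord x b :=
  p.hasCompactSupport_coord.comp_left (g := fun y : Euc m => y b) rfl

variable [IsManifold (𝓡 m) ∞ X]

lemma form_apply {k : ℕ} (α : ∀ x : X, TangentSpace (𝓡 m) x [⋀^Fin k]→L[ℝ] ℝ) {x : X}
    (hx : x ∈ closure p.dom) (v : Fin k → TangentSpace (𝓡 m) x) :
    α x v = chartRep α x₀ (p.coord x) (fun i => dAt p.coord x (v i)) := by
  rw [form_apply_eq_chartRep α (p.closure_subset hx), p.coord_eq hx]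
  congr 1
  funext i
  exact (p.dAt_coord hx (v i)).symm

/-- The local expression of `α` is continuous on the compact image of the closure of the patch,
hence bounded there. -/
lemma exists_form_le {k : ℕ} (α : TestForm m X k) :
    ∃ C : ℝ, 0 ≤ C ∧ ∀ x ∈ p.dom, ∀ v : Fin k → TangentSpace (𝓡 m) x,
      |α.1 x v| ≤ C * ∏ i, ‖dAt p.coord x (v i)‖ := by
  have h1 : IsCompact (p.coord '' closure p.dom) :=
    p.isCompact_closure.image p.contMDiff_coord.continuous
  have h2 : ContinuousOn (chartRep α.1 x₀) (p.coord '' closure p.dom) :=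
    (α.2.1 x₀).continuousOn.mono (image_subset_iff.2 fun x hx => p.coord_mem_target hx)
  obtain ⟨C, hC⟩ := h1.exists_bound_of_continuousOn h2
  refine ⟨max C 0, le_max_right _ _, fun x hx v => ?_⟩
  rw [p.form_apply α.1 (subset_closure hx)]
  refine (ContinuousAlternatingMap.le_opNorm (chartRep α.1 x₀ (p.coord x))
    (fun i => dAt p.coord x (v i))).trans ?_
  exact mul_le_mul_of_nonneg_right ((hC _ ⟨x, subset_closure hx, rfl⟩).trans (le_max_left _ _))
    (Finset.prod_nonneg fun i _ => norm_nonneg _)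

/-- The differentials of the coordinates, as test forms. -/
def dcoord (b : Fin m) : TestForm m X 1 :=
  TestForm.dfun (fun x => p.coord x b) (p.contMDiff_coord_apply b) (p.hasCompactSupport_coord_apply b)

lemma dAt_coord_apply (b : Fin m) (x : X) (v : TangentSpace (𝓡 m) x) :
    dAt (fun x => p.coord x b) x v = dAt p.coord x v b := by
  have h1 : MDifferentiableAt (𝓡 m) 𝓘(ℝ, Euc m) p.coord x :=
    p.contMDiff_coord.mdifferentiableAt (by simp)
  have h2 : MDifferentiableAt 𝓘(ℝ, Euc m) 𝓘(ℝ, ℝ) (EuclideanSpace.proj b : Euc m →L[ℝ] ℝ) (p.coord x) :=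
    (EuclideanSpace.proj b : Euc m →L[ℝ] ℝ).contDiff.contMDiff.mdifferentiableAt (n := ∞) (by simp)
  have h3 := mfderiv_comp x h2 h1
  have h4 := congrArg (fun L : Euc m →L[ℝ] ℝ => L v) h3
  refine h4.trans ?_
  change (mfderiv 𝓘(ℝ, Euc m) 𝓘(ℝ, ℝ) (EuclideanSpace.proj b : Euc m →L[ℝ] ℝ) (p.coord x))
    (dAt p.coord x v) = _
  rw [mfderiv_eq_fderiv]
  exact congrArg (fun L : Euc m →L[ℝ] ℝ => L (dAt p.coord x v))
    (EuclideanSpace.proj b : Euc m →L[ℝ] ℝ).fderiv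

lemma dcoord_apply (b : Fin m) (x : X) (v : Fin 1 → TangentSpace (𝓡 m) x) :
    (p.dcoord b).1 x v = dAt p.coord x (v 0) b := by
  rw [← p.dAt_coord_apply b x (v 0)]
  exact TestForm.dfun_apply _ _ _ x v

/-- The wedge products of the differentials of the coordinates, as test forms. -/
def dcoord₂ (a b : Fin m) : TestForm m X 2 :=
  TestForm.dwedge (fun x => p.coord x a) (p.contMDiff_coord_apply a) (p.dcoord b)

lemma dcoord₂_apply (a b : Fin m) (x : X) (v : Fin 2 → TangentSpace (𝓡 m) x) :
    (p.dcoord₂ a b).1 x v = dAt p.coord x (v 0) a * dAt p.coord x (v 1) b -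
      dAt p.coord x (v 1) a * dAt p.coord x (v 0) b := by
  rw [dcoord₂, TestForm.dwedge_apply, dcoord_apply, dcoord_apply, dAt_coord_apply, dAt_coord_apply]

end ChartPatch

lemma exists_countable_cover_chartPatch [SecondCountableTopology X]
    (p : ∀ x : X, ChartPatch m ε x) : ∃ s : Set X, s.Countable ∧ ⋃ x ∈ s, (p x).dom = univ :=
  TopologicalSpace.countable_cover_nhds fun x => (p x).isOpen_dom.mem_nhds (p x).mem_dom

end Patches

lemma continuous_alternatingMap_eval {m k : ℕ} :
    Continuous fun q : (Euc m [⋀^Fin k]→L[ℝ] ℝ) × (Fin k → Euc m) => q.1 q.2 := by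
  have h : Continuous fun q : (Euc m [⋀^Fin k]→L[ℝ] ℝ) × (Fin k → Euc m) =>
      (ContinuousAlternatingMap.toContinuousMultilinearMapCLM ℝ q.1) q.2 :=
    ((ContinuousAlternatingMap.toContinuousMultilinearMapCLM ℝ).continuous.comp
      continuous_fst).eval continuous_snd
  exact h

/-! ### Lipschitz maps from Euclidean sets to the manifold -/

section Parametrizations

variable {m n : ℕ} {X : Type*} [EMetricSpace X] [ChartedSpace (Euc m) X]

/-- The derivative at `u` along `K` of a map from a Euclidean space to a manifold. -/
def pAt (f : Euc n → X) (K : Set (Euc n)) (u : Euc n) : Euc n →L[ℝ] TangentSpace (𝓡 m) (f u) :=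
  mfderivWithin 𝓘(ℝ, Euc n) (𝓡 m) f K u

lemma pushDensity_apply (K : Set (Euc n)) (f : Euc n → X) (θ : Euc n → ℤ) (α : TestForm m X n)
    (u : Euc n) : pushDensity K f θ α u =
      θ u * α.1 (f u) fun j => pAt f K u (EuclideanSpace.single j (1 : ℝ)) := rfl

variable [IsManifold (𝓡 m) ∞ X]

lemma hasFDerivWithinAt_comp {F : Type*} [NormedAddCommGroup F] [NormedSpace ℝ F] {w : X → F}
    (hw : ContMDiff (𝓡 m) 𝓘(ℝ, F) ∞ w) {f : Euc n → X} {K : Set (Euc n)} {u : Euc n}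
    (hf : MDifferentiableWithinAt 𝓘(ℝ, Euc n) (𝓡 m) f K u) :
    HasFDerivWithinAt (w ∘ f) ((dAt w (f u)).comp (pAt (m := m) f K u) : Euc n →L[ℝ] F) K u := by
  have h1 : MDifferentiableAt (𝓡 m) 𝓘(ℝ, F) w (f u) := hw.mdifferentiableAt (by simp)
  exact (h1.hasMFDerivAt.comp_hasMFDerivWithinAt u hf.hasMFDerivWithinAt).hasFDerivWithinAt

lemma fderivWithin_comp_apply {F : Type*} [NormedAddCommGroup F] [NormedSpace ℝ F] {w : X → F}
    (hw : ContMDiff (𝓡 m) 𝓘(ℝ, F) ∞ w) {f : Euc n → X} {K : Set (Euc n)} {u : Euc n}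
    (hf : MDifferentiableWithinAt 𝓘(ℝ, Euc n) (𝓡 m) f K u) (hK : UniqueDiffWithinAt ℝ K u)
    (e : Euc n) : fderivWithin ℝ (w ∘ f) K u e = dAt w (f u) (pAt (m := m) f K u e) := by
  rw [(hasFDerivWithinAt_comp hw hf).fderivWithin hK]; rfl

variable [RiemannianBundle (fun x : X => TangentSpace (𝓡 m) x)]

/-- Near `u` the map is the inverse chart composed with `p.coord ∘ f`, so differentiability can be
tested on coordinates, where Rademacher's theorem applies. -/
lemma ChartPatch.mdifferentiableWithinAt {ε : ℝ} {x₀ : X} (p : ChartPatch m ε x₀) {f : Euc n → X}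
    {K : Set (Euc n)} {u : Euc n} (hf : ContinuousWithinAt f K u) (hu : f u ∈ p.dom)
    (h : DifferentiableWithinAt ℝ (p.coord ∘ f) K u) :
    MDifferentiableWithinAt 𝓘(ℝ, Euc n) (𝓡 m) f K u := by
  have h1 : MDifferentiableAt 𝓘(ℝ, Euc m) (𝓡 m) (extChartAt (𝓡 m) x₀).symm ((p.coord ∘ f) u) := by
    have := mdifferentiableWithinAt_extChartAt_symm (I := 𝓡 m) (p.coord_mem_target (subset_closure hu))
    rwa [ModelWithCorners.range_eq_univ, mdifferentiableWithinAt_univ] at this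
  refine (h1.comp_mdifferentiableWithinAt u h.mdifferentiableWithinAt).congr_of_eventuallyEq ?_
    (p.symm_coord (subset_closure hu)).symm
  filter_upwards [hf.preimage_mem_nhdsWithin (p.isOpen_dom.mem_nhds hu)] with y hy
  exact (p.symm_coord (subset_closure hy)).symm

lemma measurableSet_inter_preimage' {f : Euc n → X} {K : Set (Euc n)}
    (hK : MeasurableSet K) (hf : ContinuousOn f K) {U : Set X} (hU : IsOpen U) :
    MeasurableSet (K ∩ f ⁻¹' U) := by
  obtain ⟨V, hV, h⟩ := continuousOn_iff'.1 hf U hU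
  rw [inter_comm, h]
  exact hV.measurableSet.inter hK

variable [IsContinuousRiemannianBundle (Euc m) (fun x : X => TangentSpace (𝓡 m) x)]
  [IsRiemannianManifold (𝓡 m) X] [SecondCountableTopology X]

/-- Rademacher's theorem for Lipschitz maps to a manifold. -/
lemma ae_mdifferentiableWithinAt {f : Euc n → X} {K : Set (Euc n)} (hK : MeasurableSet K) {c : ℝ≥0}
    (hf : LipschitzOnWith c f K) :
    ∀ᵐ u ∂(volume.restrict K), MDifferentiableWithinAt 𝓘(ℝ, Euc n) (𝓡 m) f K u := by
  have p : ∀ x : X, ChartPatch m 1 x := fun x => (nonempty_chartPatch one_pos x).some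
  obtain ⟨s, hs, hcov⟩ := exists_countable_cover_chartPatch p
  have h1 : ∀ᵐ u ∂(volume.restrict K), ∀ x ∈ s, DifferentiableWithinAt ℝ ((p x).coord ∘ f) K u :=
    (ae_ball_iff hs).2 fun x _ =>
      ((p x).lipschitz_coord.comp_lipschitzOnWith hf).ae_differentiableWithinAt hK
  filter_upwards [h1, ae_restrict_mem hK] with u hu huK
  obtain ⟨x, hx, hux⟩ := mem_iUnion₂.1 (hcov ▸ mem_univ (f u))
  exact (p x).mdifferentiableWithinAt (hf.continuousOn u huK) hux (hu x hx)

/-- Measurability of the pullback of a form under a Lipschitz map. -/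
lemma aestronglyMeasurable_form_pAt {f : Euc n → X} {K : Set (Euc n)} (hK : MeasurableSet K)
    {c : ℝ≥0} (hf : LipschitzOnWith c f K) {k : ℕ} (α : TestForm m X k) (e : Fin k → Euc n) :
    AEStronglyMeasurable (fun u => α.1 (f u) fun j => pAt f K u (e j)) (volume.restrict K) := by
  have p : ∀ x : X, ChartPatch m 1 x := fun x => (nonempty_chartPatch one_pos x).some
  obtain ⟨s, hs, hcov⟩ := exists_countable_cover_chartPatch p
  have : Countable s := hs
  have hK' : K = ⋃ x : s, K ∩ f ⁻¹' (p x).dom := by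
    rw [← inter_iUnion, ← preimage_iUnion, iUnion_coe_set, hcov, preimage_univ, inter_univ]
  suffices h : ∀ x : s, AEStronglyMeasurable (fun u => α.1 (f u) fun j => pAt f K u (e j))
      (volume.restrict (K ∩ f ⁻¹' (p x).dom)) by
    have := aestronglyMeasurable_iUnion_iff.2 h
    rwa [← hK'] at this
  intro x
  set S := K ∩ f ⁻¹' (p x).dom
  have hS : MeasurableSet S := measurableSet_inter_preimage' hK hf.continuousOn (p x).isOpen_dom
  have hSK : S ⊆ K := inter_subset_left
  have hΦ := (p x).lipschitz_coord.comp_lipschitzOnWith hf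
  -- The derivative of a function defined on the whole space is measurable in the point; it agrees
  -- almost everywhere on `K` with the derivative along `K`.
  obtain ⟨Φ, hΦl, hΦe⟩ : ∃ Φ : Euc n → Euc m, (∃ c : ℝ≥0, LipschitzWith c Φ) ∧
      EqOn ((p x).coord ∘ f) Φ K := by
    obtain ⟨g, hg, hge⟩ := hΦ.extend_finite_dimension
    exact ⟨g, ⟨_, hg⟩, hge⟩
  obtain ⟨cΦ, hcΦ⟩ := hΦl
  have h1 : ContinuousOn (fun u => chartRep α.1 (x : X) (Φ u)) S :=
    (α.2.1 x).continuousOn.comp hcΦ.continuous.continuousOn fun u hu => by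
      rw [← hΦe (hSK hu)]
      exact (p x).coord_mem_target (subset_closure hu.2)
  have h2 : AEStronglyMeasurable (fun u => chartRep α.1 (x : X) (Φ u)) (volume.restrict S) :=
    h1.aestronglyMeasurable hS
  have h3 : AEStronglyMeasurable (fun u => fun j => fderiv ℝ Φ u (e j)) (volume.restrict S) :=
    (measurable_pi_lambda _ fun j => measurable_fderiv_apply_const ℝ Φ (e j)).aestronglyMeasurable
  refine (continuous_alternatingMap_eval.comp_aestronglyMeasurable (h2.prodMk h3)).congr ?_
  filter_upwards [ae_restrict_of_ae_restrict_of_subset hSK (ae_mdifferentiableWithinAt (m := m) hK hf),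
    ae_restrict_of_ae_restrict_of_subset hSK (ae_uniqueDiffWithinAt K),
    ae_restrict_of_ae_restrict_of_subset hSK (ae_fderivWithin_eq_fderiv hK hcΦ hΦe),
    ae_restrict_mem hS] with u hu1 hu2 hu3 hu4
  rw [(p x).form_apply α.1 (subset_closure hu4.2)]
  have e1 : Φ u = (p x).coord (f u) := (hΦe (hSK hu4)).symm
  have e2 : (fun j => fderiv ℝ Φ u (e j)) = fun j => dAt (p x).coord (f u) (pAt (m := m) f K u (e j)) := by
    funext j
    rw [← fderivWithin_comp_apply (p x).contMDiff_coord hu1 hu2, hu3.2.2]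
  simp only [e1, e2]

end Parametrizations

/-! ### Pairing currents with bounded Borel functions -/

section Pairing

variable {m n : ℕ} {X : Type*} [EMetricSpace X] [ChartedSpace (Euc m) X]

namespace RectParam

variable (P : RectParam m X n)

/-- The pairing of a parametrized current with the product of a bounded Borel function and a test
form. -/
def pair (w : X → ℝ) (α : TestForm m X n) : ℝ :=
  ∑' i, ∫ u in P.dom i, w (P.map i u) * pushDensity (P.dom i) (P.map i) (P.mult i) α u

lemma pair_one (α : TestForm m X n) : P.pair 1 α = P.toCurrent α := by
  simp [pair, toCurrent]

variable [MeasurableSpace X] [BorelSpace X]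

lemma aemeasurable_map (i : P.index) : AEMeasurable (P.map i) (volume.restrict (P.dom i)) := by
  obtain ⟨c, hc⟩ := P.lipschitz i
  exact hc.continuousOn.aemeasurable (P.measurableSet_dom i)

variable {w : X → ℝ} {c : ℝ}

lemma integrableOn_pair (hw : Measurable w) (hc : ∀ x, |w x| ≤ c) (α : TestForm m X n)
    (i : P.index) : IntegrableOn (fun u => w (P.map i u) *
      pushDensity (P.dom i) (P.map i) (P.mult i) α u) (P.dom i) :=
  (P.integrable α i).bdd_mul (hw.comp_aemeasurable (P.aemeasurable_map i)).aestronglyMeasurable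
    (Filter.Eventually.of_forall fun u => hc (P.map i u))

lemma abs_integral_pair_le (hc : ∀ x, |w x| ≤ c) (α : TestForm m X n) (i : P.index) :
    |∫ u in P.dom i, w (P.map i u) * pushDensity (P.dom i) (P.map i) (P.mult i) α u| ≤
      c * ∫ u in P.dom i, |pushDensity (P.dom i) (P.map i) (P.mult i) α u| := by
  rw [← integral_const_mul]
  refine (Real.norm_eq_abs _).symm.le.trans (norm_integral_le_of_norm_le
    ((P.integrable α i).abs.const_mul c) (Filter.Eventually.of_forall fun u => ?_))
  rw [norm_mul]
  exact mul_le_mul_of_nonneg_right (hc _) (abs_nonneg _)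

lemma summable_pair (hc : ∀ x, |w x| ≤ c) (α : TestForm m X n) : Summable fun i =>
    ∫ u in P.dom i, w (P.map i u) * pushDensity (P.dom i) (P.map i) (P.mult i) α u :=
  Summable.of_norm_bounded ((P.summable α).mul_left c) (P.abs_integral_pair_le hc α)

lemma pair_add_right (hw : Measurable w) (hc : ∀ x, |w x| ≤ c) (α β : TestForm m X n) :
    P.pair w (α + β) = P.pair w α + P.pair w β := by
  rw [pair, pair, pair, ← (P.summable_pair hc α).tsum_add (P.summable_pair hc β)]
  refine tsum_congr fun i => ?_
  rw [← integral_add (P.integrableOn_pair hw hc α i) (P.integrableOn_pair hw hc β i)]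
  simp only [pushDensity_add, Pi.add_apply, mul_add]

lemma pair_sum_right (hw : Measurable w) (hc : ∀ x, |w x| ≤ c) {ι : Type*} (J : Finset ι)
    (β : ι → TestForm m X n) : P.pair w (∑ j ∈ J, β j) = ∑ j ∈ J, P.pair w (β j) := by
  classical
  induction J using Finset.induction_on with
  | empty =>
    have : ∀ i u, pushDensity (m := m) (P.dom i) (P.map i) (P.mult i) 0 u = 0 := fun i u => by
      change _ * (0 : ℝ) = 0; simp
    simp [pair, this]
  | insert j J hj ih => rw [Finset.sum_insert hj, Finset.sum_insert hj, P.pair_add_right hw hc, ih]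

lemma toCurrent_restrict {B : Set X} (hB : MeasurableSet B) (α : TestForm m X n) :
    (P.restrict B hB).toCurrent α = P.pair (B.indicator 1) α := by
  refine tsum_congr fun i => setIntegral_congr_fun (P.measurableSet_dom i) fun u hu => ?_
  change pushDensity (m := m) (P.dom i) (P.map i) ((P.dom i ∩ P.map i ⁻¹' B).indicator (P.mult i)) α u = _
  rw [pushDensity_indicator]
  by_cases h : P.map i u ∈ B
  · rw [indicator_of_mem (show u ∈ P.dom i ∩ P.map i ⁻¹' B from ⟨hu, h⟩)]
    simp [h]
  · rw [indicator_of_notMem (fun h' => h h'.2)]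
    simp [h]

/-- Dominated convergence for the pairing. -/
lemma tendsto_pair {w' : ℕ → X → ℝ} (hw : ∀ k, Measurable (w' k)) (hc : ∀ k x, |w' k x| ≤ c)
    (α : TestForm m X n)
    (h : ∀ x, α.1 x ≠ 0 → Filter.Tendsto (fun k => w' k x) Filter.atTop (𝓝 (w x))) :
    Filter.Tendsto (fun k => P.pair (w' k) α) Filter.atTop (𝓝 (P.pair w α)) := by
  refine tendsto_tsum_of_dominated_convergence ((P.summable α).mul_left c) (fun i => ?_)
    (Filter.Eventually.of_forall fun k i => P.abs_integral_pair_le (hc k) α i)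
  refine tendsto_integral_of_dominated_convergence
    (fun u => c * |pushDensity (P.dom i) (P.map i) (P.mult i) α u|)
    (fun k => (P.integrableOn_pair (hw k) (hc k) α i).aestronglyMeasurable)
    ((P.integrable α i).abs.const_mul c) (fun k => Filter.Eventually.of_forall fun u => ?_)
    (Filter.Eventually.of_forall fun u => ?_)
  · rw [norm_mul]
    exact mul_le_mul_of_nonneg_right (hc k _) (abs_nonneg _)
  · by_cases h0 : α.1 (P.map i u) = 0
    · have : pushDensity (P.dom i) (P.map i) (P.mult i) α u = 0 := by
        rw [pushDensity_apply, h0]; simp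
      simp [this]
    · exact (h _ h0).mul_const _

variable [IsManifold (𝓡 m) ∞ X]

lemma pair_fmul (w : X → ℝ) {u : X → ℝ} (hu : ContMDiff (𝓡 m) 𝓘(ℝ, ℝ) ∞ u) (α : TestForm m X n) :
    P.pair w (TestForm.fmul u hu α) = P.pair (w * u) α := by
  refine tsum_congr fun i => integral_congr_ae (Filter.Eventually.of_forall fun v => ?_)
  simp only [pushDensity_apply, TestForm.fmul_apply, Pi.mul_apply]
  ring

end RectParam

end Pairing

/-! ### Smooth cutoffs and partitions of unity -/

section Cutoff

variable {m : ℕ} {X : Type*} [EMetricSpace X] [ChartedSpace (Euc m) X] [IsManifold (𝓡 m) ∞ X]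
  [SecondCountableTopology X]

/-- The indicator function of a sublevel set is a pointwise limit of smooth functions. -/
lemma exists_smooth_tendsto_indicator {τ : X → ℝ} (hτ : Continuous τ) (p : ℝ) :
    ∃ χ : ℕ → X → ℝ, (∀ k, ContMDiff (𝓡 m) 𝓘(ℝ, ℝ) ∞ (χ k)) ∧ (∀ k x, 0 ≤ χ k x ∧ χ k x ≤ 1) ∧
      ∀ x, Filter.Tendsto (fun k => χ k x) Filter.atTop (𝓝 ({x | τ x < p}.indicator 1 x)) := by
  have : LocallyCompactSpace X := ChartedSpace.locallyCompactSpace (Euc m) X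
  choose g hg _ using fun k : ℕ => hτ.exists_contMDiff_approx (𝓡 m) (⊤ : ℕ∞)
    (continuous_const (y := 1 / ((k : ℝ) + 1))) (fun _ => by positivity)
  -- The shift by `1 / (k + 1)`, the accuracy of `g k`, makes the argument nonpositive wherever `p ≤
  -- τ x`; the factor `k` makes it eventually at least `1` wherever `τ x < p`.
  refine ⟨fun k x => Real.smoothTransition (k * (p - 1 / ((k : ℝ) + 1) - g k x)), fun k => ?_,
    fun k x => ⟨Real.smoothTransition.nonneg _, Real.smoothTransition.le_one _⟩, fun x => ?_⟩
  · have h1 : ContDiff ℝ ∞ fun t : ℝ => Real.smoothTransition (k * (p - 1 / ((k : ℝ) + 1) - t)) :=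
      Real.smoothTransition.contDiff.comp (by fun_prop)
    exact h1.contMDiff.comp (g k).contMDiff
  · have hg' : ∀ k, |g k x - τ x| < 1 / ((k : ℝ) + 1) := fun k => hg k x
    by_cases h : τ x < p
    · rw [indicator_of_mem (by exact h), Pi.one_apply]
      refine tendsto_const_nhds.congr' ?_
      obtain ⟨N, hN⟩ := exists_nat_gt (4 / (p - τ x) + 1)
      have hpos : 0 < p - τ x := sub_pos.2 h
      filter_upwards [Filter.eventually_ge_atTop N] with k hk
      have hkN : (N : ℝ) ≤ k := by exact_mod_cast hk
      have h4 : 4 / (p - τ x) < k := by linarith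
      have hk0 : (0 : ℝ) < k := lt_trans (by positivity) h4
      have h5 : 4 < k * (p - τ x) := by rwa [div_lt_iff₀ hpos] at h4
      have h6 : (k : ℝ) * (1 / ((k : ℝ) + 1)) ≤ 1 := by
        rw [mul_one_div, div_le_one (by positivity)]; linarith
      have h7 := (abs_lt.1 (hg' k)).2
      rw [Real.smoothTransition.one_of_one_le]
      nlinarith
    · rw [indicator_of_notMem (by exact h)]
      refine tendsto_const_nhds.congr fun k => ?_
      have h7 := (abs_lt.1 (hg' k)).1
      refine (Real.smoothTransition.zero_of_nonpos ?_).symm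
      exact mul_nonpos_of_nonneg_of_nonpos (Nat.cast_nonneg k) (by linarith)

/-- Decomposition of a test form by means of a partition of unity. -/
lemma TestForm.exists_eq_sum_fmul {n : ℕ} (β : TestForm m X n) {ι : Type*} (U : ι → Set X)
    (hU : ∀ i, IsOpen (U i)) (hcov : closure {x | β.1 x ≠ 0} ⊆ ⋃ i, U i) :
    ∃ (J : Finset ι) (χ : ι → X → ℝ) (hχ : ∀ i, ContMDiff (𝓡 m) 𝓘(ℝ, ℝ) ∞ (χ i)),
      (∀ i x, 0 ≤ χ i x) ∧ (∀ x, ∑ i ∈ J, χ i x ≤ 1) ∧ (∀ i, tsupport (χ i) ⊆ U i) ∧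
      β = ∑ i ∈ J, TestForm.fmul (χ i) (hχ i) β := by
  classical
  have : LocallyCompactSpace X := ChartedSpace.locallyCompactSpace (Euc m) X
  obtain ⟨f, hf⟩ := SmoothPartitionOfUnity.exists_isSubordinate (𝓡 m)
    (isClosed_closure (s := {x | β.1 x ≠ 0})) U hU hcov
  have hfin := f.locallyFinite.finite_nonempty_inter_compact β.2.2
  have hsum : ∀ x, ∑ i ∈ hfin.toFinset, f i x ≤ ∑ᶠ i, f i x := fun x => by
    rw [finsum_eq_sum_of_support_subset_of_finite _ (s := Function.support fun i => f i x) subset_rfl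
      (f.locallyFinite.point_finite x)]
    have h1 : ∑ i ∈ hfin.toFinset, f i x =
        ∑ i ∈ hfin.toFinset ∩ (f.locallyFinite.point_finite x).toFinset, f i x := by
      refine (Finset.sum_subset Finset.inter_subset_left fun i hi hi' => ?_).symm
      by_contra hne
      exact hi' (Finset.mem_inter.2 ⟨hi, by simpa using hne⟩)
    rw [h1]
    refine Finset.sum_le_sum_of_subset_of_nonneg (fun i hi => ?_) fun i _ _ => f.nonneg i x
    exact (Finset.mem_inter.1 hi).2
  refine ⟨hfin.toFinset, fun i => f i, fun i => (f i).contMDiff, fun i x => f.nonneg i x,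
    fun x => (hsum x).trans (f.sum_le_one x), hf, ?_⟩
  ext1
  funext x
  rw [AddSubmonoidClass.coe_finsetSum, Finset.sum_apply]
  by_cases hx : β.1 x = 0
  · rw [hx]
    refine (Finset.sum_eq_zero fun i _ => ?_).symm
    ext v
    rw [TestForm.fmul_apply, hx]; simp
  · have hxc : x ∈ closure {x | β.1 x ≠ 0} := subset_closure hx
    have h1 : ∑ i ∈ hfin.toFinset, f i x = 1 := by
      rw [← f.sum_eq_one hxc]
      refine (finsum_eq_sum_of_support_subset _ fun i hi => ?_).symm
      simp only [Finite.coe_toFinset, mem_ofPred_eq]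
      exact ⟨x, hi, hxc⟩
    ext v
    have h2 : (∑ i ∈ hfin.toFinset, (TestForm.fmul (f i) (f i).contMDiff β).1 x) v =
        ∑ i ∈ hfin.toFinset, f i x * β.1 x v := by
      rw [ContinuousAlternatingMap.sum_apply]; rfl
    refine Eq.trans ?_ h2.symm
    rw [← Finset.sum_mul, h1, one_mul]

lemma TestForm.closure_fmul_subset {n : ℕ} (β : TestForm m X n) {χ : X → ℝ}
    (hχ : ContMDiff (𝓡 m) 𝓘(ℝ, ℝ) ∞ χ) :
    closure {x | (TestForm.fmul χ hχ β).1 x ≠ 0} ⊆ tsupport χ ∩ closure {x | β.1 x ≠ 0} := by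
  refine subset_inter (closure_mono fun x hx h0 => hx ?_) (closure_mono fun x hx h0 => hx ?_)
  · ext v
    rw [TestForm.fmul_apply, h0, zero_mul]; rfl
  · ext v
    rw [TestForm.fmul_apply, h0]; exact mul_zero _

/-- A current vanishes on the forms whose support does not meet its support. -/
lemma Current.apply_eq_zero_of_disjoint_support {n : ℕ} (T : Current m X n) (β : TestForm m X n)
    (h : Disjoint (closure {x | β.1 x ≠ 0}) T.support) : T β = 0 := by
  have h1 : ∀ x : closure {x | β.1 x ≠ 0}, ∃ U : Set X, IsOpen U ∧ (x : X) ∈ U ∧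
      ∀ α : TestForm m X n, closure {y | α.1 y ≠ 0} ⊆ U → T α = 0 := by
    intro x
    have := disjoint_left.1 h x.2
    simp only [Current.support, mem_ofPred_eq, not_forall, not_exists, not_and, not_not] at this
    obtain ⟨U, hU, hxU, h2⟩ := this
    exact ⟨U, hU, hxU, h2⟩
  choose U hU hxU hT using h1
  obtain ⟨J, χ, hχ, -, -, hsub, heq⟩ := TestForm.exists_eq_sum_fmul β U hU
    fun x hx => mem_iUnion.2 ⟨⟨x, hx⟩, hxU _⟩
  rw [heq, map_sum]
  exact Finset.sum_eq_zero fun i _ => hT i _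
    ((TestForm.closure_fmul_subset β (hχ i)).trans (inter_subset_left.trans (hsub i)))

end Cutoff

/-! ### Masses in sublevel sets -/

section Mass

variable {m n : ℕ} {X : Type*} [EMetricSpace X] [ChartedSpace (Euc m) X] [IsManifold (𝓡 m) ∞ X]
  [SecondCountableTopology X] [MeasurableSpace X] [BorelSpace X]
  [RiemannianBundle (fun x : X => TangentSpace (𝓡 m) x)]

/-- A form has comass at most `c`. -/
def ComassLE (α : TestForm m X n) (c : ℝ) : Prop :=
  ∀ (x : X) (v : Fin n → TangentSpace (𝓡 m) x), (∀ j, ‖v j‖ ≤ 1) → |α.1 x v| ≤ c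

lemma Current.le_mass (T : Current m X n) {α : TestForm m X n} (hα : ComassLE α 1) :
    ENNReal.ofReal (T α) ≤ T.mass :=
  le_iSup₂ (f := fun (α : TestForm m X n) _ => ENNReal.ofReal (T α)) α hα

variable (P : RectParam m X n) {τ : X → ℝ}

lemma measurableSet_sublevel (hτ : Continuous τ) (p : ℝ) : MeasurableSet {x | τ x < p} :=
  (isOpen_lt hτ continuous_const).measurableSet

/-- Multiplying a form by a smooth function with values in `[0, 1]` does not increase its comass.
Such functions converge to the indicator, and the pairing passes to the limit by dominated
convergence. -/
lemma RectParam.mass_restrict_sublevel_le (hτ : Continuous τ) (p : ℝ) :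
    (P.restrict {x | τ x < p} (measurableSet_sublevel hτ p)).toCurrent.mass ≤
      P.toCurrent.mass := by
  obtain ⟨χ, hχ, hχ1, hχ2⟩ := exists_smooth_tendsto_indicator (m := m) hτ p
  refine iSup₂_le fun α hα => ?_
  rw [P.toCurrent_restrict]
  have h1 := P.tendsto_pair (c := 1) (fun k => (hχ k).continuous.measurable)
    (fun k x => abs_le.2 ⟨by linarith [(hχ1 k x).1], (hχ1 k x).2⟩) α fun x _ => hχ2 x
  refine le_of_tendsto (ENNReal.tendsto_ofReal h1) (Filter.Eventually.of_forall fun k => ?_)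
  rw [← one_mul (χ k), ← P.pair_fmul 1 (hχ k), P.pair_one]
  refine Current.le_mass _ fun x v hv => ?_
  rw [TestForm.fmul_apply, abs_mul, abs_of_nonneg (hχ1 k x).1]
  exact mul_le_one₀ (hχ1 k x).2 (abs_nonneg _) (hα x v hv)

/-- The two forms are glued to `χ k α + (1 - χ k) ζ`, where `χ k` tends to the indicator of `{τ <
p}`. At each point this is a convex combination, so it is a competitor for the mass in `{τ < q}`. -/
lemma RectParam.ofReal_pair_add_le (hτ : Continuous τ) {p q : ℝ} (hpq : p ≤ q) {α ζ : TestForm m X n}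
    (hα : ComassLE α 1) (hζ : ComassLE ζ 1) (h0 : ∀ x, ζ.1 x ≠ 0 → p ≤ τ x ∧ τ x < q) :
    ENNReal.ofReal (P.pair ({x | τ x < p}.indicator 1) α + P.toCurrent ζ) ≤
      (P.restrict {x | τ x < q} (measurableSet_sublevel hτ q)).toCurrent.mass := by
  obtain ⟨χ, hχ, hχ1, hχ2⟩ := exists_smooth_tendsto_indicator (m := m) hτ p
  have hi : Measurable ({x | τ x < q}.indicator (1 : X → ℝ)) :=
    measurable_one.indicator (measurableSet_sublevel hτ q)
  have hi1 : ∀ x, 0 ≤ {x | τ x < q}.indicator (1 : X → ℝ) x ∧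
      {x | τ x < q}.indicator (1 : X → ℝ) x ≤ 1 := fun x => by
    by_cases h : x ∈ {x | τ x < q} <;> simp [h]
  have hi2 : ∀ x, |{x | τ x < q}.indicator (1 : X → ℝ) x| ≤ 1 := fun x =>
    abs_le.2 ⟨by linarith [(hi1 x).1], (hi1 x).2⟩
  have hχ' : ∀ k, ContMDiff (𝓡 m) 𝓘(ℝ, ℝ) ∞ (fun x => 1 - χ k x) := fun k =>
    contMDiff_const.sub (hχ k)
  have h1 : Filter.Tendsto (fun k => P.pair ({x | τ x < q}.indicator 1 * χ k) α) Filter.atTop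
      (𝓝 (P.pair ({x | τ x < p}.indicator 1) α)) := by
    refine P.tendsto_pair (c := 1) (fun k => hi.mul (hχ k).continuous.measurable)
      (fun k x => ?_) α fun x _ => ?_
    · rw [Pi.mul_apply, abs_mul, abs_of_nonneg (hχ1 k x).1]
      exact mul_le_one₀ (hi2 x) (hχ1 k x).1 (hχ1 k x).2
    · have := (hχ2 x).const_mul ({x | τ x < q}.indicator (1 : X → ℝ) x)
      have e : {x | τ x < q}.indicator (1 : X → ℝ) x * {x | τ x < p}.indicator (1 : X → ℝ) x =
          {x | τ x < p}.indicator 1 x := by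
        by_cases h : τ x < p
        · simp [h, h.trans_le hpq]
        · simp [h]
      rwa [e] at this
  have h2 : Filter.Tendsto (fun k => P.pair ({x | τ x < q}.indicator 1 * fun x => 1 - χ k x) ζ)
      Filter.atTop (𝓝 (P.pair 1 ζ)) := by
    refine P.tendsto_pair (c := 1) (fun k => hi.mul (hχ' k).continuous.measurable)
      (fun k x => ?_) ζ fun x hx => ?_
    · rw [Pi.mul_apply, abs_mul, abs_of_nonneg (sub_nonneg.2 (hχ1 k x).2)]
      exact mul_le_one₀ (hi2 x) (sub_nonneg.2 (hχ1 k x).2) (by linarith [(hχ1 k x).1])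
    · have := ((hχ2 x).const_sub 1).const_mul ({x | τ x < q}.indicator (1 : X → ℝ) x)
      have hx1 : x ∈ {x | τ x < q} := (h0 x hx).2
      have hx2 : x ∉ {x | τ x < p} := fun h => absurd h (not_lt.2 (h0 x hx).1)
      simpa [hx1, hx2] using this
  rw [P.pair_one] at h2
  refine le_of_tendsto (ENNReal.tendsto_ofReal (h1.add h2)) (Filter.Eventually.of_forall fun k => ?_)
  rw [← P.pair_fmul _ (hχ k), ← P.pair_fmul _ (hχ' k), ← P.pair_add_right hi hi2,
    ← P.toCurrent_restrict (measurableSet_sublevel hτ q)]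
  refine Current.le_mass _ fun x v hv => ?_
  have e : (TestForm.fmul (χ k) (hχ k) α + TestForm.fmul (fun x => 1 - χ k x) (hχ' k) ζ).1 x v =
    χ k x * α.1 x v + (1 - χ k x) * ζ.1 x v := rfl
  rw [e, abs_le]
  have ha := abs_le.1 (hα x v hv)
  have hw := abs_le.1 (hζ x v hv)
  obtain ⟨hc0, hc1⟩ := hχ1 k x
  constructor <;> nlinarith

/-- The mass in a sublevel set plus the value on a form of comass at most `κ` supported in the
annulus is at most the mass in the larger sublevel set. -/
lemma RectParam.mass_add_toCurrent_le (hτ : Continuous τ) (hP : P.toCurrent.mass < ⊤) {p q : ℝ} (hpq : p ≤ q)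
    {ζ : TestForm m X n} {κ : ℝ} (hκ : 0 < κ) (hζ : ComassLE ζ κ)
    (h0 : ∀ x, ζ.1 x ≠ 0 → p ≤ τ x ∧ τ x < q) :
    |P.toCurrent ζ| ≤
      κ * ((P.restrict {x | τ x < q} (measurableSet_sublevel hτ q)).toCurrent.mass.toReal -
        (P.restrict {x | τ x < p} (measurableSet_sublevel hτ p)).toCurrent.mass.toReal) := by
  set f := fun r => (P.restrict {x | τ x < r} (measurableSet_sublevel hτ r)).toCurrent.mass with hf
  have hfin : ∀ r, f r ≠ ⊤ := fun r => ((P.mass_restrict_sublevel_le hτ r).trans_lt hP).ne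
  -- The supremum over `α` in the previous estimate turns its first term into the mass in `{τ < p}`.
  -- The result is then applied to `ζ` divided by `κ` and by `-κ`.
  have key : ∀ η : TestForm m X n, ComassLE η 1 → (∀ x, η.1 x ≠ 0 → p ≤ τ x ∧ τ x < q) →
      P.toCurrent η ≤ (f q).toReal - (f p).toReal := by
    intro η hη hη0
    have h1 : ∀ α : TestForm m X n, ComassLE α 1 →
        P.pair ({x | τ x < p}.indicator 1) α + P.toCurrent η ≤ (f q).toReal := fun α hα =>
      (ENNReal.ofReal_le_iff_le_toReal (hfin q)).1 (P.ofReal_pair_add_le hτ hpq hα hη hη0)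
    have h2 : 0 ≤ (f q).toReal - P.toCurrent η := by
      have := h1 0 (fun x v _ => by change |(0 : ℝ)| ≤ 1; simp)
      have e : P.pair ({x | τ x < p}.indicator 1) 0 = 0 := by
        rw [← P.toCurrent_restrict (measurableSet_sublevel hτ p), map_zero]
      rw [e] at this; linarith
    have h3 : f p ≤ ENNReal.ofReal ((f q).toReal - P.toCurrent η) := by
      refine iSup₂_le fun α hα => ENNReal.ofReal_le_ofReal ?_
      rw [P.toCurrent_restrict]
      linarith [h1 α hα]
    have h4 := ENNReal.toReal_mono ENNReal.ofReal_ne_top h3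
    rw [ENNReal.toReal_ofReal h2] at h4
    linarith
  have hsc : ∀ s : ℝ, |s| = κ⁻¹ → ComassLE (s • ζ) 1 := fun s hs x v hv => by
    have e : (s • ζ).1 x v = s * ζ.1 x v := rfl
    rw [e, abs_mul, hs, inv_mul_le_iff₀ hκ, mul_one]
    exact hζ x v hv
  have hsc0 : ∀ s : ℝ, ∀ x, (s • ζ).1 x ≠ 0 → p ≤ τ x ∧ τ x < q := fun s x hx =>
    h0 x fun h => hx (by change s • ζ.1 x = 0; rw [h, smul_zero])
  have k1 := key _ (hsc κ⁻¹ (abs_of_pos (inv_pos.2 hκ))) (hsc0 _)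
  have k2 := key _ (hsc (-κ⁻¹) (by rw [abs_neg]; exact abs_of_pos (inv_pos.2 hκ))) (hsc0 _)
  rw [map_smul, smul_eq_mul, inv_mul_le_iff₀ hκ] at k1
  rw [map_smul, smul_eq_mul, neg_mul, ← mul_neg, inv_mul_le_iff₀ hκ] at k2
  exact abs_le.2 ⟨by linarith, k1⟩

end Mass

/-! ### Subdividing a parametrization -/

section Refine

variable {m n : ℕ} {X : Type*} [EMetricSpace X] [ChartedSpace (Euc m) X] [IsManifold (𝓡 m) ∞ X]
  [RiemannianBundle (fun x : X => TangentSpace (𝓡 m) x)]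
  [IsContinuousRiemannianBundle (Euc m) (fun x : X => TangentSpace (𝓡 m) x)]
  [IsRiemannianManifold (𝓡 m) X] [SecondCountableTopology X]

/-- The derivative along a subset agrees almost everywhere with the derivative along the set. -/
lemma ae_pAt_eq {f : Euc n → X} {K S : Set (Euc n)} (hK : MeasurableSet K)
    {c : ℝ≥0} (hf : LipschitzOnWith c f K) (hSK : S ⊆ K) :
    ∀ᵐ u ∂(volume.restrict S), pAt (m := m) f S u = pAt (m := m) f K u := by
  filter_upwards [ae_restrict_of_ae_restrict_of_subset hSK (ae_mdifferentiableWithinAt (m := m) hK hf),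
    ae_uniqueDiffWithinAt S] with u h1 h2
  exact mfderivWithin_subset hSK h2.uniqueMDiffWithinAt h1

lemma pushDensity_ae_eq {f : Euc n → X} {K S : Set (Euc n)} (hK : MeasurableSet K)
    {c : ℝ≥0} (hf : LipschitzOnWith c f K) (hSK : S ⊆ K) (θ : Euc n → ℤ) (α : TestForm m X n) :
    pushDensity S f θ α =ᵐ[volume.restrict S] pushDensity K f θ α := by
  filter_upwards [ae_pAt_eq (m := m) hK hf hSK] with u hu
  rw [pushDensity_apply, pushDensity_apply, hu]

lemma hasSum_integral_of_partition {K : Set (Euc n)} {A : ℕ → Set (Euc n)}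
    (hA : ∀ k, MeasurableSet (A k)) (hd : Pairwise (Function.onFun Disjoint A)) (hs : ∀ k, A k ⊆ K)
    (h0 : volume (K \ ⋃ k, A k) = 0) {g : Euc n → ℝ} (hg : IntegrableOn g K) :
    HasSum (fun k => ∫ u in A k, g u) (∫ u in K, g u) := by
  have h1 : (⋃ k, A k) =ᵐ[volume] K :=
    (iUnion_subset hs).eventuallyLE.antisymm (ae_le_set.2 h0)
  rw [← setIntegral_congr_set h1]
  exact hasSum_integral_iUnion hA hd (hg.mono_set (iUnion_subset hs))

/-- A parametrization can be refined along countable partitions of its domains. -/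
lemma RectParam.exists_refinement [MeasurableSpace X] [BorelSpace X] (P : RectParam m X n)
    (G : (Euc n → X) → (Euc n → ℤ) → Set (Euc n) → Prop)
    (h : ∀ i, ∃ A : ℕ → Set (Euc n), (∀ k, MeasurableSet (A k)) ∧
      Pairwise (Function.onFun Disjoint A) ∧
      (∀ k, A k ⊆ P.dom i) ∧ volume (P.dom i \ ⋃ k, A k) = 0 ∧ ∀ k, G (P.map i) (P.mult i) (A k)) :
    ∃ P' : RectParam m X n, (∀ q, G (P'.map q) (P'.mult q) (P'.dom q)) ∧
      P'.toCurrent = P.toCurrent ∧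
      ∀ (w : X → ℝ) (c : ℝ), Measurable w → (∀ x, |w x| ≤ c) →
        ∀ α, P'.pair w α = P.pair w α := by
  choose A hA hd hs h0 hG using h
  have hLip : ∀ i k, ∃ c : ℝ≥0, LipschitzOnWith c (P.map i) (A i k) := fun i k => by
    obtain ⟨c, hc⟩ := P.lipschitz i
    exact ⟨c, hc.mono (hs i k)⟩
  have hae : ∀ (α : TestForm m X n) i k, pushDensity (A i k) (P.map i) (P.mult i) α
      =ᵐ[volume.restrict (A i k)] pushDensity (P.dom i) (P.map i) (P.mult i) α := fun α i k => by
    obtain ⟨c, hc⟩ := P.lipschitz i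
    exact pushDensity_ae_eq (P.measurableSet_dom i) hc (hs i k) _ _
  have hsumabs : ∀ (α : TestForm m X n) i,
      HasSum (fun k => ∫ u in A i k, |pushDensity (P.dom i) (P.map i) (P.mult i) α u|)
        (∫ u in P.dom i, |pushDensity (P.dom i) (P.map i) (P.mult i) α u|) := fun α i =>
    hasSum_integral_of_partition (hA i) (hd i) (hs i) (h0 i) (P.integrable α i).abs
  have hsummable : ∀ α : TestForm m X n, Summable fun q : P.index × ℕ =>
      ∫ u in A q.1 q.2, |pushDensity (P.dom q.1) (P.map q.1) (P.mult q.1) α u| := fun α => by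
    refine (summable_prod_of_nonneg fun q => integral_nonneg fun u => abs_nonneg _).2
      ⟨fun i => (hsumabs α i).summable, ?_⟩
    simp only [(hsumabs α _).tsum_eq]
    exact P.summable α
  have := P.countable_index
  -- The densities of the new pieces involve derivatives along the pieces; these agree almost
  -- everywhere with the derivatives along the original domains.
  let P' : RectParam m X n :=
    { index := P.index × ℕ
      countable_index := inferInstance
      dom := fun q => A q.1 q.2
      map := fun q => P.map q.1
      mult := fun q => P.mult q.1
      measurableSet_dom := fun q => hA q.1 q.2
      lipschitz := fun q => hLip q.1 q.2
      measurable_mult := fun q => P.measurable_mult q.1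
      integrable := fun α q => ((P.integrable α q.1).mono_set (hs q.1 q.2)).congr (hae α q.1 q.2).symm
      summable := fun α => (hsummable α).congr fun q => integral_congr_ae (by
        filter_upwards [hae α q.1 q.2] with u hu
        rw [hu]) }
  have hpair : ∀ (w : X → ℝ) (c : ℝ), (∀ i (α : TestForm m X n), IntegrableOn (fun u => w (P.map i u) *
      pushDensity (P.dom i) (P.map i) (P.mult i) α u) (P.dom i)) → (∀ x, |w x| ≤ c) →
        ∀ α, P'.pair w α = P.pair w α := by
    intro w c hw hc α
    have h1 : ∀ i, HasSum (fun k => ∫ u in A i k, w (P.map i u) *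
        pushDensity (m := m) (A i k) (P.map i) (P.mult i) α u) (∫ u in P.dom i, w (P.map i u) *
          pushDensity (m := m) (P.dom i) (P.map i) (P.mult i) α u) := fun i => by
      have := hasSum_integral_of_partition (hA i) (hd i) (hs i) (h0 i) (hw i α)
      have e : (fun k => ∫ u in A i k, w (P.map i u) * pushDensity (m := m) (A i k) (P.map i) (P.mult i) α u)
          = fun k => ∫ u in A i k, w (P.map i u) * pushDensity (m := m) (P.dom i) (P.map i) (P.mult i) α u := by
        funext k
        refine integral_congr_ae ?_
        filter_upwards [hae α i k] with u hu
        rw [hu]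
      exact e ▸ this
    have h2 : Summable fun q : P.index × ℕ => ∫ u in A q.1 q.2, w (P.map q.1 u) *
        pushDensity (m := m) (A q.1 q.2) (P.map q.1) (P.mult q.1) α u := P'.summable_pair hc α
    exact (h2.tsum_prod' fun i => (h1 i).summable).trans (tsum_congr fun i => (h1 i).tsum_eq)
  refine ⟨P', fun q => hG q.1 q.2, ?_, ?_⟩
  swap
  · intro w c hw hc α
    exact hpair w c (fun i α => P.integrableOn_pair hw hc α i) hc α
  ext α
  rw [← P.pair_one, ← P'.pair_one]
  exact hpair 1 1 (fun i α => by simpa using P.integrable α i) (fun x => by simp) α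

end Refine

/-! ### The forms `dw ∧ α` and their pull-backs -/

section Wedge

variable {m : ℕ} {X : Type*} [EMetricSpace X] [ChartedSpace (Euc m) X]

/-- A test `1`-form at a point, as a linear form. -/
def TestForm.lin (α : TestForm m X 1) (x : X) : TangentSpace (𝓡 m) x →ₗ[ℝ] ℝ where
  toFun v := α.1 x fun _ => v
  map_add' v w := by
    have e : ∀ z : TangentSpace (𝓡 m) x, Function.update (fun _ : Fin 1 => v) 0 z = fun _ => z :=
      fun z => by funext i; rw [Subsingleton.elim i 0, Function.update_self]
    have := (α.1 x).map_update_add (fun _ => v) 0 v w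
    rwa [e, e, e] at this
  map_smul' c v := by
    have e : ∀ z : TangentSpace (𝓡 m) x, Function.update (fun _ : Fin 1 => v) 0 z = fun _ => z :=
      fun z => by funext i; rw [Subsingleton.elim i 0, Function.update_self]
    have := (α.1 x).map_update_smul (fun _ => v) 0 c v
    rwa [e, e] at this

lemma TestForm.apply_eq_lin (α : TestForm m X 1) (x : X) (v : Fin 1 → TangentSpace (𝓡 m) x) :
    α.1 x v = TestForm.lin α x (v 0) := by
  change _ = α.1 x fun _ => v 0
  congr 1; funext i; rw [Subsingleton.elim i 0]

/-- The density of the push-forward of the restriction of `dg ∧ f^*α` to a piece of a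
parametrization. -/
def wedgeDensity (g : Euc 2 → ℝ) (K : Set (Euc 2)) (f : Euc 2 → X) (θ : Euc 2 → ℤ)
    (α : TestForm m X 1) (u : Euc 2) : ℝ :=
  θ u * (fderivWithin ℝ g K u (EuclideanSpace.single 0 1) *
      TestForm.lin α (f u) (pAt f K u (EuclideanSpace.single 1 1)) -
    fderivWithin ℝ g K u (EuclideanSpace.single 1 1) *
      TestForm.lin α (f u) (pAt f K u (EuclideanSpace.single 0 1)))

variable [IsManifold (𝓡 m) ∞ X]

lemma TestForm.dwedge_apply_lin (w : X → ℝ) (hw : ContMDiff (𝓡 m) 𝓘(ℝ, ℝ) ∞ w) (α : TestForm m X 1)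
    (x : X) (v : Fin 2 → TangentSpace (𝓡 m) x) : (TestForm.dwedge w hw α).1 x v =
      dAt w x (v 0) * TestForm.lin α x (v 1) - dAt w x (v 1) * TestForm.lin α x (v 0) :=
  TestForm.dwedge_apply w hw α x v

lemma pushDensity_dwedge {w : X → ℝ} (hw : ContMDiff (𝓡 m) 𝓘(ℝ, ℝ) ∞ w) {f : Euc 2 → X}
    {K : Set (Euc 2)} {u : Euc 2} (hf : MDifferentiableWithinAt 𝓘(ℝ, Euc 2) (𝓡 m) f K u)
    (hK : UniqueDiffWithinAt ℝ K u) (θ : Euc 2 → ℤ) (α : TestForm m X 1) :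
    pushDensity K f θ (TestForm.dwedge w hw α) u = wedgeDensity (w ∘ f) K f θ α u := by
  rw [pushDensity_apply, TestForm.dwedge_apply_lin, wedgeDensity,
    fderivWithin_comp_apply hw hf hK, fderivWithin_comp_apply hw hf hK]

variable [RiemannianBundle (fun x : X => TangentSpace (𝓡 m) x)]

lemma ChartPatch.exists_lin_le {ε : ℝ} {x₀ : X} (p : ChartPatch m ε x₀) (α : TestForm m X 1) :
    ∃ C : ℝ, 0 ≤ C ∧ ∀ x ∈ p.dom, ∀ v : TangentSpace (𝓡 m) x,
      |TestForm.lin α x v| ≤ C * ‖dAt p.coord x v‖ := by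
  obtain ⟨C, hC, h⟩ := p.exists_form_le α
  exact ⟨C, hC, fun x hx v => by
    have := h x hx fun _ => v
    rwa [Fin.prod_univ_one] at this⟩

/-- The wedge product of a covector with a form is controlled by the coordinate `2`-forms. -/
lemma ChartPatch.exists_wedge_le {ε : ℝ} {x₀ : X} (p : ChartPatch m ε x₀) (α : TestForm m X 1) :
    ∃ C : ℝ, 0 ≤ C ∧ ∀ x ∈ p.dom, ∀ (v : Fin 2 → TangentSpace (𝓡 m) x) (q r a : ℝ), 0 ≤ a →
      (∀ s t : ℝ, |s * q + t * r| ≤ a * ‖s • dAt p.coord x (v 0) + t • dAt p.coord x (v 1)‖) →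
      |q * TestForm.lin α x (v 1) - r * TestForm.lin α x (v 0)| ≤
        C * (a * ∑ i, ∑ j, |(p.dcoord₂ i j).1 x v|) := by
  obtain ⟨C, hC, h⟩ := p.exists_lin_le α
  refine ⟨C, hC, fun x hx v q r a ha hqr => ?_⟩
  -- As in Hadamard's inequality, the expression is the value of `α` at one vector, whose
  -- coordinates are controlled by the minors.
  have h1 : q * TestForm.lin α x (v 1) - r * TestForm.lin α x (v 0) =
      TestForm.lin α x (q • v 1 - r • v 0) := by
    rw [map_sub, map_smul, map_smul]; rfl
  rw [h1]
  refine (h x hx _).trans (mul_le_mul_of_nonneg_left ?_ hC)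
  rw [map_sub, map_smul, map_smul]
  refine (norm_smul_sub_smul_le_sum ha hqr).trans (le_of_eq ?_)
  congr 1
  refine Finset.sum_congr rfl fun i _ => Finset.sum_congr rfl fun j _ => ?_
  rw [p.dcoord₂_apply]
  congr 1; ring

end Wedge

/-! ### Composition with functions of one variable -/

section ChainRule

variable {m : ℕ} {X : Type*} [EMetricSpace X] [ChartedSpace (Euc m) X]

lemma contMDiff_comp_real {Ψ : ℝ → ℝ} (hΨ : ContDiff ℝ ∞ Ψ) {w : X → ℝ}
    (hw : ContMDiff (𝓡 m) 𝓘(ℝ, ℝ) ∞ w) : ContMDiff (𝓡 m) 𝓘(ℝ, ℝ) ∞ (fun x => Ψ (w x)) :=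
  hΨ.contMDiff.comp hw

lemma dAt_comp_real {Ψ : ℝ → ℝ} (hΨ : ContDiff ℝ ∞ Ψ) {w : X → ℝ}
    (hw : ContMDiff (𝓡 m) 𝓘(ℝ, ℝ) ∞ w) (x : X) (v : TangentSpace (𝓡 m) x) :
    dAt (fun x => Ψ (w x)) x v = deriv Ψ (w x) * dAt w x v := by
  have h1 : MDifferentiableAt (𝓡 m) 𝓘(ℝ, ℝ) w x := hw.mdifferentiableAt (by simp)
  have h2 : MDifferentiableAt 𝓘(ℝ, ℝ) 𝓘(ℝ, ℝ) Ψ (w x) :=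
    hΨ.contMDiff.mdifferentiableAt (n := ∞) (by simp)
  have h4 := congrArg (fun L : Euc m →L[ℝ] ℝ => L v) (mfderiv_comp x h2 h1)
  refine h4.trans ?_
  change (mfderiv 𝓘(ℝ, ℝ) 𝓘(ℝ, ℝ) Ψ (w x)) (dAt w x v) = _
  rw [mfderiv_eq_fderiv]
  have h5 : (fderiv ℝ Ψ (w x) : ℝ →L[ℝ] ℝ) (dAt w x v) = dAt w x v * deriv Ψ (w x) := by
    rw [fderiv_eq_smul_deriv]; rfl
  exact h5.trans (mul_comm _ _)

end ChainRule

/-! ### First evaluation of the limit: the Leibniz rule -/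

section BoundaryLimit

variable {m : ℕ} {X : Type*} [EMetricSpace X] [ChartedSpace (Euc m) X] [IsManifold (𝓡 m) ∞ X]
  [SecondCountableTopology X] [MeasurableSpace X] [BorelSpace X]

/-- The values of a current on the forms `d(Ψ ∘ w) ∧ α`, as `w` converges to the distance `τ`
from the support of the boundary. -/
lemma RectParam.tendsto_toCurrent_dwedge (P : RectParam m X 2) {τ : X → ℝ} (hτ : Continuous τ)
    (hsupp : P.toCurrent.boundary.support ⊆ {x | τ x ≤ 0}) {Ψ : ℝ → ℝ} (hΨ : ContDiff ℝ ∞ Ψ)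
    {M c₀ s : ℝ} (hM : ∀ t, |Ψ t| ≤ M) (hs : 0 < s) (hc₀ : ∀ t ≤ s, Ψ t = c₀) (α : TestForm m X 1)
    {U : Set X} (hU : closure {x | α.1 x ≠ 0} ⊆ U) {w : ℕ → X → ℝ}
    (hw : ∀ k, ContMDiff (𝓡 m) 𝓘(ℝ, ℝ) ∞ (w k)) {η : ℕ → ℝ}
    (hη : Filter.Tendsto η Filter.atTop (𝓝 0)) (hwτ : ∀ k, ∀ x ∈ U, |w k x - τ x| ≤ η k) :
    Filter.Tendsto (fun k => P.toCurrent
      (TestForm.dwedge (fun x => Ψ (w k x)) (contMDiff_comp_real hΨ (hw k)) α)) Filter.atTop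
      (𝓝 (c₀ * P.toCurrent.boundary α - P.pair (fun x => Ψ (τ x)) (TestForm.d 1 α))) := by
  have hlim : Filter.Tendsto (fun k => P.pair (fun x => Ψ (w k x)) (TestForm.d 1 α)) Filter.atTop
      (𝓝 (P.pair (fun x => Ψ (τ x)) (TestForm.d 1 α))) := by
    refine P.tendsto_pair (c := M) (fun k => (hΨ.continuous.comp (hw k).continuous).measurable)
      (fun k x => hM _) _ fun x hx => ?_
    have hxU : x ∈ U := hU (extD_support α.1 hx)
    refine (hΨ.continuous.tendsto _).comp ?_
    rw [tendsto_iff_dist_tendsto_zero]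
    exact squeeze_zero (fun k => dist_nonneg) (fun k => hwτ k x hxU) hη
  refine (hlim.const_sub (c₀ * P.toCurrent.boundary α)).congr' ?_
  filter_upwards [hη.eventually (gt_mem_nhds hs)] with k hk
  -- This is `T(du ∧ α) = ∂T(u α) - T(u dα)` with `u = Ψ ∘ w k`.
  have e1 : P.toCurrent (TestForm.dwedge (fun x => Ψ (w k x)) (contMDiff_comp_real hΨ (hw k)) α) =
      P.toCurrent.boundary (TestForm.fmul (fun x => Ψ (w k x)) (contMDiff_comp_real hΨ (hw k)) α) -
        P.pair (fun x => Ψ (w k x)) (TestForm.d 1 α) := by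
    refine (map_sub P.toCurrent _ _).trans (congrArg _ ?_)
    rw [← P.pair_one, P.pair_fmul, one_mul]
  rw [e1]
  congr 1
  -- Where this form is nonzero one has `s < w k`, hence `τ > s - η k`, so for large `k` its support
  -- misses that of the boundary. The boundary term is thus eventually equal to its limit.
  have e2 : P.toCurrent.boundary (TestForm.fmul (fun x => Ψ (w k x)) (contMDiff_comp_real hΨ (hw k)) α
      - c₀ • α) = 0 := by
    refine Current.apply_eq_zero_of_disjoint_support _ _ ?_
    have hv : ∀ x, (TestForm.fmul (fun x => Ψ (w k x)) (contMDiff_comp_real hΨ (hw k)) α - c₀ • α).1 x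
        = (Ψ (w k x) - c₀) • α.1 x := fun x => by
      ext v
      exact (sub_mul (Ψ (w k x)) c₀ (α.1 x v)).symm
    have hsub : closure {x | (TestForm.fmul (fun x => Ψ (w k x)) (contMDiff_comp_real hΨ (hw k)) α
        - c₀ • α).1 x ≠ 0} ⊆ {x | s - η k ≤ τ x} := by
      refine closure_minimal (fun x hx => ?_) (isClosed_le continuous_const hτ)
      rw [mem_ofPred_eq, hv] at hx
      have hα : α.1 x ≠ 0 := fun h => hx (by rw [h, smul_zero])
      have hΨx : Ψ (w k x) ≠ c₀ := fun h => hx (by rw [h, sub_self, zero_smul])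
      have h3 : s < w k x := not_le.1 fun h => hΨx (hc₀ _ h)
      have h4 := (abs_le.1 (hwτ k x (hU (subset_closure hα)))).2
      rw [mem_ofPred_eq]; linarith
    refine disjoint_left.2 fun x hx hx' => ?_
    have h5 : s - η k ≤ τ x := hsub hx
    have h6 : τ x ≤ 0 := hsupp hx'
    linarith
  have e3 := (map_sub P.toCurrent.boundary (TestForm.fmul (fun x => Ψ (w k x))
    (contMDiff_comp_real hΨ (hw k)) α) (c₀ • α)).symm.trans e2
  have e4 : P.toCurrent.boundary (c₀ • α) = c₀ * P.toCurrent.boundary α := map_smul _ _ _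
  linarith

end BoundaryLimit

/-! ### Bounds for derivatives along a set -/

section Integrability

variable {n : ℕ}

lemma aestronglyMeasurable_fderivWithin {S : Set (Euc n)} (hS : MeasurableSet S) {w : Euc n → ℝ}
    {c : ℝ≥0} (hw : LipschitzOnWith c w S) (e : Euc n) :
    AEStronglyMeasurable (fun u => fderivWithin ℝ w S u e) (volume.restrict S) := by
  obtain ⟨g, hg, hgd⟩ := hw.extend_real
  refine (measurable_fderiv_apply_const ℝ g e).aestronglyMeasurable.congr ?_
  filter_upwards [ae_fderivWithin_eq_fderiv hS hg hgd] with u hu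
  rw [hu.2.2]

lemma ae_norm_fderivWithin_le {F : Type*} [NormedAddCommGroup F] [NormedSpace ℝ F]
    [FiniteDimensional ℝ F] {S : Set (Euc n)} (hS : MeasurableSet S) {w : Euc n → F}
    {c : ℝ≥0} (hw : LipschitzOnWith c w S) : ∃ C : ℝ, 0 ≤ C ∧ ∀ e : Euc n,
    ∀ᵐ u ∂(volume.restrict S), ‖fderivWithin ℝ w S u e‖ ≤ C * ‖e‖ := by
  obtain ⟨g, hg, hgd⟩ := hw.extend_finite_dimension
  refine ⟨_, NNReal.coe_nonneg (lipschitzExtensionConstant F * c), fun e => ?_⟩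
  filter_upwards [ae_fderivWithin_eq_fderiv hS hg hgd] with u hu
  rw [hu.2.2]
  exact (ContinuousLinearMap.le_opNorm _ e).trans
    (mul_le_mul_of_nonneg_right (norm_fderiv_le_of_lipschitz ℝ hg) (norm_nonneg _))

lemma integrableOn_fderivWithin_mul {S : Set (Euc n)} (hS : MeasurableSet S) {w b : Euc n → ℝ}
    {c : ℝ≥0} (hw : LipschitzOnWith c w S) (hb : IntegrableOn b S) (e : Euc n) :
    IntegrableOn (fun u => fderivWithin ℝ w S u e * b u) S := by
  obtain ⟨C, -, hC⟩ := ae_norm_fderivWithin_le hS hw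
  exact hb.bdd_mul (aestronglyMeasurable_fderivWithin hS hw e) (hC e)

end Integrability

/-! ### Dominating `dτ ∧ α` by coordinate `2`-forms -/

section Domination

variable {m : ℕ} {X : Type*} [EMetricSpace X] [ChartedSpace (Euc m) X] [IsManifold (𝓡 m) ∞ X]
  [RiemannianBundle (fun x : X => TangentSpace (𝓡 m) x)]

/-- The sum of the absolute values of the densities of the coordinate `2`-forms. -/
def ChartPatch.density {ε : ℝ} {x₀ : X} (p : ChartPatch m ε x₀) (K : Set (Euc 2)) (f : Euc 2 → X)
    (θ : Euc 2 → ℤ) (u : Euc 2) : ℝ := ∑ a, ∑ b, |pushDensity K f θ (p.dcoord₂ a b) u|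

lemma ChartPatch.density_nonneg {ε : ℝ} {x₀ : X} (p : ChartPatch m ε x₀) (K : Set (Euc 2))
    (f : Euc 2 → X) (θ : Euc 2 → ℤ) (u : Euc 2) : 0 ≤ p.density K f θ u :=
  Finset.sum_nonneg fun _ _ => Finset.sum_nonneg fun _ _ => abs_nonneg _

lemma ChartPatch.integrableOn_density {ε : ℝ} {x₀ : X} (p : ChartPatch m ε x₀)
    (P : RectParam m X 2) (i : P.index) :
    IntegrableOn (p.density (P.dom i) (P.map i) (P.mult i)) (P.dom i) :=
  integrable_finsetSum _ fun _ _ => integrable_finsetSum _ fun _ _ => (P.integrable _ i).abs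

lemma ChartPatch.summable_density {ε : ℝ} {x₀ : X} (p : ChartPatch m ε x₀) (P : RectParam m X 2) :
    Summable fun i => ∫ u in P.dom i, p.density (P.dom i) (P.map i) (P.mult i) u := by
  have h : ∀ i, ∫ u in P.dom i, p.density (P.dom i) (P.map i) (P.mult i) u = ∑ a, ∑ b,
      ∫ u in P.dom i, |pushDensity (P.dom i) (P.map i) (P.mult i) (p.dcoord₂ a b) u| := fun i => by
    simp only [ChartPatch.density]
    rw [integral_finsetSum _ fun a _ => integrable_finsetSum _ fun b _ => (P.integrable _ i).abs]
    exact Finset.sum_congr rfl fun a _ => integral_finsetSum _ fun b _ => (P.integrable _ i).abs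
  simp only [h]
  exact summable_sum fun a _ => summable_sum fun b _ => P.summable _

/-- The constant controlling the wedge product of a covector with a form. -/
lemma ChartPatch.exists_pushDensity_dwedge_le {ε : ℝ} {x₀ : X} (p : ChartPatch m ε x₀)
    (α : TestForm m X 1) : ∃ C : ℝ, 0 ≤ C ∧ ∀ (K : Set (Euc 2)) (f : Euc 2 → X) (θ : Euc 2 → ℤ)
      (u : Euc 2) (_ : f u ∈ p.dom) (q r a : ℝ), 0 ≤ a → (∀ s t : ℝ, |s * q + t * r| ≤
        a * ‖dAt p.coord (f u) (pAt (m := m) f K u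
          (s • EuclideanSpace.single 0 1 + t • EuclideanSpace.single 1 1))‖) →
      |(θ u : ℝ) * (q * TestForm.lin α (f u) (pAt (m := m) f K u (EuclideanSpace.single 1 1)) -
        r * TestForm.lin α (f u) (pAt (m := m) f K u (EuclideanSpace.single 0 1)))| ≤
        C * a * p.density K f θ u := by
  obtain ⟨C, hC, h⟩ := p.exists_wedge_le α
  refine ⟨C, hC, fun K f θ u hu q r a ha hqr => ?_⟩
  have h1 := h (f u) hu (fun j => pAt f K u (EuclideanSpace.single j 1)) q r a ha fun s t => by
    refine (hqr s t).trans (le_of_eq ?_)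
    rw [map_add, map_add, map_smul, map_smul, map_smul, map_smul]
  rw [abs_mul]
  refine (mul_le_mul_of_nonneg_left h1 (abs_nonneg _)).trans (le_of_eq ?_)
  simp only [ChartPatch.density, pushDensity_apply, abs_mul, ← Finset.mul_sum]
  ring

variable [IsContinuousRiemannianBundle (Euc m) (fun x : X => TangentSpace (𝓡 m) x)]
  [IsRiemannianManifold (𝓡 m) X] [SecondCountableTopology X]

/-- Domination of the density of `dτ ∧ α` for a Lipschitz function `τ`. -/
lemma ChartPatch.exists_wedgeDensity_le {ε : ℝ} {x₀ : X} (p : ChartPatch m ε x₀)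
    (α : TestForm m X 1) : ∃ C : ℝ, 0 ≤ C ∧ ∀ {K : Set (Euc 2)} (_ : MeasurableSet K)
      {f : Euc 2 → X} {c : ℝ≥0} (_ : LipschitzOnWith c f K) (θ : Euc 2 → ℤ) {τ : X → ℝ} {κ : ℝ≥0}
      (_ : LipschitzWith κ τ), ∀ᵐ u ∂(volume.restrict K), f u ∈ p.dom →
        |wedgeDensity (τ ∘ f) K f θ α u| ≤ C * κ * p.density K f θ u := by
  obtain ⟨C, hC, h⟩ := p.exists_pushDensity_dwedge_le α
  refine ⟨C * p.distortion, mul_nonneg hC p.distortion_nonneg, fun {K} hK {f c} hf θ {τ κ} hτ => ?_⟩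
  filter_upwards [ae_mdifferentiableWithinAt (m := m) hK hf, ae_tangentConeAt_eq_univ K,
    ae_uniqueDiffWithinAt K, ae_restrict_mem hK,
    (hτ.comp_lipschitzOnWith hf).ae_differentiableWithinAt hK] with u h1 h2 h3 h4 h5 hu
  have key := h K f θ u hu (fderivWithin ℝ (τ ∘ f) K u (EuclideanSpace.single 0 1))
    (fderivWithin ℝ (τ ∘ f) K u (EuclideanSpace.single 1 1)) (κ * p.distortion)
    (mul_nonneg κ.coe_nonneg p.distortion_nonneg) fun s t => by
      have e1 : s * fderivWithin ℝ (τ ∘ f) K u (EuclideanSpace.single 0 1) +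
          t * fderivWithin ℝ (τ ∘ f) K u (EuclideanSpace.single 1 1) = fderivWithin ℝ (τ ∘ f) K u
            (s • EuclideanSpace.single 0 1 + t • EuclideanSpace.single 1 1) := by
        rw [map_add, map_smul, map_smul]; rfl
      rw [e1]
      -- The function `τ` need not be differentiable on `X`, only `τ ∘ f` along `K`. Its derivative
      -- is compared with that of the coordinates through increments: `|Δτ|` is at most `κ` times
      -- the distance, which is at most the distortion times the increment of the coordinates.
      refine norm_fderivWithin_apply_le h2.2 h5.hasFDerivWithinAt
        (hasFDerivWithinAt_comp p.contMDiff_coord h1) ?_ _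
      filter_upwards [(hf.continuousOn u h4).preimage_mem_nhdsWithin (p.isOpen_dom.mem_nhds hu)]
        with y hy
      have h6 := (hτ (f y) (f u)).trans (mul_le_mul_right (p.edist_le _ hy _ hu) (κ : ℝ≥0∞))
      rw [edist_dist, ← ENNReal.ofReal_coe_nnreal, ← ENNReal.ofReal_mul κ.coe_nonneg,
        ENNReal.ofReal_le_ofReal_iff (by
          exact mul_nonneg κ.coe_nonneg (mul_nonneg p.distortion_nonneg dist_nonneg)), ← mul_assoc,
        dist_eq_norm, dist_eq_norm] at h6
      exact h6
  refine key.trans (le_of_eq ?_)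
  ring

/-- Domination of the density of `dw ∧ α` for a smooth function `w`. -/
lemma ChartPatch.exists_dwedge_le {ε : ℝ} {x₀ : X} (p : ChartPatch m ε x₀)
    (α : TestForm m X 1) (hα : closure {x | α.1 x ≠ 0} ⊆ p.dom) : ∃ C : ℝ, 0 ≤ C ∧
      ∀ (K : Set (Euc 2)) (f : Euc 2 → X) (θ : Euc 2 → ℤ) {w : X → ℝ}
      (hw : ContMDiff (𝓡 m) 𝓘(ℝ, ℝ) ∞ w) {A : ℝ} (_ : 0 ≤ A)
      (_ : ∀ x ∈ p.dom, ∀ v : TangentSpace (𝓡 m) x, |dAt w x v| ≤ A * ‖v‖) (u : Euc 2),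
        |pushDensity K f θ (TestForm.dwedge w hw α) u| ≤ C * A * p.density K f θ u := by
  obtain ⟨C, hC, h⟩ := p.exists_pushDensity_dwedge_le α
  refine ⟨C * p.distortion, mul_nonneg hC p.distortion_nonneg, fun K f θ w hw A hA hwA u => ?_⟩
  rw [pushDensity_apply, TestForm.dwedge_apply_lin]
  by_cases hu : f u ∈ p.dom
  · have key := h K f θ u hu (dAt w (f u) (pAt (m := m) f K u (EuclideanSpace.single 0 1)))
      (dAt w (f u) (pAt (m := m) f K u (EuclideanSpace.single 1 1))) (A * p.distortion)
      (mul_nonneg hA p.distortion_nonneg) fun s t => by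
        have e1 : s * dAt w (f u) (pAt (m := m) f K u (EuclideanSpace.single 0 1)) +
            t * dAt w (f u) (pAt (m := m) f K u (EuclideanSpace.single 1 1)) = dAt w (f u) (pAt (m := m) f K u
              (s • EuclideanSpace.single 0 1 + t • EuclideanSpace.single 1 1)) := by
          rw [map_add, map_smul, map_smul, map_add, map_smul, map_smul]; rfl
        rw [e1, mul_assoc]
        exact (hwA _ hu _).trans (mul_le_mul_of_nonneg_left (p.norm_le _ hu _) hA)
    refine key.trans (le_of_eq ?_)
    ring
  · have h0 : α.1 (f u) = 0 := by
      by_contra hne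
      exact hu (hα (subset_closure hne))
    have h1 : ∀ v, TestForm.lin α (f u) v = 0 := fun v => by
      change α.1 (f u) (fun _ => v) = 0
      rw [h0]; rfl
    rw [h1, h1]
    simp only [mul_zero, sub_zero, abs_zero]
    exact mul_nonneg (mul_nonneg (mul_nonneg hC p.distortion_nonneg) hA) (p.density_nonneg K f θ u)

/-- The pull-back of a `1`-form by a Lipschitz map is bounded on a patch, so finite measure of the
piece makes it integrable, as the weak convergence of derivatives requires. -/
lemma ChartPatch.integrableOn_lin_pAt {ε : ℝ} {x₀ : X} (p : ChartPatch m ε x₀)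
    (α : TestForm m X 1) {n : ℕ} {S : Set (Euc n)} (hS : MeasurableSet S) (hfin : volume S < ⊤)
    {f : Euc n → X} {c : ℝ≥0} (hf : LipschitzOnWith c f S) (hfS : ∀ u ∈ S, f u ∈ p.dom) (e : Euc n) :
    IntegrableOn (fun u => TestForm.lin α (f u) (pAt (m := m) f S u e)) S := by
  obtain ⟨C, hC, h⟩ := p.exists_lin_le α
  obtain ⟨C', hC', h'⟩ := ae_norm_fderivWithin_le hS (p.lipschitz_coord.comp_lipschitzOnWith hf)
  refine IntegrableOn.of_bound hfin
    (aestronglyMeasurable_form_pAt hS hf α (fun _ => e)) (C * (C' * ‖e‖)) ?_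
  filter_upwards [h' e, ae_mdifferentiableWithinAt (m := m) hS hf, ae_uniqueDiffWithinAt S,
    ae_restrict_mem hS] with u h1 h2 h3 h4
  rw [fderivWithin_comp_apply p.contMDiff_coord h2 h3] at h1
  exact (h _ (hfS u h4) _).trans (mul_le_mul_of_nonneg_left h1 hC)

/-- With constant multiplicity, the pull-back of `dw ∧ α` is linear in the derivatives of `w ∘ f`,
with integrable coefficients independent of `w`; `tendsto_integral_fderivWithin` applies to each of
the two terms. -/
lemma ChartPatch.tendsto_integral_pushDensity {ε : ℝ} {x₀ : X} (p : ChartPatch m ε x₀)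
    (α : TestForm m X 1) {S : Set (Euc 2)} (hS : MeasurableSet S) (hfin : volume S < ⊤)
    {f : Euc 2 → X} {c : ℝ≥0} (hf : LipschitzOnWith c f S) (hfS : ∀ u ∈ S, f u ∈ p.dom)
    {θ : Euc 2 → ℤ} {z : ℤ} (hθ : ∀ u ∈ S, θ u = z) {τ : X → ℝ} {κ : ℝ≥0} (hτ : LipschitzWith κ τ)
    {w : ℕ → X → ℝ} (hw : ∀ k, ContMDiff (𝓡 m) 𝓘(ℝ, ℝ) ∞ (w k)) (hwl : ∀ k, LipschitzWith κ (w k))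
    {η : ℕ → ℝ} (hη : Filter.Tendsto η Filter.atTop (𝓝 0)) (hη0 : ∀ k, 0 ≤ η k)
    (hwτ : ∀ k, ∀ x ∈ p.dom, |w k x - τ x| ≤ η k) :
    Filter.Tendsto (fun k => ∫ u in S, pushDensity S f θ (TestForm.dwedge (w k) (hw k) α) u)
      Filter.atTop (𝓝 (∫ u in S, wedgeDensity (τ ∘ f) S f θ α u)) := by
  set b : Fin 2 → Euc 2 → ℝ := fun j u => TestForm.lin α (f u) (pAt (m := m) f S u (EuclideanSpace.single j 1))
    with hb
  have hbi : ∀ j, IntegrableOn (b j) S := fun j => p.integrableOn_lin_pAt α hS hfin hf hfS _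
  have hval : ∀ {g : Euc 2 → ℝ} {c' : ℝ≥0}, LipschitzOnWith c' g S →
      ∫ u in S, wedgeDensity g S f θ α u =
        z * ((∫ u in S, fderivWithin ℝ g S u (EuclideanSpace.single 0 1) * b 1 u) -
          ∫ u in S, fderivWithin ℝ g S u (EuclideanSpace.single 1 1) * b 0 u) := by
    intro g c' hg
    rw [← integral_sub (integrableOn_fderivWithin_mul hS hg (hbi 1) _)
      (integrableOn_fderivWithin_mul hS hg (hbi 0) _), ← integral_const_mul]
    refine setIntegral_congr_fun hS fun u hu => ?_
    simp only [wedgeDensity, hb, hθ u hu]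
  have hval' : ∀ k, ∫ u in S, pushDensity S f θ (TestForm.dwedge (w k) (hw k) α) u =
      ∫ u in S, wedgeDensity (w k ∘ f) S f θ α u := fun k => by
    refine integral_congr_ae ?_
    filter_upwards [ae_mdifferentiableWithinAt (m := m) hS hf, ae_uniqueDiffWithinAt S] with u h1 h2
    exact pushDensity_dwedge (hw k) h1 h2 θ α
  have hlip : ∀ k, LipschitzOnWith (κ * c) (w k ∘ f) S := fun k => (hwl k).comp_lipschitzOnWith hf
  have hlip0 : LipschitzOnWith (κ * c) (τ ∘ f) S := hτ.comp_lipschitzOnWith hf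
  simp only [hval']
  rw [hval hlip0]
  simp only [hval (hlip _)]
  refine Filter.Tendsto.const_mul _ (Filter.Tendsto.sub ?_ ?_)
  · exact tendsto_integral_fderivWithin hS hlip hlip0 hη hη0
      (fun k u hu => hwτ k _ (hfS u hu)) (hbi 1) _
  · exact tendsto_integral_fderivWithin hS hlip hlip0 hη hη0
      (fun k u hu => hwτ k _ (hfS u hu)) (hbi 0) _

end Domination

/-! ### Additivity and chain rule for the wedge density -/

section WedgeAlgebra

variable {m : ℕ} {X : Type*} [EMetricSpace X] [ChartedSpace (Euc m) X]

lemma TestForm.lin_sum {ι : Type*} (J : Finset ι) (α : ι → TestForm m X 1) (x : X)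
    (v : TangentSpace (𝓡 m) x) :
    TestForm.lin (∑ j ∈ J, α j) x v = ∑ j ∈ J, TestForm.lin (α j) x v := by
  classical
  induction J using Finset.induction_on with
  | empty => rfl
  | insert j J hj ih => rw [Finset.sum_insert hj, Finset.sum_insert hj, ← ih]; rfl

lemma TestForm.lin_eq_zero {α : TestForm m X 1} {x : X} (h : α.1 x = 0) (v : TangentSpace (𝓡 m) x) :
    TestForm.lin α x v = 0 := by
  change α.1 x (fun _ => v) = 0
  rw [h]; rfl

lemma wedgeDensity_sum {ι : Type*} (J : Finset ι) (α : ι → TestForm m X 1) (g : Euc 2 → ℝ)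
    (K : Set (Euc 2)) (f : Euc 2 → X) (θ : Euc 2 → ℤ) (u : Euc 2) :
    wedgeDensity g K f θ (∑ j ∈ J, α j) u = ∑ j ∈ J, wedgeDensity g K f θ (α j) u := by
  simp only [wedgeDensity, TestForm.lin_sum, Finset.mul_sum, ← Finset.sum_sub_distrib]

lemma wedgeDensity_eq_zero {α : TestForm m X 1} {f : Euc 2 → X} {u : Euc 2} (h : α.1 (f u) = 0)
    (g : Euc 2 → ℝ) (K : Set (Euc 2)) (θ : Euc 2 → ℤ) : wedgeDensity g K f θ α u = 0 := by
  simp only [wedgeDensity, TestForm.lin_eq_zero h, mul_zero, sub_zero]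

lemma pushDensity_eq_zero {n : ℕ} {α : TestForm m X n} {f : Euc n → X} {u : Euc n}
    (h : α.1 (f u) = 0) (K : Set (Euc n)) (θ : Euc n → ℤ) : pushDensity K f θ α u = 0 := by
  rw [pushDensity_apply, h]; exact mul_zero _

lemma wedgeDensity_comp_real {Ψ : ℝ → ℝ} {g : Euc 2 → ℝ} {K : Set (Euc 2)} {u : Euc 2}
    (hΨ : DifferentiableAt ℝ Ψ (g u)) (hg : DifferentiableWithinAt ℝ g K u)
    (hK : UniqueDiffWithinAt ℝ K u) (f : Euc 2 → X) (θ : Euc 2 → ℤ) (α : TestForm m X 1) :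
    wedgeDensity (Ψ ∘ g) K f θ α u = deriv Ψ (g u) * wedgeDensity g K f θ α u := by
  have h1 : ∀ e, fderivWithin ℝ (Ψ ∘ g) K u e = deriv Ψ (g u) * fderivWithin ℝ g K u e := fun e => by
    rw [fderiv_comp_fderivWithin u hΨ hg hK, ContinuousLinearMap.comp_apply, fderiv_eq_smul_deriv]
    simp [mul_comm]
  simp only [wedgeDensity, h1]
  ring

end WedgeAlgebra

/-! ### Second evaluation of the limit, and the two consequences -/

section Identities

variable {m : ℕ} {X : Type*} [EMetricSpace X] [ChartedSpace (Euc m) X] [IsManifold (𝓡 m) ∞ X]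
  [RiemannianBundle (fun x : X => TangentSpace (𝓡 m) x)]
  [IsContinuousRiemannianBundle (Euc m) (fun x : X => TangentSpace (𝓡 m) x)]
  [IsRiemannianManifold (𝓡 m) X] [SecondCountableTopology X]

lemma wedgeDensity_ae_eq {f : Euc 2 → X} {K S : Set (Euc 2)} (hK : MeasurableSet K)
    {c : ℝ≥0} (hf : LipschitzOnWith c f K) (hSK : S ⊆ K) {g : Euc 2 → ℝ} {c' : ℝ≥0}
    (hg : LipschitzOnWith c' g K) (θ : Euc 2 → ℤ) (α : TestForm m X 1) :
    wedgeDensity g S f θ α =ᵐ[volume.restrict S] wedgeDensity g K f θ α := by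
  filter_upwards [ae_pAt_eq (m := m) hK hf hSK, ae_uniqueDiffWithinAt S,
    ae_restrict_of_ae_restrict_of_subset hSK (hg.ae_differentiableWithinAt hK)] with u h1 h2 h3
  rw [wedgeDensity, wedgeDensity, h1, fderivWithin_subset hSK h2 h3]

namespace RectParam

variable (P : RectParam m X 2) {τ : X → ℝ} {κ : ℝ≥0}

/-- A localization of a test form by means of coordinate patches. -/
lemma _root_.RectCurrent.TestForm.exists_eq_sum_patch {ε : ℝ} (p : ∀ x : X, ChartPatch m ε x)
    {n : ℕ} (α : TestForm m X n) :
    ∃ (J : Finset X) (χ : X → X → ℝ) (hχ : ∀ i, ContMDiff (𝓡 m) 𝓘(ℝ, ℝ) ∞ (χ i)),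
      (∀ i x, 0 ≤ χ i x) ∧ (∀ x, ∑ i ∈ J, χ i x ≤ 1) ∧
      (∀ i, closure {x | (TestForm.fmul (χ i) (hχ i) α).1 x ≠ 0} ⊆ (p i).dom) ∧
      (∀ i x, χ i x ≠ 0 → x ∈ (p i).dom) ∧
      α = ∑ i ∈ J, TestForm.fmul (χ i) (hχ i) α := by
  obtain ⟨J, χ, hχ, h1, h2, h3, h4⟩ := TestForm.exists_eq_sum_fmul α (fun x => (p x).dom)
    (fun x => (p x).isOpen_dom) fun x _ => mem_iUnion.2 ⟨x, (p x).mem_dom⟩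
  exact ⟨J, χ, hχ, h1, h2, fun i => (TestForm.closure_fmul_subset α (hχ i)).trans
    (inter_subset_left.trans (h3 i)), fun i x hx => h3 i (subset_closure hx), h4⟩

/-- After localizing `α` to finitely many patches, the bound is a combination of the absolute values
of the densities of the coordinate `2`-forms. Those are test forms, so the definition of a
parametrization supplies integrability and summability. -/
lemma exists_wedge_bound (hτ : LipschitzWith κ τ) (α : TestForm m X 1) :
    ∃ B : P.index → Euc 2 → ℝ, (∀ i, IntegrableOn (B i) (P.dom i)) ∧
      (Summable fun i => ∫ u in P.dom i, B i u) ∧ ∀ i, ∀ᵐ u ∂(volume.restrict (P.dom i)),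
        |wedgeDensity (τ ∘ P.map i) (P.dom i) (P.map i) (P.mult i) α u| ≤ B i u := by
  have p : ∀ x : X, ChartPatch m 1 x := fun x => (nonempty_chartPatch one_pos x).some
  obtain ⟨J, χ, hχ, -, -, hsub, -, heq⟩ := TestForm.exists_eq_sum_patch p α
  choose C hC h using fun j => (p j).exists_wedgeDensity_le (TestForm.fmul (χ j) (hχ j) α)
  refine ⟨fun i u => ∑ j ∈ J, C j * κ * (p j).density (P.dom i) (P.map i) (P.mult i) u,
    fun i => integrable_finsetSum _ fun j _ => ((p j).integrableOn_density P i).const_mul _, ?_, ?_⟩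
  · have e : ∀ i, ∫ u in P.dom i, ∑ j ∈ J, C j * κ * (p j).density (P.dom i) (P.map i) (P.mult i) u =
        ∑ j ∈ J, C j * κ * ∫ u in P.dom i, (p j).density (P.dom i) (P.map i) (P.mult i) u := fun i => by
      rw [integral_finsetSum _ fun j _ => ((p j).integrableOn_density P i).const_mul _]
      exact Finset.sum_congr rfl fun j _ => integral_const_mul _ _
    simp only [e]
    exact summable_sum fun j _ => ((p j).summable_density P).mul_left _
  · intro i
    obtain ⟨c, hc⟩ := P.lipschitz i
    have h1 : ∀ᵐ u ∂(volume.restrict (P.dom i)), ∀ j ∈ J, P.map i u ∈ (p j).dom →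
        |wedgeDensity (τ ∘ P.map i) (P.dom i) (P.map i) (P.mult i) (TestForm.fmul (χ j) (hχ j) α) u| ≤
          C j * κ * (p j).density (P.dom i) (P.map i) (P.mult i) u :=
      (ae_ball_iff J.countable_toSet).2 fun j _ => h j (P.measurableSet_dom i) hc (P.mult i) hτ
    filter_upwards [h1] with u hu
    have h2 : wedgeDensity (τ ∘ P.map i) (P.dom i) (P.map i) (P.mult i) α u =
        ∑ j ∈ J, wedgeDensity (τ ∘ P.map i) (P.dom i) (P.map i) (P.mult i)
          (TestForm.fmul (χ j) (hχ j) α) u := by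
      rw [← wedgeDensity_sum, ← heq]
    rw [h2]
    refine (Finset.abs_sum_le_sum_abs _ _).trans (Finset.sum_le_sum fun j hj => ?_)
    by_cases hd : P.map i u ∈ (p j).dom
    · exact hu j hj hd
    · rw [wedgeDensity_eq_zero (by_contra fun hne => hd (hsub j (subset_closure hne))), abs_zero]
      exact mul_nonneg (mul_nonneg (hC j) κ.coe_nonneg) ((p j).density_nonneg _ _ _ _)

lemma integrableOn_wedgeDensity (hτ : LipschitzWith κ τ) (α : TestForm m X 1) (i : P.index) :
    IntegrableOn (wedgeDensity (τ ∘ P.map i) (P.dom i) (P.map i) (P.mult i) α) (P.dom i) := by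
  obtain ⟨B, h1, -, h3⟩ := P.exists_wedge_bound hτ α
  obtain ⟨c, hc⟩ := P.lipschitz i
  have hK := P.measurableSet_dom i
  have hg := hτ.comp_lipschitzOnWith hc
  refine (h1 i).mono' ?_ (h3 i)
  have hθ : AEStronglyMeasurable (fun u => (P.mult i u : ℝ)) (volume.restrict (P.dom i)) :=
    ((measurable_from_top (f := fun z : ℤ => (z : ℝ))).comp (P.measurable_mult i)).aestronglyMeasurable
  exact hθ.mul (((aestronglyMeasurable_fderivWithin hK hg _).mul
    (aestronglyMeasurable_form_pAt hK hc α _)).sub ((aestronglyMeasurable_fderivWithin hK hg _).mul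
    (aestronglyMeasurable_form_pAt hK hc α _)))

lemma summable_wedgeDensity (hτ : LipschitzWith κ τ) (α : TestForm m X 1) : Summable fun i =>
    ∫ u in P.dom i, |wedgeDensity (τ ∘ P.map i) (P.dom i) (P.map i) (P.mult i) α u| := by
  obtain ⟨B, h1, h2, h3⟩ := P.exists_wedge_bound hτ α
  refine Summable.of_nonneg_of_le (fun i => integral_nonneg fun u => abs_nonneg _) (fun i => ?_) h2
  exact integral_mono_ae (P.integrableOn_wedgeDensity hτ α i).abs (h1 i) (h3 i)

/-- The pieces of the parametrization have finite measure and constant multiplicity. -/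
def IsTame : Prop := ∀ i, volume (P.dom i) < ⊤ ∧ ∃ z : ℤ, ∀ u ∈ P.dom i, P.mult i u = z

variable {P}

/-- On each piece this is weak convergence of derivatives; the coordinate `2`-forms give a bound
that is summable over the pieces and uniform in `k`, so the series converges too. -/
lemma IsTame.tendsto_toCurrent_dwedge (hP : P.IsTame) {ε : ℝ} {x₀ : X} (p : ChartPatch m ε x₀)
    (α : TestForm m X 1) (hα : closure {x | α.1 x ≠ 0} ⊆ p.dom) (hτ : LipschitzWith κ τ)
    {w : ℕ → X → ℝ} (hw : ∀ k, ContMDiff (𝓡 m) 𝓘(ℝ, ℝ) ∞ (w k)) (hwl : ∀ k, LipschitzWith κ (w k))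
    {η : ℕ → ℝ} (hη : Filter.Tendsto η Filter.atTop (𝓝 0)) (hη0 : ∀ k, 0 ≤ η k)
    (hwτ : ∀ k, ∀ x ∈ p.dom, |w k x - τ x| ≤ η k) {A : ℝ} (hA : 0 ≤ A)
    (hwA : ∀ k, ∀ x ∈ p.dom, ∀ v : TangentSpace (𝓡 m) x, |dAt (w k) x v| ≤ A * ‖v‖) :
    Filter.Tendsto (fun k => P.toCurrent (TestForm.dwedge (w k) (hw k) α)) Filter.atTop
      (𝓝 (∑' i, ∫ u in P.dom i, wedgeDensity (τ ∘ P.map i) (P.dom i) (P.map i) (P.mult i) α u)) := by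
  obtain ⟨C, hC, hbd⟩ := p.exists_dwedge_le α hα
  refine tendsto_tsum_of_dominated_convergence ((p.summable_density P).mul_left (C * A)) (fun i => ?_)
    (Filter.Eventually.of_forall fun k i => ?_)
  · obtain ⟨c, hc⟩ := P.lipschitz i
    obtain ⟨hfin, z, hz⟩ := hP i
    have hK := P.measurableSet_dom i
    have hS : MeasurableSet (P.dom i ∩ P.map i ⁻¹' p.dom) :=
      measurableSet_inter_preimage' hK hc.continuousOn p.isOpen_dom
    have hSK : P.dom i ∩ P.map i ⁻¹' p.dom ⊆ P.dom i := inter_subset_left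
    have h0 : ∀ u ∈ P.dom i \ (P.dom i ∩ P.map i ⁻¹' p.dom), α.1 (P.map i u) = 0 := fun u hu => by
      by_contra hne
      exact hu.2 ⟨hu.1, hα (subset_closure hne)⟩
    -- The piece is reduced to the part mapped into the patch; the pull-back of `α` vanishes on the
    -- rest.
    have key := p.tendsto_integral_pushDensity α hS ((measure_mono hSK).trans_lt hfin)
      (hc.mono hSK) (fun u hu => hu.2) (θ := P.mult i) (z := z) (fun u hu => hz u hu.1) hτ hw hwl hη hη0
      hwτ
    have e1 : ∀ k, ∫ u in P.dom i, pushDensity (P.dom i) (P.map i) (P.mult i)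
        (TestForm.dwedge (w k) (hw k) α) u = ∫ u in P.dom i ∩ P.map i ⁻¹' p.dom,
          pushDensity (P.dom i ∩ P.map i ⁻¹' p.dom) (P.map i) (P.mult i)
            (TestForm.dwedge (w k) (hw k) α) u := fun k => by
      rw [integral_congr_ae (pushDensity_ae_eq hK hc hSK (P.mult i) (TestForm.dwedge (w k) (hw k) α))]
      refine setIntegral_eq_of_subset_of_forall_sdiff_eq_zero hK hSK fun u hu => ?_
      rw [pushDensity_apply, TestForm.dwedge_apply_lin, TestForm.lin_eq_zero (h0 u hu),
        TestForm.lin_eq_zero (h0 u hu)]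
      simp
    have e2 : ∫ u in P.dom i, wedgeDensity (τ ∘ P.map i) (P.dom i) (P.map i) (P.mult i) α u =
        ∫ u in P.dom i ∩ P.map i ⁻¹' p.dom, wedgeDensity (τ ∘ P.map i)
          (P.dom i ∩ P.map i ⁻¹' p.dom) (P.map i) (P.mult i) α u := by
      rw [integral_congr_ae (wedgeDensity_ae_eq hK hc hSK (hτ.comp_lipschitzOnWith hc) (P.mult i) α)]
      exact setIntegral_eq_of_subset_of_forall_sdiff_eq_zero hK hSK fun u hu =>
        wedgeDensity_eq_zero (h0 u hu) _ _ _
    rw [e2]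
    exact key.congr fun k => (e1 k).symm
  · rw [← integral_const_mul]
    exact norm_integral_le_of_norm_le ((p.integrableOn_density P i).const_mul _)
      (Filter.Eventually.of_forall fun u => hbd _ _ _ (hw k) hA (hwA k) u)

end RectParam

/-- Smooth approximations of a function of a `1`-Lipschitz function on a coordinate patch. -/
lemma ChartPatch.exists_smooth_seq {ε : ℝ} {x₀ : X} (p : ChartPatch m ε x₀) {τ : X → ℝ}
    (hτ : LipschitzWith 1 τ) :
    ∃ (K : ℝ≥0) (w : ℕ → X → ℝ), (∀ k, ContMDiff (𝓡 m) 𝓘(ℝ, ℝ) ∞ (w k)) ∧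
      (∀ k, LipschitzWith K (w k)) ∧ (∀ k, ∀ x ∈ p.dom, |w k x - τ x| ≤ 1 / ((k : ℝ) + 1)) ∧
      ∀ k, ∀ x ∈ p.dom, ∀ v : TangentSpace (𝓡 m) x, |dAt (w k) x v| ≤ (1 + ε) * ‖v‖ := by
  obtain ⟨K, hK⟩ := p.smoothing
  choose w h1 h2 h3 h4 using fun k : ℕ => hK τ hτ (1 / ((k : ℝ) + 1)) (by positivity)
  exact ⟨K, w, h1, h2, h3, h4⟩

variable [MeasurableSpace X] [BorelSpace X]

lemma lipschitzWith_of_abs_deriv_le {Ψ : ℝ → ℝ} (hΨ : ContDiff ℝ ∞ Ψ) {κ : ℝ≥0}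
    (hκ : ∀ t, |deriv Ψ t| ≤ κ) : LipschitzWith κ Ψ :=
  lipschitzWith_of_nnnorm_deriv_le (hΨ.differentiable (by simp)) fun t => by
    rw [← NNReal.coe_le_coe, coe_nnnorm]; exact hκ t

namespace RectParam

/-- Slicing identity: the weighted integral of `dτ ∧ α` over a parametrized current in terms of the
boundary of its restrictions. -/
lemma IsTame.tsum_integral_wedgeDensity {P : RectParam m X 2} (hP : P.IsTame) {τ : X → ℝ}
    (hτ : LipschitzWith 1 τ)
    (hsupp : P.toCurrent.boundary.support ⊆ {x | τ x ≤ 0}) {Ψ : ℝ → ℝ} (hΨ : ContDiff ℝ ∞ Ψ)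
    {M c₀ s : ℝ} (hM : ∀ t, |Ψ t| ≤ M) (hs : 0 < s) (hc₀ : ∀ t ≤ s, Ψ t = c₀) {κ : ℝ≥0}
    (hκ : ∀ t, |deriv Ψ t| ≤ κ) (α : TestForm m X 1) :
    ∑' i, ∫ u in P.dom i, deriv Ψ (τ (P.map i u)) *
        wedgeDensity (τ ∘ P.map i) (P.dom i) (P.map i) (P.mult i) α u =
      c₀ * P.toCurrent.boundary α - P.pair (fun x => Ψ (τ x)) (TestForm.d 1 α) := by
  have hΨl := lipschitzWith_of_abs_deriv_le hΨ hκ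
  have hΨτ : LipschitzWith κ (Ψ ∘ τ) := by simpa using hΨl.comp hτ
  have p : ∀ x : X, ChartPatch m 1 x := fun x => (nonempty_chartPatch one_pos x).some
  -- For a form supported in one patch, both evaluations apply to the same sequence, and limits are
  -- unique.
  have hlocal : ∀ (j : X) (β : TestForm m X 1), closure {x | β.1 x ≠ 0} ⊆ (p j).dom →
      ∑' i, ∫ u in P.dom i, wedgeDensity ((Ψ ∘ τ) ∘ P.map i) (P.dom i) (P.map i) (P.mult i) β u =
        c₀ * P.toCurrent.boundary β - P.pair (fun x => Ψ (τ x)) (TestForm.d 1 β) := by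
    intro j β hβ
    obtain ⟨K, w, h1, h2, h3, h4⟩ := (p j).exists_smooth_seq hτ
    have hη : Filter.Tendsto (fun k : ℕ => 1 / ((k : ℝ) + 1)) Filter.atTop (𝓝 0) :=
      tendsto_one_div_add_atTop_nhds_zero_nat
    have lim1 := P.tendsto_toCurrent_dwedge hτ.continuous hsupp hΨ hM hs hc₀ β hβ h1 hη h3
    -- The functions `Ψ ∘ w k` are `κ K`-Lipschitz and `Ψ ∘ τ` is `κ`-Lipschitz; `κ * max K 1`
    -- serves for both.
    have lim2 := hP.tendsto_toCurrent_dwedge (p j) β hβ (κ := κ * max K 1) (τ := Ψ ∘ τ)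
      (hΨτ.weaken (le_mul_of_one_le_right' (le_max_right _ _)))
      (w := fun k x => Ψ (w k x)) (fun k => contMDiff_comp_real hΨ (h1 k))
      (fun k => (hΨl.comp (h2 k)).weaken (mul_le_mul_right (le_max_left _ _) _))
      (η := fun k => κ * (1 / ((k : ℝ) + 1))) (by simpa using hη.const_mul (κ : ℝ))
      (fun k => by positivity) (fun k x hx => ?_) (A := κ * (1 + 1)) (by positivity)
      (fun k x hx v => ?_)
    · exact tendsto_nhds_unique lim2 lim1
    · refine (hΨl.dist_le_mul _ _).trans ?_
      exact mul_le_mul_of_nonneg_left (h3 k x hx) κ.coe_nonneg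
    · rw [dAt_comp_real hΨ (h1 k), abs_mul, mul_assoc]
      exact mul_le_mul (hκ _) (h4 k x hx v) (abs_nonneg _) κ.coe_nonneg
  have hae : ∀ i, ∀ β : TestForm m X 1, ∀ᵐ u ∂(volume.restrict (P.dom i)),
      wedgeDensity ((Ψ ∘ τ) ∘ P.map i) (P.dom i) (P.map i) (P.mult i) β u =
        deriv Ψ (τ (P.map i u)) *
          wedgeDensity (τ ∘ P.map i) (P.dom i) (P.map i) (P.mult i) β u := fun i β => by
    obtain ⟨c, hc⟩ := P.lipschitz i
    filter_upwards [ae_uniqueDiffWithinAt (P.dom i),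
      (hτ.comp_lipschitzOnWith hc).ae_differentiableWithinAt (P.measurableSet_dom i)] with u h1 h2
    exact wedgeDensity_comp_real (hΨ.differentiable (by simp) _) h2 h1 _ _ _
  obtain ⟨J, χ, hχ, -, -, hsub, -, heq⟩ := TestForm.exists_eq_sum_patch p α
  have h1 : ∀ i, ∫ u in P.dom i, deriv Ψ (τ (P.map i u)) *
      wedgeDensity (τ ∘ P.map i) (P.dom i) (P.map i) (P.mult i) α u =
      ∑ j ∈ J, ∫ u in P.dom i, wedgeDensity ((Ψ ∘ τ) ∘ P.map i) (P.dom i) (P.map i) (P.mult i)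
        (TestForm.fmul (χ j) (hχ j) α) u := fun i => by
    rw [← integral_finsetSum _ fun j _ => P.integrableOn_wedgeDensity hΨτ _ i,
      ← integral_congr_ae (hae i α)]
    refine integral_congr_ae (Filter.Eventually.of_forall fun u => ?_)
    beta_reduce
    rw [← wedgeDensity_sum, ← heq]
  have h2 : ∀ j, Summable fun i => ∫ u in P.dom i, wedgeDensity ((Ψ ∘ τ) ∘ P.map i) (P.dom i)
      (P.map i) (P.mult i) (TestForm.fmul (χ j) (hχ j) α) u := fun j =>
    Summable.of_norm_bounded (P.summable_wedgeDensity hΨτ _) fun i => norm_integral_le_integral_norm _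
  simp only [h1]
  rw [Summable.tsum_finsetSum fun j _ => h2 j]
  rw [Finset.sum_congr rfl fun j _ => hlocal j _ (hsub j), Finset.sum_sub_distrib, ← Finset.mul_sum,
    ← map_sum, ← heq, ← P.pair_sum_right (show Measurable fun x => Ψ (τ x) from (hΨ.continuous.comp hτ.continuous).measurable)
      (fun x => hM _), ← map_sum, ← heq]

/-- The mass bound for the boundaries of the restrictions. -/
lemma abs_boundary_sub_pair_le (P : RectParam m X 2) (hfin : P.toCurrent.mass < ⊤) {τ : X → ℝ}
    (hτ : LipschitzWith 1 τ)
    (hsupp : P.toCurrent.boundary.support ⊆ {x | τ x ≤ 0}) {Ψ : ℝ → ℝ} (hΨ : ContDiff ℝ ∞ Ψ)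
    {M c₀ s : ℝ} (hM : ∀ t, |Ψ t| ≤ M) (hs : 0 < s) (hc₀ : ∀ t ≤ s, Ψ t = c₀) {κ : ℝ≥0} (hκ0 : 0 < κ)
    (hκ : ∀ t, |deriv Ψ t| ≤ κ) {p q p' q' : ℝ} (hp : p < p') (hpq : p' ≤ q') (hq : q' < q)
    (hder : ∀ t, deriv Ψ t ≠ 0 → p' ≤ t ∧ t ≤ q') {α : TestForm m X 1} (hα : ComassLE α 1) :
    |c₀ * P.toCurrent.boundary α - P.pair (fun x => Ψ (τ x)) (TestForm.d 1 α)| ≤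
      κ * ((P.restrict {x | τ x < q} (measurableSet_sublevel hτ.continuous q)).toCurrent.mass.toReal -
        (P.restrict {x | τ x < p} (measurableSet_sublevel hτ.continuous p)).toCurrent.mass.toReal) := by
  set D := (P.restrict {x | τ x < q} (measurableSet_sublevel hτ.continuous q)).toCurrent.mass.toReal -
    (P.restrict {x | τ x < p} (measurableSet_sublevel hτ.continuous p)).toCurrent.mass.toReal with hD
  have hbound : ∀ {ζ : TestForm m X 2} {c : ℝ}, 0 < c → ComassLE ζ c →
      (∀ x, ζ.1 x ≠ 0 → p ≤ τ x ∧ τ x < q) → |P.toCurrent ζ| ≤ c * D := fun hc hζ h0 =>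
    P.mass_add_toCurrent_le hτ.continuous hfin (by linarith) hc hζ h0
  have hD0 : 0 ≤ D := by
    have := hbound (ζ := 0) one_pos (fun x v _ => by change |(0 : ℝ)| ≤ 1; simp)
      (fun x hx => (hx rfl).elim)
    rw [map_zero, abs_zero, one_mul] at this
    exact this
  have hε : ∀ ε : ℝ, 0 < ε →
      |c₀ * P.toCurrent.boundary α - P.pair (fun x => Ψ (τ x)) (TestForm.d 1 α)| ≤
        κ * (1 + ε) * D := by
    intro ε hε
    have P' : ∀ x : X, ChartPatch m ε x := fun x => (nonempty_chartPatch hε x).some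
    obtain ⟨J, χ, hχ, hχ0, hχ1, hsub, hχdom, heq⟩ := TestForm.exists_eq_sum_patch P' α
    choose K w h1 h2 h3 h4 using fun j => (P' j).exists_smooth_seq hτ
    have hη : Filter.Tendsto (fun k : ℕ => 1 / ((k : ℝ) + 1)) Filter.atTop (𝓝 0) :=
      tendsto_one_div_add_atTop_nhds_zero_nat
    have lim : Filter.Tendsto (fun k => P.toCurrent (∑ j ∈ J, TestForm.dwedge
        (fun x => Ψ (w j k x)) (contMDiff_comp_real hΨ (h1 j k)) (TestForm.fmul (χ j) (hχ j) α)))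
        Filter.atTop
        (𝓝 (c₀ * P.toCurrent.boundary α - P.pair (fun x => Ψ (τ x)) (TestForm.d 1 α))) := by
      have e : c₀ * P.toCurrent.boundary α - P.pair (fun x => Ψ (τ x)) (TestForm.d 1 α) =
          ∑ j ∈ J, (c₀ * P.toCurrent.boundary (TestForm.fmul (χ j) (hχ j) α) -
            P.pair (fun x => Ψ (τ x)) (TestForm.d 1 (TestForm.fmul (χ j) (hχ j) α))) := by
        rw [Finset.sum_sub_distrib, ← Finset.mul_sum,
          ← map_sum, ← heq, ← P.pair_sum_right (show Measurable fun x => Ψ (τ x) from (hΨ.continuous.comp hτ.continuous).measurable)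
          (fun x => hM _), ← map_sum, ← heq]
      rw [e]
      simp only [map_sum]
      exact tendsto_finsetSum _ fun j _ => P.tendsto_toCurrent_dwedge hτ.continuous hsupp hΨ hM hs
        hc₀ _ (hsub j) (h1 j) hη (h3 j)
    -- Pointwise the sum is one wedge product `A ∧ α` with `A = ∑ χ j Ψ'(w j) dw j`. As the `χ j`
    -- are nonnegative with sum at most `1`, the norm of `A` is at most `κ (1 + ε)`, so neither the
    -- partition of unity nor the different smoothings on the patches cost a further constant.
    have hval : ∀ k x (v : Fin 2 → TangentSpace (𝓡 m) x), (∑ j ∈ J, TestForm.dwedge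
        (fun x => Ψ (w j k x)) (contMDiff_comp_real hΨ (h1 j k)) (TestForm.fmul (χ j) (hχ j) α)).1 x v =
        (∑ j ∈ J, (χ j x * deriv Ψ (w j k x)) • ((dAt (m := m) (w j k) x : TangentSpace (𝓡 m) x →L[ℝ] ℝ) : TangentSpace (𝓡 m) x →ₗ[ℝ] ℝ)) (v 0)
          * TestForm.lin α x (v 1) -
        (∑ j ∈ J, (χ j x * deriv Ψ (w j k x)) • ((dAt (m := m) (w j k) x : TangentSpace (𝓡 m) x →L[ℝ] ℝ) : TangentSpace (𝓡 m) x →ₗ[ℝ] ℝ)) (v 1)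
          * TestForm.lin α x (v 0) := by
      intro k x v
      have e1 : (∑ j ∈ J, TestForm.dwedge (fun x => Ψ (w j k x)) (contMDiff_comp_real hΨ (h1 j k))
          (TestForm.fmul (χ j) (hχ j) α)).1 x v = ∑ j ∈ J, (TestForm.dwedge (fun x => Ψ (w j k x))
            (contMDiff_comp_real hΨ (h1 j k)) (TestForm.fmul (χ j) (hχ j) α)).1 x v := by
        rw [AddSubmonoidClass.coe_finsetSum, Finset.sum_apply]
        exact ContinuousAlternatingMap.sum_apply _ _
      rw [e1, LinearMap.sum_apply, LinearMap.sum_apply, Finset.sum_mul, Finset.sum_mul,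
        ← Finset.sum_sub_distrib]
      refine Finset.sum_congr rfl fun j _ => ?_
      have e2 : ∀ z, TestForm.lin (TestForm.fmul (χ j) (hχ j) α) x z = χ j x * TestForm.lin α x z :=
        fun z => rfl
      rw [TestForm.dwedge_apply_lin, dAt_comp_real hΨ (h1 j k), dAt_comp_real hΨ (h1 j k), e2, e2]
      simp only [LinearMap.smul_apply, ContinuousLinearMap.coe_coe, smul_eq_mul]
      ring
    refine le_of_tendsto lim.abs ?_
    -- Once `w j` is this close to `τ`, the condition `p' ≤ w j ≤ q'` forces `p ≤ τ < q`, and the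
    -- form lives in the annulus.
    have hsmall : 0 < min (p' - p) (q - q') := lt_min (by linarith) (by linarith)
    filter_upwards [hη.eventually (gt_mem_nhds hsmall)] with k hk
    refine hbound (by positivity) (fun x v hv => ?_) (fun x hx => ?_)
    · rw [hval]
      refine (abs_wedge_le (a := κ * (1 + ε)) (b := 1) (by positivity) zero_le_one (fun z => ?_)
        (fun z => ?_) (hv 0) (hv 1)).trans (mul_one _).le
      · rw [LinearMap.sum_apply]
        refine (Finset.abs_sum_le_sum_abs _ _).trans ?_
        calc ∑ j ∈ J, |((χ j x * deriv Ψ (w j k x)) •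
              ((dAt (m := m) (w j k) x : TangentSpace (𝓡 m) x →L[ℝ] ℝ) : TangentSpace (𝓡 m) x →ₗ[ℝ] ℝ)) z|
            ≤ ∑ j ∈ J, χ j x * (κ * (1 + ε) * ‖z‖) := by
              refine Finset.sum_le_sum fun j _ => ?_
              simp only [LinearMap.smul_apply, ContinuousLinearMap.coe_coe, smul_eq_mul, abs_mul,
                abs_of_nonneg (hχ0 j x)]
              by_cases h0 : χ j x = 0
              · simp [h0]
              · rw [mul_assoc, mul_assoc]
                exact mul_le_mul_of_nonneg_left (mul_le_mul (hκ _) (h4 j k x (hχdom j x h0) z)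
                  (abs_nonneg _) κ.coe_nonneg) (hχ0 j x)
          _ ≤ κ * (1 + ε) * ‖z‖ := by
              rw [← Finset.sum_mul]
              exact mul_le_of_le_one_left (by positivity) (hχ1 x)
      · rcases eq_or_ne z 0 with rfl | hz
        · simp
        · have hz' : 0 < ‖z‖ := norm_pos_iff.2 hz
          have := hα x (fun _ => ‖z‖⁻¹ • z) fun _ => by
            rw [norm_smul, norm_inv, norm_norm, inv_mul_cancel₀ hz'.ne']
          have e : α.1 x (fun _ => ‖z‖⁻¹ • z) = ‖z‖⁻¹ * TestForm.lin α x z :=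
            map_smul (TestForm.lin α x) _ _
          rw [e, abs_mul, abs_of_pos (inv_pos.2 hz'), inv_mul_le_iff₀ hz'] at this
          linarith
    · have : ∃ j ∈ J, χ j x ≠ 0 ∧ deriv Ψ (w j k x) ≠ 0 := by
        by_contra hcon
        push Not at hcon
        refine hx ?_
        ext v
        rw [hval, Finset.sum_eq_zero fun j hj => ?_]
        · simp
        · by_cases h0 : χ j x = 0
          · simp [h0]
          · simp [hcon j hj h0]
      obtain ⟨j, -, hj1, hj2⟩ := this
      have h5 := hder _ hj2
      have h6 := abs_le.1 (h3 j k x (hχdom j x hj1))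
      have h7 := lt_min_iff.1 hk
      constructor <;> linarith [h5.1, h5.2, h6.1, h6.2, h7.1, h7.2]
  refine le_of_forall_pos_le_add fun δ hδ => ?_
  refine (hε (δ / (κ * D + 1)) (by positivity)).trans ?_
  have : κ * D * (δ / (κ * D + 1)) ≤ δ := by
    rw [mul_div_assoc', div_le_iff₀ (by positivity)]
    nlinarith [mul_nonneg κ.coe_nonneg hD0]
  linarith

end RectParam

end Identities

/-! ### Integrating series of functions -/

section Series

/-- A series of functions whose integrals converge absolutely converges absolutely almost everywhere,
to an integrable function. -/
lemma integrable_tsum_of_summable {Ω ι : Type*} [MeasurableSpace Ω] {μ : Measure Ω} [Countable ι]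
    {F : ι → Ω → ℝ} (hF : ∀ i, Integrable (F i) μ) (hs : Summable fun i => ∫ a, ‖F i a‖ ∂μ) :
    (∀ᵐ a ∂μ, Summable fun i => ‖F i a‖) ∧ Integrable (fun a => ∑' i, F i a) μ := by
  have h1 : ∫⁻ a, ∑' i, ‖F i a‖ₑ ∂μ < ⊤ := by
    rw [lintegral_tsum fun i => (hF i).aestronglyMeasurable.enorm]
    have h2 : ∀ i, ∫⁻ a, ‖F i a‖ₑ ∂μ = ENNReal.ofReal (∫ a, ‖F i a‖ ∂μ) := fun i =>
      (ofReal_integral_norm_eq_lintegral_enorm (hF i)).symm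
    simp only [h2]
    rw [← ENNReal.ofReal_tsum_of_nonneg (fun i => integral_nonneg fun a => norm_nonneg _) hs]
    exact ENNReal.ofReal_lt_top
  have hmeas : AEMeasurable (fun a => ∑' i, ‖F i a‖ₑ) μ :=
    AEMeasurable.tsum fun i => (hF i).aestronglyMeasurable.enorm
  have h3 : ∀ᵐ a ∂μ, Summable fun i => ‖F i a‖ := by
    filter_upwards [ae_lt_top' hmeas h1.ne] with a ha
    have h4 := ENNReal.summable_toReal ha.ne
    simpa only [toReal_enorm] using h4
  refine ⟨h3, ?_, lt_of_le_of_lt (lintegral_mono_ae ?_) h1⟩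
  · refine aestronglyMeasurable_of_tendsto_ae (Filter.atTop : Filter (Finset ι))
      (f := fun J a => ∑ i ∈ J, F i a) (fun J => ?_) ?_
    · exact (integrable_finsetSum J fun i _ => hF i).aestronglyMeasurable
    · filter_upwards [h3] with a ha
      exact ha.of_norm.hasSum
  · filter_upwards [h3] with a ha
    exact enorm_tsum_le_tsum_enorm

end Series

/-! ### Cutoffs as primitives of densities -/

section Primitive

/-- The primitive of `-ψ` which vanishes near `+∞`. -/
def upperPrimitive (ψ : ℝ → ℝ) (s : ℝ) : ℝ := ∫ t, ψ t * (Ioi s).indicator 1 t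

variable {ψ : ℝ → ℝ}

lemma upperPrimitive_eq (hψ : Continuous ψ) (hc : HasCompactSupport ψ) (s : ℝ) :
    upperPrimitive ψ s = upperPrimitive ψ 0 - ∫ t in (0 : ℝ)..s, ψ t := by
  have hi : Integrable ψ := hψ.integrable_of_hasCompactSupport hc
  have h1 : ∀ s, upperPrimitive ψ s = ∫ t in Ioi s, ψ t := fun s => by
    rw [upperPrimitive, ← integral_indicator measurableSet_Ioi]
    congr 1; funext t
    by_cases h : t ∈ Ioi s <;> simp [h]
  have h2 : ∀ s, ∫ t in Ioi s, ψ t = (∫ t, ψ t) - ∫ t in Iic s, ψ t := fun s => by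
    rw [← intervalIntegral.integral_Iic_add_Ioi (b := s) hi.integrableOn hi.integrableOn]; ring
  rw [h1, h1, h2, h2, ← intervalIntegral.integral_Iic_sub_Iic hi.integrableOn hi.integrableOn]
  ring

lemma hasDerivAt_upperPrimitive (hψ : Continuous ψ) (hc : HasCompactSupport ψ) (s : ℝ) :
    HasDerivAt (upperPrimitive ψ) (-ψ s) s := by
  have h1 : upperPrimitive ψ = fun s => upperPrimitive ψ 0 - ∫ t in (0 : ℝ)..s, ψ t :=
    funext fun s => upperPrimitive_eq hψ hc s
  rw [h1]
  exact (hψ.integral_hasStrictDerivAt 0 s).hasDerivAt.const_sub _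

lemma deriv_upperPrimitive (hψ : Continuous ψ) (hc : HasCompactSupport ψ) (s : ℝ) :
    deriv (upperPrimitive ψ) s = -ψ s := (hasDerivAt_upperPrimitive hψ hc s).deriv

lemma contDiff_upperPrimitive (hψ : ContDiff ℝ ∞ ψ) (hc : HasCompactSupport ψ) :
    ContDiff ℝ ∞ (upperPrimitive ψ) := by
  rw [contDiff_infty_iff_deriv]
  refine ⟨fun s => (hasDerivAt_upperPrimitive hψ.continuous hc s).differentiableAt, ?_⟩
  rw [show deriv (upperPrimitive ψ) = fun s => -ψ s from
    funext fun s => deriv_upperPrimitive hψ.continuous hc s]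
  exact hψ.neg

lemma abs_upperPrimitive_le (hψ : Continuous ψ) (hc : HasCompactSupport ψ) (s : ℝ) :
    |upperPrimitive ψ s| ≤ ∫ t, |ψ t| := by
  have hi : Integrable ψ := hψ.integrable_of_hasCompactSupport hc
  refine (Real.norm_eq_abs _).symm.le.trans (norm_integral_le_of_norm_le hi.abs
    (Filter.Eventually.of_forall fun t => ?_))
  rw [norm_mul]
  refine mul_le_of_le_one_right (norm_nonneg _) ?_
  by_cases h : t ∈ Ioi s <;> simp [h]

lemma upperPrimitive_eq_integral {s : ℝ} (h : ∀ t ≤ s, ψ t = 0) :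
    upperPrimitive ψ s = ∫ t, ψ t := by
  refine integral_congr_ae (Filter.Eventually.of_forall fun t => ?_)
  by_cases ht : t ∈ Ioi s
  · simp [ht]
  · simp [h t (not_lt.1 ht)]

lemma upperPrimitive_eq_zero {s : ℝ} (h : ∀ t, s < t → ψ t = 0) : upperPrimitive ψ s = 0 := by
  refine (integral_congr_ae (Filter.Eventually.of_forall fun t => ?_)).trans (integral_zero _ _)
  by_cases ht : t ∈ Ioi s
  · simp [h t ht]
  · simp [ht]

/-- A nonnegative smooth function of integral one, supported in an interval of length `h`, which is
at most `(1 + h) / h`. -/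
lemma exists_smooth_density (t : ℝ) {h : ℝ} (hh : 0 < h) : ∃ ρ : ℝ → ℝ, ContDiff ℝ ∞ ρ ∧
    HasCompactSupport ρ ∧ (∀ s, 0 ≤ ρ s ∧ ρ s ≤ (1 + h) / h) ∧ (∫ s, ρ s = 1) ∧
    ∀ s, ρ s ≠ 0 → t - h < s ∧ s < t := by
  -- The normalized bump is at most `1 / (2 rIn)`, and this inner radius makes that `(1 + h) / h`;
  -- it is just below the outer radius `h / 2`.
  let f : ContDiffBump (t - h / 2) :=
    { rIn := h / (2 * (1 + h))
      rOut := h / 2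
      rIn_pos := by positivity
      rIn_lt_rOut := div_lt_div_of_pos_left hh two_pos (by linarith) }
  refine ⟨f.normed volume, f.contDiff_normed, f.hasCompactSupport_normed,
    fun s => ⟨f.nonneg_normed s, ?_⟩, f.integral_normed, fun s hs => ?_⟩
  · refine (f.normed_le_div_measure_closedBall_rIn volume s).trans (le_of_eq ?_)
    rw [Measure.real, Real.volume_closedBall, ENNReal.toReal_ofReal (by have := f.rIn_pos; positivity)]
    change 1 / (2 * (h / (2 * (1 + h)))) = _
    field_simp
  · have h1 : s ∈ Metric.ball (t - h / 2) (h / 2) := by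
      have := f.support_normed_eq (μ := volume)
      exact this ▸ hs
    rw [Metric.mem_ball, Real.dist_eq, abs_lt] at h1
    constructor <;> linarith [h1.1, h1.2]

end Primitive

/-! ### The mass of a slice -/

section Boundary

variable {m : ℕ} {X : Type*} [EMetricSpace X] [ChartedSpace (Euc m) X] [IsManifold (𝓡 m) ∞ X]
  [RiemannianBundle (fun x : X => TangentSpace (𝓡 m) x)] [SecondCountableTopology X]
  [MeasurableSpace X] [BorelSpace X]

namespace RectParam

/-- The mass of the restriction of a parametrized current to a sublevel set. -/
def sublevelMass {n : ℕ} (P : RectParam m X n) (τ : X → ℝ) (hτ : Continuous τ) (r : ℝ) : ℝ :=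
  (P.restrict {x | τ x < r} (measurableSet_sublevel hτ r)).toCurrent.mass.toReal

/-- The difference of the boundary of the restriction to a sublevel set and the boundary. -/
def slice (P : RectParam m X 2) (τ : X → ℝ) (t : ℝ) (α : TestForm m X 1) : ℝ :=
  P.pair ({x | τ x < t}.indicator 1) (TestForm.d 1 α) - P.toCurrent.boundary α

lemma pair_sublevel_eq (P : RectParam m X 2) {τ : X → ℝ} (hτ : Continuous τ) (t : ℝ)
    (α : TestForm m X 1) : P.pair ({x | τ x < t}.indicator 1) (TestForm.d 1 α) =
      (P.restrict {x | τ x < t} (measurableSet_sublevel hτ t)).toCurrent.boundary α :=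
  (P.toCurrent_restrict (measurableSet_sublevel hτ t) (TestForm.d 1 α)).symm

/-- This is the case of the zero form in `mass_add_toCurrent_le`. Monotonicity makes the mass
differentiable almost everywhere. -/
lemma monotone_sublevelMass {n : ℕ} (P : RectParam m X n) (hfin : P.toCurrent.mass < ⊤) {τ : X → ℝ}
    (hτ : Continuous τ) : Monotone (P.sublevelMass τ hτ) := fun p q hpq => by
  have := P.mass_add_toCurrent_le hτ hfin hpq one_pos (ζ := 0)
    (fun x v _ => by change |(0 : ℝ)| ≤ 1; simp) (fun x hx => (hx rfl).elim)
  rw [map_zero, abs_zero, one_mul] at this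
  exact sub_nonneg.1 this

variable [IsContinuousRiemannianBundle (Euc m) (fun x : X => TangentSpace (𝓡 m) x)]
  [IsRiemannianManifold (𝓡 m) X]

/-- The slices are bounded by the derivative of the mass. -/
lemma abs_slice_le (P : RectParam m X 2) (hfin : P.toCurrent.mass < ⊤) {τ : X → ℝ}
    (hτ : LipschitzWith 1 τ) (hsupp : P.toCurrent.boundary.support ⊆ {x | τ x ≤ 0}) {t : ℝ}
    (ht : 0 < t) {f' : ℝ} (hf : HasDerivAt (P.sublevelMass τ hτ.continuous) f' t)
    {α : TestForm m X 1} (hα : ComassLE α 1) : |P.slice τ t α| ≤ f' := by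
  set f := P.sublevelMass τ hτ.continuous with hfdef
  -- The cutoff drops from `1` to `0` on `[t - h, t]` with slope at most `(1 + h) / h`. The mass is
  -- taken on an interval larger by `h ^ 2` at each end, a margin that is needed for the smoothing
  -- and negligible compared with `h`. The condition `h < t` keeps `Ψ` constant near `(-∞, 0]`.
  have key : ∀ h : ℝ, 0 < h → h < t → ∃ Ψ : ℝ → ℝ, Continuous Ψ ∧ (∀ s, |Ψ s| ≤ 1) ∧
      (∀ s ≤ t - h, Ψ s = 1) ∧ (∀ s, t ≤ s → Ψ s = 0) ∧
      |P.toCurrent.boundary α - P.pair (fun x => Ψ (τ x)) (TestForm.d 1 α)| ≤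
        (1 + h) / h * (f (t + h ^ 2) - f (t - (h + h ^ 2))) := by
    intro h hh hht
    obtain ⟨ρ, h1, h2, h3, h4, h5⟩ := exists_smooth_density t hh
    have hone : ∀ s ≤ t - h, upperPrimitive ρ s = 1 := fun s hs => by
      rw [upperPrimitive_eq_integral fun r hr => ?_, h4]
      by_contra hne
      linarith [(h5 r hne).1]
    have habs : ∀ s, |upperPrimitive ρ s| ≤ 1 := fun s => by
      refine (abs_upperPrimitive_le h1.continuous h2 s).trans (le_of_eq ?_)
      rw [← h4]
      exact integral_congr_ae (Filter.Eventually.of_forall fun s => abs_of_nonneg (h3 s).1)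
    refine ⟨upperPrimitive ρ, (contDiff_upperPrimitive h1 h2).continuous, habs, hone,
      fun s hs => upperPrimitive_eq_zero fun r hr => ?_, ?_⟩
    · by_contra hne
      linarith [(h5 r hne).2]
    · have hpos : 0 < (1 + h) / h := by positivity
      have := P.abs_boundary_sub_pair_le hfin hτ hsupp (contDiff_upperPrimitive h1 h2) (M := 1)
        (c₀ := 1) (s := t - h) (κ := ⟨(1 + h) / h, hpos.le⟩) habs (by linarith) hone
        (NNReal.coe_pos.1 hpos)
        (fun s => by
          rw [deriv_upperPrimitive h1.continuous h2, abs_neg, abs_of_nonneg (h3 s).1]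
          exact (h3 s).2)
        (p := t - (h + h ^ 2)) (p' := t - h) (q' := t) (q := t + h ^ 2) (by nlinarith)
        (by linarith) (by nlinarith) (fun s hs => by
          rw [deriv_upperPrimitive h1.continuous h2, neg_ne_zero] at hs
          exact ⟨(h5 s hs).1.le, (h5 s hs).2.le⟩) hα
      rwa [one_mul] at this
  obtain ⟨N, hN⟩ := exists_nat_gt (1 / t)
  have hpos : ∀ k : ℕ, (0 : ℝ) < 1 / ((k : ℝ) + N + 1) := fun k => by positivity
  have hlt : ∀ k : ℕ, 1 / ((k : ℝ) + N + 1) < t := fun k => by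
    rw [div_lt_iff₀ (by positivity)]
    rw [div_lt_iff₀ ht] at hN
    nlinarith [mul_nonneg ht.le (Nat.cast_nonneg (α := ℝ) k)]
  choose Ψ hΨ1 hΨ2 hΨ3 hΨ4 hΨ5 using fun k : ℕ => key _ (hpos k) (hlt k)
  set h : ℕ → ℝ := fun k => 1 / ((k : ℝ) + N + 1) with hh
  have hlim : Filter.Tendsto h Filter.atTop (𝓝 0) := by
    have := tendsto_one_div_add_atTop_nhds_zero_nat (𝕜 := ℝ)
    refine ((Filter.tendsto_add_atTop_iff_nat N).2 this).congr fun k => ?_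
    simp [hh]
  have hlim' : Filter.Tendsto h Filter.atTop (𝓝[≠] 0) :=
    tendsto_nhdsWithin_iff.2 ⟨hlim, Filter.Eventually.of_forall fun k => (hpos k).ne'⟩
  have hpair : Filter.Tendsto (fun k => P.pair (fun x => Ψ k (τ x)) (TestForm.d 1 α)) Filter.atTop
      (𝓝 (P.pair ({x | τ x < t}.indicator 1) (TestForm.d 1 α))) := by
    refine P.tendsto_pair (c := 1) (fun k => ((hΨ1 k).comp hτ.continuous).measurable)
      (fun k x => hΨ2 k _) _ fun x _ => ?_
    by_cases hx : τ x < t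
    · rw [indicator_of_mem (by exact hx), Pi.one_apply]
      refine tendsto_const_nhds.congr' ?_
      filter_upwards [hlim.eventually (gt_mem_nhds (sub_pos.2 hx))] with k hk
      exact (hΨ3 k _ (by linarith)).symm
    · rw [indicator_of_notMem (by exact hx)]
      exact tendsto_const_nhds.congr fun k => (hΨ4 k _ (not_lt.1 hx)).symm
  have hslope := hasDerivAt_iff_tendsto_slope_zero.1 hf
  have hA : Filter.Tendsto (fun k => (h k ^ 2)⁻¹ • (f (t + h k ^ 2) - f t)) Filter.atTop (𝓝 f') :=
    hslope.comp (tendsto_nhdsWithin_iff.2 ⟨by simpa using hlim.pow 2,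
      Filter.Eventually.of_forall fun k => (pow_pos (hpos k) 2).ne'⟩)
  have hB : Filter.Tendsto (fun k => (-(h k + h k ^ 2))⁻¹ • (f (t + -(h k + h k ^ 2)) - f t))
      Filter.atTop (𝓝 f') :=
    hslope.comp (tendsto_nhdsWithin_iff.2 ⟨by simpa using (hlim.add (hlim.pow 2)).neg,
      Filter.Eventually.of_forall fun k =>
        (neg_lt_zero.2 (add_pos (hpos k) (pow_pos (hpos k) 2))).ne⟩)
  -- The expression equals `(1 + h) (h A + (1 + h) B)`, where `A` and `B` are the difference
  -- quotients of `f` at `t` with steps `h ^ 2` and `-(h + h ^ 2)`.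
  have hC : Filter.Tendsto (fun k => (1 + h k) / h k * (f (t + h k ^ 2) - f (t - (h k + h k ^ 2))))
      Filter.atTop (𝓝 f') := by
    have h1 := ((hlim.const_add 1).mul ((hlim.mul hA).add ((hlim.const_add 1).mul hB)))
    simp only [add_zero, zero_mul, one_mul, zero_add] at h1
    refine h1.congr fun k => ?_
    have hk := (hpos k).ne'
    have hk1 : h k + h k ^ 2 ≠ 0 := (add_pos (hpos k) (pow_pos (hpos k) 2)).ne'
    have hk2 : 1 + h k ≠ 0 := (add_pos one_pos (hpos k)).ne'
    have hk3 : h k ≠ 0 := hk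
    rw [show t + -(h k + h k ^ 2) = t - (h k + h k ^ 2) by ring, smul_eq_mul, smul_eq_mul]
    have hk4 : h k + h k ^ 2 = h k * (1 + h k) := by ring
    rw [hk4]
    field_simp
    ring
  have := le_of_tendsto_of_tendsto ((hpair.const_sub (P.toCurrent.boundary α)).abs) hC
    (Filter.Eventually.of_forall fun k => hΨ5 k)
  rwa [slice, abs_sub_comm]

end RectParam

end Boundary

/-! ### The layer-cake formula for the pairing -/

section PairPrimitive

variable {m n : ℕ} {X : Type*} [EMetricSpace X] [ChartedSpace (Euc m) X]
  [MeasurableSpace X] [BorelSpace X]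

namespace RectParam

/-- The pairing with a function of `τ` as a superposition of the restrictions to sublevel sets. -/
lemma integral_mul_pair_sublevel (P : RectParam m X n) {τ : X → ℝ} (hτ : Continuous τ) {ψ : ℝ → ℝ}
    (hψ : Continuous ψ) (hc : HasCompactSupport ψ) (β : TestForm m X n) :
    Integrable (fun t => ψ t * P.pair ({x | τ x < t}.indicator 1) β) ∧
    ∫ t, ψ t * P.pair ({x | τ x < t}.indicator 1) β = P.pair (fun x => upperPrimitive ψ (τ x)) β := by
  have hi : Integrable ψ := hψ.integrable_of_hasCompactSupport hc
  set D : P.index → Euc n → ℝ := fun i => pushDensity (P.dom i) (P.map i) (P.mult i) β with hD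
  have hDi : ∀ i, IntegrableOn (D i) (P.dom i) := P.integrable β
  have hind : ∀ (t : ℝ) (x : X), |{x | τ x < t}.indicator (1 : X → ℝ) x| ≤ 1 := fun t x => by
    by_cases h : x ∈ {x | τ x < t} <;> simp [h]
  have hprod : ∀ i, Integrable (Function.uncurry fun (u : Euc n) (t : ℝ) =>
      ψ t * ({x | τ x < t}.indicator 1 (P.map i u) * D i u))
      ((volume.restrict (P.dom i)).prod volume) := by
    intro i
    have h1 : Integrable (fun q : Euc n × ℝ => D i q.1 * ψ q.2)
      ((volume.restrict (P.dom i)).prod volume) := (hDi i).mul_prod hi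
    obtain ⟨g, hg, hge⟩ : AEMeasurable (fun u => τ (P.map i u)) (volume.restrict (P.dom i)) :=
      hτ.measurable.comp_aemeasurable (P.aemeasurable_map i)
    have hset : MeasurableSet {q : Euc n × ℝ | g q.1 < q.2} :=
      measurableSet_lt (hg.comp measurable_fst) measurable_snd
    have h2 := h1.indicator hset
    refine h2.congr ?_
    have h3 : ∀ᵐ q : Euc n × ℝ ∂((volume.restrict (P.dom i)).prod volume),
        τ (P.map i q.1) = g q.1 := Measure.quasiMeasurePreserving_fst.ae hge
    filter_upwards [h3] with q hq
    by_cases h : g q.1 < q.2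
    · rw [indicator_of_mem (by exact h)]
      simp [Function.uncurry, hq, h, mul_comm]
    · rw [indicator_of_notMem (by exact h)]
      simp [Function.uncurry, hq, h]
  have hF : ∀ i, Integrable (fun t => ∫ u in P.dom i,
      ψ t * ({x | τ x < t}.indicator 1 (P.map i u) * D i u)) := fun i =>
    (hprod i).integral_prod_right
  have hbound : ∀ i t, ‖∫ u in P.dom i, ψ t * ({x | τ x < t}.indicator 1 (P.map i u) * D i u)‖ ≤
      |ψ t| * ∫ u in P.dom i, |D i u| := fun i t => by
    rw [integral_const_mul, norm_mul]
    refine mul_le_mul_of_nonneg_left ?_ (norm_nonneg _)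
    have := P.abs_integral_pair_le (hind t) β i
    rwa [one_mul] at this
  have hsum : Summable fun i => ∫ t, ‖∫ u in P.dom i,
      ψ t * ({x | τ x < t}.indicator 1 (P.map i u) * D i u)‖ := by
    refine Summable.of_nonneg_of_le (fun i => integral_nonneg fun t => norm_nonneg _) (fun i => ?_)
      ((P.summable β).mul_left (∫ t, |ψ t|))
    rw [← integral_mul_const]
    exact integral_mono (hF i).norm (hi.abs.mul_const _) (hbound i)
  have := P.countable_index
  have htsum : ∀ t, ∑' i, ∫ u in P.dom i, ψ t * ({x | τ x < t}.indicator 1 (P.map i u) * D i u) =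
      ψ t * P.pair ({x | τ x < t}.indicator 1) β := fun t => by
    simp only [integral_const_mul, tsum_mul_left]; rfl
  refine ⟨?_, ?_⟩
  · refine (integrable_tsum_of_summable hF hsum).2.congr ?_
    exact Filter.Eventually.of_forall htsum
  · have h1 := (hasSum_integral_of_summable_integral_norm hF hsum).tsum_eq
    simp only [htsum] at h1
    rw [← h1]
    refine tsum_congr fun i => ?_
    rw [← integral_integral_swap (hprod i)]
    refine integral_congr_ae (Filter.Eventually.of_forall fun u => ?_)
    simp only [upperPrimitive, ← integral_mul_const]
    refine integral_congr_ae (Filter.Eventually.of_forall fun t => ?_)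
    by_cases h : τ (P.map i u) < t <;> simp [h, hD]

end RectParam

end PairPrimitive

/-! ### Horizontal lines and box coordinates in the plane -/

section FlowBox

/-- The standard basis of the plane. -/
abbrev basisVec (j : Fin 2) : Euc 2 := EuclideanSpace.single j 1

/-- The line at height `t` in the plane. -/
def planeLine (t : ℝ) (s : Euc 1) : Euc 2 := s 0 • basisVec 0 + t • basisVec 1

lemma planeLine_zero (t : ℝ) (s : Euc 1) : planeLine t s 0 = s 0 := by simp [planeLine]

lemma planeLine_one (t : ℝ) (s : Euc 1) : planeLine t s 1 = t := by simp [planeLine]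

lemma continuous_planeLine : Continuous fun q : ℝ × Euc 1 => planeLine q.1 q.2 := by
  unfold planeLine
  fun_prop

lemma injective_planeLine : Function.Injective fun q : ℝ × Euc 1 => planeLine q.1 q.2 := by
  rintro ⟨t, s⟩ ⟨t', s'⟩ h
  have h0 := congrArg (fun x : Euc 2 => x 0) h
  have h1 := congrArg (fun x : Euc 2 => x 1) h
  simp only [planeLine_zero, planeLine_one] at h0 h1
  refine Prod.ext h1 ?_
  ext i
  rw [Subsingleton.elim i 0]
  exact h0

lemma measurePreserving_planeLine :
    MeasurePreserving (fun q : ℝ × Euc 1 => planeLine q.1 q.2) (volume.prod volume) volume := by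
  have h1 : MeasurePreserving (fun s : Euc 1 => s 0) volume volume :=
    (volume_preserving_funUnique (Fin 1) ℝ).comp (PiLp.volume_preserving_ofLp (Fin 1))
  have h2 : MeasurePreserving (Prod.map (id : ℝ → ℝ) fun s : Euc 1 => s 0)
      ((volume : Measure ℝ).prod volume) (volume.prod volume) := (MeasurePreserving.id _).prod h1
  have h3 : MeasurePreserving (Prod.swap : ℝ × ℝ → ℝ × ℝ)
      ((volume : Measure ℝ).prod volume) (volume.prod volume) := Measure.measurePreserving_swap
  have h4 : MeasurePreserving (MeasurableEquiv.finTwoArrow (α := ℝ)).symm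
      ((volume : Measure ℝ).prod volume) volume :=
    (volume_preserving_finTwoArrow ℝ).symm
  have h5 := (PiLp.volume_preserving_toLp (Fin 2)).comp (h4.comp (h3.comp h2))
  have e : (fun q : ℝ × Euc 1 => planeLine q.1 q.2) = WithLp.toLp 2 ∘
      (MeasurableEquiv.finTwoArrow (α := ℝ)).symm ∘ Prod.swap ∘
        Prod.map (id : ℝ → ℝ) fun s : Euc 1 => s 0 := by
    funext q
    ext j
    fin_cases j
    · exact planeLine_zero q.1 q.2
    · exact planeLine_one q.1 q.2
  rw [e]
  exact h5

/-- Slicing the integral over a planar set by horizontal lines. -/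
lemma integral_planeLine {V : Set (Euc 2)} (hV : MeasurableSet V) {G : Euc 2 → ℝ}
    (hG : IntegrableOn G V) :
    (∀ᵐ t : ℝ, IntegrableOn (fun s => G (planeLine t s)) (planeLine t ⁻¹' V)) ∧
    Integrable (fun t => ∫ s in planeLine t ⁻¹' V, G (planeLine t s)) ∧
    ∫ t, ∫ s in planeLine t ⁻¹' V, G (planeLine t s) = ∫ p in V, G p := by
  have hm : ∀ t, Measurable (planeLine t) := fun t =>
    (continuous_planeLine.comp (Continuous.prodMk_right t)).measurable
  have h1 : Integrable (fun q : ℝ × Euc 1 => V.indicator G (planeLine q.1 q.2))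
      (volume.prod volume) :=
    measurePreserving_planeLine.integrable_comp_of_integrable (hG.integrable_indicator hV)
  have e : ∀ t, (fun s => V.indicator G (planeLine t s)) =
      (planeLine t ⁻¹' V).indicator fun s => G (planeLine t s) := fun t => rfl
  have e2 : ∀ t, ∫ s, V.indicator G (planeLine t s) = ∫ s in planeLine t ⁻¹' V, G (planeLine t s) :=
    fun t => by rw [e, integral_indicator (hm t hV)]
  refine ⟨?_, ?_, ?_⟩
  · filter_upwards [h1.prod_right_ae] with t ht
    simp only [e] at ht
    exact (integrable_indicator_iff (hm t hV)).1 ht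
  · simpa only [e2] using h1.integral_prod_left
  · simp only [← e2]
    rw [← integral_prod (fun q : ℝ × Euc 1 => V.indicator G (planeLine q.1 q.2)) h1,
      measurePreserving_planeLine.integral_comp
        (continuous_planeLine.measurableEmbedding injective_planeLine), integral_indicator hV]

lemma ae_ae_planeLine {V : Set (Euc 2)} (hV : MeasurableSet V) {Q : Euc 2 → Prop}
    (hQ : ∀ᵐ p ∂(volume.restrict V), Q p) :
    ∀ᵐ t : ℝ, ∀ᵐ s ∂(volume.restrict (planeLine t ⁻¹' V)), Q (planeLine t s) := by
  have hm : ∀ t, Measurable (planeLine t) := fun t =>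
    (continuous_planeLine.comp (Continuous.prodMk_right t)).measurable
  have h1 := measurePreserving_planeLine.quasiMeasurePreserving.ae ((ae_restrict_iff' hV).1 hQ)
  filter_upwards [Measure.ae_ae_of_ae_prod h1] with t ht
  exact (ae_restrict_iff' (hm t hV)).2 ht

/-- The map of the plane with coordinates a linear form and a function. -/
def boxMap (ℓ : Euc 2 →L[ℝ] ℝ) (g : Euc 2 → ℝ) (u : Euc 2) : Euc 2 :=
  ℓ u • basisVec 0 + g u • basisVec 1

lemma boxMap_one (ℓ : Euc 2 →L[ℝ] ℝ) (g : Euc 2 → ℝ) (u : Euc 2) : boxMap ℓ g u 1 = g u := by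
  simp [boxMap]

/-- The derivative of `boxMap`. -/
def boxDeriv (ℓ L : Euc 2 →L[ℝ] ℝ) : Euc 2 →L[ℝ] Euc 2 :=
  ℓ.smulRight (basisVec 0) + L.smulRight (basisVec 1)

lemma boxDeriv_apply (ℓ L : Euc 2 →L[ℝ] ℝ) (v : Euc 2) :
    boxDeriv ℓ L v = ℓ v • basisVec 0 + L v • basisVec 1 := rfl

lemma hasFDerivAt_boxMap (ℓ : Euc 2 →L[ℝ] ℝ) {g : Euc 2 → ℝ} {u : Euc 2}
    (hg : DifferentiableAt ℝ g u) : HasFDerivAt (boxMap ℓ g) (boxDeriv ℓ (fderiv ℝ g u)) u :=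
  (ℓ.hasFDerivAt.smul_const (basisVec 0)).add (hg.hasFDerivAt.smul_const (basisVec 1))

lemma det_boxDeriv (ℓ L : Euc 2 →L[ℝ] ℝ) :
    (boxDeriv ℓ L).det = ℓ (basisVec 0) * L (basisVec 1) - ℓ (basisVec 1) * L (basisVec 0) := by
  rw [ContinuousLinearMap.det, ← LinearMap.det_toMatrix (EuclideanSpace.basisFun (Fin 2) ℝ).toBasis,
    Matrix.det_fin_two]
  simp [LinearMap.toMatrix_apply, boxDeriv_apply]

/-- An almost everywhere property on the image of a map with invertible derivatives holds almost
everywhere on the domain. -/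
lemma ae_of_ae_image {n : ℕ} {S : Set (Euc n)} (hS : MeasurableSet S) {F : Euc n → Euc n}
    (hFc : Continuous F) {F' : Euc n → Euc n →L[ℝ] Euc n}
    (hF : ∀ u ∈ S, HasFDerivWithinAt F (F' u) S u) (hinj : InjOn F S)
    (hdet : ∀ u ∈ S, (F' u).det ≠ 0) {Q : Euc n → Prop} (hQ : ∀ᵐ p ∂(volume.restrict (F '' S)), Q p) :
    ∀ᵐ u ∂(volume.restrict S), Q (F u) := by
  set N := toMeasurable (volume.restrict (F '' S)) {p | ¬ Q p} with hN
  have hN0 : volume.restrict (F '' S) N = 0 := by rw [hN, measure_toMeasurable]; exact hQ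
  have hNm : MeasurableSet N := measurableSet_toMeasurable _ _
  rw [Measure.restrict_apply hNm] at hN0
  set S' := S ∩ F ⁻¹' N with hS'
  have hS'm : MeasurableSet S' := hS.inter (hFc.measurable hNm)
  have hF' : ∀ u ∈ S', HasFDerivWithinAt F (F' u) S' u := fun u hu => (hF u hu.1).mono inter_subset_left
  -- The part of `S` sent to the bad null set has an image of measure zero, so the Jacobian
  -- integrates to zero over it; as the Jacobian does not vanish, that part is null.
  have h1 := lintegral_abs_det_fderiv_eq_addHaar_image volume hS'm hF' (hinj.mono inter_subset_left)
  have h2 : volume (F '' S') = 0 := by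
    refine measure_mono_null ?_ hN0
    rintro _ ⟨u, hu, rfl⟩
    exact ⟨hu.2, u, hu.1, rfl⟩
  rw [h2, lintegral_eq_zero_iff' (aemeasurable_ofReal_abs_det_fderivWithin volume hS'm hF')] at h1
  have h3 : ∀ᵐ u ∂(volume.restrict S'), False := by
    filter_upwards [h1, ae_restrict_mem hS'm] with u h4 h5
    have h6 : 0 < |(F' u).det| := abs_pos.2 (hdet u h5.1)
    simp only [Pi.zero_apply, ENNReal.ofReal_eq_zero] at h4
    linarith
  have h4 : volume S' = 0 := by
    have := Filter.eventually_false_iff_eq_bot.1 h3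
    rwa [ae_eq_bot, Measure.restrict_eq_zero] at this
  rw [ae_restrict_iff' hS]
  have h5 : ∀ᵐ u ∂(volume : Measure (Euc n)), u ∉ S' := measure_eq_zero_iff_ae_notMem.1 h4
  filter_upwards [h5] with u hu huS
  by_contra hq
  exact hu ⟨huS, subset_toMeasurable _ _ hq⟩

end FlowBox

/-! ### Slicing a single piece -/

section SlicePiece

variable {m : ℕ} {X : Type*} [EMetricSpace X] [ChartedSpace (Euc m) X]

/-- The chain rule for the pullback of a `1`-form. -/
lemma lin_pAt_comp {a b : ℕ} {f : Euc a → X} {h : Euc b → X} {F : Euc a → Euc b} {S : Set (Euc a)}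
    {V : Set (Euc b)} {u : Euc a} {F' : Euc a →L[ℝ] Euc b} (heq : ∀ v ∈ S, f v = h (F v)) (hu : u ∈ S)
    (hF : HasFDerivWithinAt F F' S u) (hmaps : MapsTo F S V)
    (hh : MDifferentiableWithinAt 𝓘(ℝ, Euc b) (𝓡 m) h V (F u)) (hS : UniqueDiffWithinAt ℝ S u)
    (α : TestForm m X 1) (e : Euc a) :
    TestForm.lin α (f u) (pAt (m := m) f S u e) =
      TestForm.lin α (h (F u)) (pAt (m := m) h V (F u) (F' e)) := by
  have h1 := hh.hasMFDerivWithinAt.comp u hF.hasMFDerivWithinAt hmaps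
  have h2 := (h1.congr_mono heq (heq u hu) subset_rfl).mfderivWithin hS.uniqueMDiffWithinAt
  have h3 : (pAt (m := m) f S u e : Euc m) = pAt (m := m) h V (F u) (F' e) :=
    congrArg (fun L : Euc a →L[ℝ] Euc m => L e) h2
  exact form_congr (n := 1) α.1 (heq u hu) (funext fun _ => h3)

lemma pushDensity_one (K : Set (Euc 1)) (f : Euc 1 → X) (θ : Euc 1 → ℤ) (α : TestForm m X 1)
    (s : Euc 1) : pushDensity K f θ α s =
      θ s * TestForm.lin α (f s) (pAt (m := m) f K s (EuclideanSpace.single 0 1)) := by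
  rw [pushDensity_apply, TestForm.apply_eq_lin]

variable [IsManifold (𝓡 m) ∞ X]
  [RiemannianBundle (fun x : X => TangentSpace (𝓡 m) x)]
  [IsContinuousRiemannianBundle (Euc m) (fun x : X => TangentSpace (𝓡 m) x)]
  [IsRiemannianManifold (𝓡 m) X] [SecondCountableTopology X]

/-- The data of the slices of a piece `(S, f, θ)` of a parametrized current by the level sets of
`τ`. -/
structure SliceData (τ : X → ℝ) (S : Set (Euc 2)) (f : Euc 2 → X) (θ : Euc 2 → ℤ) where
  /-- the domains of the slices -/
  dom : ℝ → Set (Euc 1)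
  /-- the parametrizations of the slices -/
  map : ℝ → Euc 1 → X
  /-- the multiplicity of the slices -/
  mult : ℤ
  measurableSet_dom : ∀ t, MeasurableSet (dom t)
  lipschitz : ∀ t, ∃ c : ℝ≥0, LipschitzOnWith c (map t) (dom t)
  spec : ∀ α : TestForm m X 1, IntegrableOn (wedgeDensity (τ ∘ f) S f θ α) S →
    (∀ᵐ t, IntegrableOn (pushDensity (dom t) (map t) (fun _ => mult) α) (dom t)) ∧
    Integrable (fun t => ∫ s in dom t, |pushDensity (dom t) (map t) (fun _ => mult) α s|) ∧
    (∫ t, ∫ s in dom t, |pushDensity (dom t) (map t) (fun _ => mult) α s| ≤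
      ∫ u in S, |wedgeDensity (τ ∘ f) S f θ α u|) ∧
    Integrable (fun t => ∫ s in dom t, pushDensity (dom t) (map t) (fun _ => mult) α s) ∧
    ∀ ψ : ℝ → ℝ, Continuous ψ → HasCompactSupport ψ →
      ∫ u in S, ψ (τ (f u)) * wedgeDensity (τ ∘ f) S f θ α u =
        ∫ t, ψ t * ∫ s in dom t, pushDensity (dom t) (map t) (fun _ => mult) α s

/-- The slices of a piece on which `dτ` vanishes. -/
def SliceData.ofCritical {τ : X → ℝ} {S : Set (Euc 2)} {f : Euc 2 → X} {θ : Euc 2 → ℤ}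
    (h : ∀ᵐ u ∂(volume.restrict S), fderivWithin ℝ (τ ∘ f) S u = 0) (x : X) :
    SliceData (m := m) τ S f θ where
  dom _ := ∅
  map _ _ := x
  mult := 0
  measurableSet_dom _ := MeasurableSet.empty
  lipschitz _ := ⟨0, fun _ hs => (notMem_empty _ hs).elim⟩
  spec α _ := by
    have h0 : ∀ᵐ u ∂(volume.restrict S), wedgeDensity (τ ∘ f) S f θ α u = 0 := by
      filter_upwards [h] with u hu
      simp [wedgeDensity, hu]
    refine ⟨by simp, by simp, ?_, by simp, fun ψ _ _ => ?_⟩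
    · simpa using integral_nonneg fun u => abs_nonneg _
    · have h1 : ∀ᵐ u ∂(volume.restrict S),
          ψ (τ (f u)) * wedgeDensity (τ ∘ f) S f θ α u = 0 := by
        filter_upwards [h0] with u hu
        rw [hu, mul_zero]
      rw [integral_congr_ae h1]
      simp

/-- The box map straightens the level sets of `τ ∘ f` into horizontal lines and has a Lipschitz
inverse, so the slices are `f` composed with that inverse on those lines. The change of variables
formula followed by Fubini's theorem gives the integral identities. -/
lemma nonempty_sliceData_of_regular {τ : X → ℝ} {S : Set (Euc 2)} (hS : MeasurableSet S)
    {f : Euc 2 → X} {c : ℝ≥0} (hf : LipschitzOnWith c f S) {θ : Euc 2 → ℤ} {z : ℤ}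
    (hz : ∀ u ∈ S, θ u = z) {g : Euc 2 → ℝ} (hg : Continuous g) (hge : EqOn (τ ∘ f) g S)
    (hgd : ∀ u ∈ S, DifferentiableAt ℝ g u) (ℓ : Euc 2 →L[ℝ] ℝ)
    (hdet : ∀ u ∈ S, 0 < (boxDeriv ℓ (fderiv ℝ g u)).det) {C : ℝ≥0}
    (hC : ∀ u ∈ S, ∀ v ∈ S, edist u v ≤ C * edist (boxMap ℓ g u) (boxMap ℓ g v)) :
    Nonempty (SliceData (m := m) τ S f θ) := by
  classical
  set F := boxMap ℓ g with hFdef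
  have hFc : Continuous F := by unfold F boxMap; fun_prop
  have hF' : ∀ u ∈ S, HasFDerivWithinAt F (boxDeriv ℓ (fderiv ℝ g u)) S u := fun u hu =>
    (hasFDerivAt_boxMap ℓ (hgd u hu)).hasFDerivWithinAt
  have hinj : InjOn F S := fun u hu v hv huv => by
    have := hC u hu v hv
    rw [huv, edist_self, mul_zero] at this
    exact edist_le_zero.1 this
  set V := F '' S with hVdef
  have hV : MeasurableSet V := hS.image_of_continuousOn_injOn hFc.continuousOn hinj
  set H := Function.invFunOn F S with hHdef
  have hHF : ∀ u ∈ S, H (F u) = u := fun u hu => hinj.leftInvOn_invFunOn hu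
  have hHl : LipschitzOnWith C H V := by
    rintro _ ⟨u, hu, rfl⟩ _ ⟨v, hv, rfl⟩
    rw [hHF u hu, hHF v hv]
    exact hC u hu v hv
  have hHm : MapsTo H V S := by
    rintro _ ⟨u, hu, rfl⟩
    rw [hHF u hu]; exact hu
  set h := f ∘ H with hhdef
  have hh : LipschitzOnWith (c * C) h V := hf.comp hHl hHm
  have hmd := ae_mdifferentiableWithinAt (m := m) hV hh
  set D : ℝ → Set (Euc 1) := fun t => planeLine t ⁻¹' V with hD
  have hDm : ∀ t, MeasurableSet (D t) := fun t =>
    (continuous_planeLine.comp (Continuous.prodMk_right t)).measurable hV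
  have hlineD : ∀ t s, HasFDerivAt (planeLine t)
      ((EuclideanSpace.proj (0 : Fin 1) : Euc 1 →L[ℝ] ℝ).smulRight (basisVec 0)) s := fun t s =>
    (((EuclideanSpace.proj (0 : Fin 1) : Euc 1 →L[ℝ] ℝ).hasFDerivAt (x := s)).smul_const
      (basisVec 0)).add_const _
  have hlineLip : ∀ t, LipschitzWith 1 (planeLine t) := fun t => by
    refine LipschitzWith.of_dist_le_mul fun s s' => ?_
    rw [dist_eq_norm, dist_eq_norm, show planeLine t s - planeLine t s' = (s - s') 0 • basisVec 0 by
      simp [planeLine, sub_smul], norm_smul, PiLp.norm_single]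
    simpa using PiLp.norm_apply_le (s - s') 0
  -- If `f^*α = a ℓ + b dg`, then `dg ∧ f^*α = -a (ℓ ∧ dg)`, and `ℓ ∧ dg` is the Jacobian of the box
  -- map; hence the multiplicity `-z` on the slices.
  set J : TestForm m X 1 → Euc 2 → ℝ := fun α p =>
    ((-z : ℤ) : ℝ) * TestForm.lin α (h p) (pAt (m := m) h V p (basisVec 0)) with hJ
  have hslice : ∀ᵐ t : ℝ, ∀ α : TestForm m X 1, ∀ᵐ s ∂(volume.restrict (D t)),
      pushDensity (D t) (fun s => h (planeLine t s)) (fun _ => -z) α s = J α (planeLine t s) := by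
    filter_upwards [ae_ae_planeLine hV hmd] with t ht α
    filter_upwards [ht, ae_uniqueDiffWithinAt (D t), ae_restrict_mem (hDm t)] with s h1 h2 h3
    rw [pushDensity_one, lin_pAt_comp (f := fun s => h (planeLine t s)) (h := h) (F := planeLine t)
      (V := V) (fun _ _ => rfl) h3 (hlineD t s).hasFDerivWithinAt (fun s hs => hs) h1 h2]
    simp [hJ]
  have hcov : ∀ (α : TestForm m X 1), ∀ᵐ u ∂(volume.restrict S),
      |(boxDeriv ℓ (fderiv ℝ g u)).det| * J α (F u) = wedgeDensity (τ ∘ f) S f θ α u := by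
    intro α
    have hgdw : ∀ u ∈ S, HasFDerivWithinAt (τ ∘ f) (fderiv ℝ g u) S u := fun u hu =>
      ((hgd u hu).hasFDerivAt.hasFDerivWithinAt).congr hge (hge hu)
    filter_upwards [ae_of_ae_image hS hFc hF' hinj (fun u hu => (hdet u hu).ne') hmd,
      ae_uniqueDiffWithinAt S, ae_restrict_mem hS] with u h1 h2 h3
    have e : ∀ e, TestForm.lin α (f u) (pAt (m := m) f S u e) = TestForm.lin α (h (F u))
        (pAt (m := m) h V (F u) (boxDeriv ℓ (fderiv ℝ g u) e)) := fun e =>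
      lin_pAt_comp (fun v hv => by simp only [hhdef, Function.comp_apply, hHF v hv]) h3 (hF' u h3)
        (mapsTo_image F S) h1 h2 α e
    rw [wedgeDensity, e, e, (hgdw u h3).fderivWithin h2, abs_of_pos (hdet u h3), det_boxDeriv,
      boxDeriv_apply, boxDeriv_apply, hz u h3]
    simp only [map_add, map_smul, smul_eq_mul, hJ, Int.cast_neg]
    ring
  refine ⟨⟨D, fun t s => h (planeLine t s), -z, hDm, fun t => ⟨c * C * 1, ?_⟩, fun α hα => ?_⟩⟩
  · exact hh.comp ((hlineLip t).lipschitzOnWith) fun s hs => hs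
  have hJi : IntegrableOn (J α) V := by
    rw [hVdef, integrableOn_image_iff_integrableOn_abs_det_fderiv_smul volume hS hF' hinj]
    exact hα.congr (by filter_upwards [hcov α] with u hu using hu.symm)
  -- Positive homogeneity lets the Jacobian enter `φ`; this covers both the absolute value and
  -- multiplication by `ψ (τ (f u))`.
  have hchange : ∀ φ : ℝ → ℝ → ℝ, (∀ a x y, 0 ≤ a → a * φ x y = φ x (a * y)) →
      ∫ p in V, φ (p 1) (J α p) = ∫ u in S, φ (τ (f u)) (wedgeDensity (τ ∘ f) S f θ α u) := by
    intro φ hφ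
    rw [hVdef, integral_image_eq_integral_abs_det_fderiv_smul volume hS hF' hinj]
    refine integral_congr_ae ?_
    filter_upwards [hcov α, ae_restrict_mem hS] with u h1 h2
    rw [smul_eq_mul, hφ _ _ _ (abs_nonneg _), h1, boxMap_one]
    congr 1
    exact (hge h2).symm
  obtain ⟨i1, i2, -⟩ := integral_planeLine hV hJi
  obtain ⟨-, j2, j3⟩ := integral_planeLine hV hJi.abs
  have heq : ∀ᵐ t : ℝ, ∀ φ : ℝ → ℝ, ∫ s in D t, φ (pushDensity (D t) (fun s => h (planeLine t s))
      (fun _ => -z) α s) = ∫ s in D t, φ (J α (planeLine t s)) := by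
    filter_upwards [hslice] with t ht φ
    refine integral_congr_ae ?_
    filter_upwards [ht α] with s hs
    rw [hs]
  refine ⟨?_, ?_, ?_, ?_, fun ψ hψ hψc => ?_⟩
  · filter_upwards [i1, hslice] with t h1 h2
    exact h1.congr (by filter_upwards [h2 α] with s hs using hs.symm)
  · exact j2.congr (by filter_upwards [heq] with t ht using (ht (fun y => |y|)).symm)
  · have h1 : ∫ t, ∫ s in D t, |pushDensity (D t) (fun s => h (planeLine t s)) (fun _ => -z) α s| =
        ∫ t, ∫ s in planeLine t ⁻¹' V, |J α (planeLine t s)| :=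
      integral_congr_ae (by filter_upwards [heq] with t ht using ht (fun y => |y|))
    rw [h1, j3]
    exact (hchange (fun _ y => |y|) fun a x y ha => by rw [abs_mul, abs_of_nonneg ha]).le
  · exact i2.congr (by filter_upwards [heq] with t ht using (ht (fun y => y)).symm)
  · rw [← hchange (fun x y => ψ x * y) fun a x y _ => by ring]
    obtain ⟨Cψ, hCψ⟩ := hψc.exists_bound_of_continuous hψ
    have hψi : IntegrableOn (fun p : Euc 2 => ψ (p 1) * J α p) V :=
      hJi.bdd_mul (hψ.comp (by fun_prop : Continuous fun p : Euc 2 => p 1)).aestronglyMeasurable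
        (Filter.Eventually.of_forall fun p => hCψ _)
    rw [← (integral_planeLine hV hψi).2.2]
    refine integral_congr_ae ?_
    filter_upwards [heq] with t ht
    rw [ht (fun y => y)]
    simp only [planeLine_one, integral_const_mul]
    rfl

end SlicePiece

/-! ### Partition into sliceable pieces -/

/-- A partition into pieces with a hereditary property, from a countable almost everywhere cover. -/
lemma exists_partition_of_cover {E ι : Type*} [MeasurableSpace E] {μ : Measure E} [Countable ι]
    [Nonempty ι] {K : Set E} (hK : MeasurableSet K) (B : ι → Set E) (hB : ∀ i, MeasurableSet (B i))
    (hcov : ∀ᵐ u ∂μ, u ∈ K → ∃ i, u ∈ B i) {G : Set E → Prop}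
    (hG : ∀ i, ∀ S ⊆ K ∩ B i, MeasurableSet S → G S) :
    ∃ A : ℕ → Set E, (∀ k, MeasurableSet (A k)) ∧ Pairwise (Function.onFun Disjoint A) ∧
      (∀ k, A k ⊆ K) ∧ μ (K \ ⋃ k, A k) = 0 ∧ ∀ k, G (A k) := by
  obtain ⟨e, he⟩ := exists_surjective_nat ι
  have hsub : ∀ k, disjointed (fun n => K ∩ B (e n)) k ⊆ K ∩ B (e k) := fun k =>
    disjointed_subset _ k
  have hm : ∀ k, MeasurableSet (disjointed (fun n => K ∩ B (e n)) k) := fun k =>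
    MeasurableSet.disjointed (fun n => hK.inter (hB (e n))) k
  refine ⟨disjointed fun n => K ∩ B (e n), hm, disjoint_disjointed _,
    fun k => (hsub k).trans inter_subset_left, ?_, fun k => hG (e k) _ (hsub k) (hm k)⟩
  rw [iUnion_disjointed]
  refine measure_mono_null (t := {u | ¬ (u ∈ K → ∃ i, u ∈ B i)}) ?_ hcov
  rintro u ⟨hu, hn⟩
  simp only [mem_ofPred_eq, Classical.not_imp, not_exists]
  refine ⟨hu, fun i hi => hn ?_⟩
  obtain ⟨n, rfl⟩ := he i
  exact mem_iUnion.2 ⟨n, hu, hi⟩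

/-- The linear forms complementing `dg` at the regular points. -/
def sideForm (j : Fin 2 × Bool) : Euc 2 →L[ℝ] ℝ :=
  (if j.2 then (1 : ℝ) else -1) • EuclideanSpace.proj j.1

/-- For the coordinate forms with either sign, the determinants are the components of `L` with
either sign; if none is positive, both components vanish. -/
lemma exists_sideForm {L : Euc 2 →L[ℝ] ℝ} (hL : L ≠ 0) :
    ∃ j, 0 < (boxDeriv (sideForm j) L).det := by
  by_contra! h
  have h1 := h (0, true)
  have h2 := h (0, false)
  have h3 := h (1, true)
  have h4 := h (1, false)
  simp only [det_boxDeriv, sideForm] at h1 h2 h3 h4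
  simp at h1 h2 h3 h4
  apply hL
  ext v
  have : v = v 0 • basisVec 0 + v 1 • basisVec 1 := by
    ext j
    fin_cases j <;> simp
  rw [this, map_add, map_smul, map_smul, le_antisymm h1 h2, le_antisymm h4 h3]
  simp

/-- The regular set of a Lipschitz function is covered by countably many sets on which the box map
is bi-Lipschitz. -/
lemma exists_bilipschitz_cover {g : Euc 2 → ℝ} (ℓ : Euc 2 →L[ℝ] ℝ) {s : Set (Euc 2)}
    (hs : ∀ u ∈ s, DifferentiableAt ℝ g u ∧ 0 < (boxDeriv ℓ (fderiv ℝ g u)).det) :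
    ∃ t : ℕ → Set (Euc 2), (∀ n, MeasurableSet (t n)) ∧ s ⊆ ⋃ n, t n ∧
      ∀ n, ∃ C : ℝ≥0, ∀ u ∈ s ∩ t n, ∀ v ∈ s ∩ t n,
        edist u v ≤ C * edist (boxMap ℓ g u) (boxMap ℓ g v) := by
  classical
  -- A map approximated by an invertible `A` to within half of `‖A⁻¹‖⁻¹` is expanding up to a
  -- constant. The default `1` plays no role: on a nonempty `s`, each approximating map is a
  -- derivative at a point of `s`, hence invertible.
  set r : (Euc 2 →L[ℝ] Euc 2) → ℝ≥0 := fun A => if h : A.det ≠ 0 then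
    ‖((A.toContinuousLinearEquivOfDetNeZero h).symm : Euc 2 →L[ℝ] Euc 2)‖₊⁻¹ / 2 else 1 with hr
  have hr0 : ∀ A, r A ≠ 0 := by
    intro A
    simp only [hr]
    split_ifs with h
    · have := (A.toContinuousLinearEquivOfDetNeZero h).nnnorm_symm_pos
      positivity
    · exact one_ne_zero
  obtain ⟨t, A, -, h2, h3, h4, h5⟩ := exists_partition_approximatesLinearOn_of_hasFDerivWithinAt
    (boxMap ℓ g) s (fun u => boxDeriv ℓ (fderiv ℝ g u))
    (fun u hu => (hasFDerivAt_boxMap ℓ (hs u hu).1).hasFDerivWithinAt) r hr0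
  refine ⟨t, h2, h3, fun n => ?_⟩
  rcases s.eq_empty_or_nonempty with rfl | hne
  · exact ⟨0, by simp⟩
  obtain ⟨y, hy, hA⟩ := h5 hne n
  have hd : (A n).det ≠ 0 := by rw [hA]; exact (hs y hy).2.ne'
  have h6 := h4 n
  rw [← (A n).coe_toContinuousLinearEquivOfDetNeZero hd] at h6
  have h7 := h6.antilipschitz (Or.inr (by
    simp only [hr, ContinuousLinearMap.coe_toContinuousLinearEquivOfDetNeZero, dif_pos hd]
    exact NNReal.half_lt_self
      (inv_ne_zero ((A n).toContinuousLinearEquivOfDetNeZero hd).nnnorm_symm_pos.ne')))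
  exact ⟨_, fun u hu v hv => h7 ⟨u, hu⟩ ⟨v, hv⟩⟩

section Decomposition

variable {m : ℕ} {X : Type*} [EMetricSpace X] [ChartedSpace (Euc m) X] [IsManifold (𝓡 m) ∞ X]
  [RiemannianBundle (fun x : X => TangentSpace (𝓡 m) x)]
  [IsContinuousRiemannianBundle (Euc m) (fun x : X => TangentSpace (𝓡 m) x)]
  [IsRiemannianManifold (𝓡 m) X] [SecondCountableTopology X]

/-- Every Lipschitz piece can be partitioned into pieces which have slices. -/
lemma exists_partition_sliceData {τ : X → ℝ} (hτ : LipschitzWith 1 τ) {K : Set (Euc 2)}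
    (hK : MeasurableSet K) {f : Euc 2 → X} {c : ℝ≥0} (hf : LipschitzOnWith c f K)
    {θ : Euc 2 → ℤ} (hθ : Measurable θ) :
    ∃ A : ℕ → Set (Euc 2), (∀ k, MeasurableSet (A k)) ∧ Pairwise (Function.onFun Disjoint A) ∧
      (∀ k, A k ⊆ K) ∧ volume (K \ ⋃ k, A k) = 0 ∧ ∀ k, volume (A k) < ⊤ ∧
        (∃ z : ℤ, ∀ u ∈ A k, θ u = z) ∧ Nonempty (SliceData (m := m) τ (A k) f θ) := by
  obtain ⟨g, hgl, hge⟩ := (hτ.comp_lipschitzOnWith hf).extend_real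
  have hg := hgl.continuous
  set Reg : Fin 2 × Bool → Set (Euc 2) := fun j => {u | DifferentiableAt ℝ g u ∧
    0 < (boxDeriv (sideForm j) (fderiv ℝ g u)).det} with hReg
  set Crit : Set (Euc 2) := {u | DifferentiableAt ℝ g u ∧ fderiv ℝ g u = 0} with hCrit
  have hRm : ∀ j, MeasurableSet (Reg j) := fun j => by
    have h : Measurable fun u => (boxDeriv (sideForm j) (fderiv ℝ g u)).det := by
      simp only [det_boxDeriv]
      exact ((measurable_fderiv_apply_const ℝ g _).const_mul _).sub
        ((measurable_fderiv_apply_const ℝ g _).const_mul _)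
    exact (measurableSet_of_differentiableAt ℝ g).inter (measurableSet_lt measurable_const h)
  have hCm : MeasurableSet Crit := (measurableSet_of_differentiableAt ℝ g).inter
    (measurable_fderiv ℝ g (measurableSet_singleton 0))
  choose t ht1 ht2 ht3 using fun j => exists_bilipschitz_cover (g := g) (sideForm j)
    (s := Reg j) (fun u hu => hu)
  -- An index records the multiplicity, a ball making the measure finite, and either the critical
  -- set (`none`) or a side form with one of its bi-Lipschitz sets.
  refine exists_partition_of_cover (ι := ℤ × ℕ × Option ((Fin 2 × Bool) × ℕ)) (μ := volume)
    (G := fun S => volume S < ⊤ ∧ (∃ z : ℤ, ∀ u ∈ S, θ u = z) ∧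
      Nonempty (SliceData (m := m) τ S f θ)) hK
    (fun i => θ ⁻¹' {i.1} ∩ (Metric.closedBall 0 i.2.1 ∩
      i.2.2.elim Crit fun q => Reg q.1 ∩ t q.1 q.2)) ?_ ?_ ?_
  · rintro ⟨z, n, o⟩
    refine (hθ (measurableSet_singleton z)).inter (measurableSet_closedBall.inter ?_)
    rcases o with _ | ⟨j, k⟩
    · exact hCm
    · exact (hRm j).inter (ht1 j k)
  · filter_upwards [hgl.ae_differentiableAt] with u hu _
    obtain ⟨n, hn⟩ := exists_nat_ge ‖u‖
    by_cases h0 : fderiv ℝ g u = 0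
    · exact ⟨(θ u, n, none), rfl, by simpa using hn, hu, h0⟩
    · obtain ⟨j, hj⟩ := exists_sideForm h0
      obtain ⟨k, hk⟩ := mem_iUnion.1 (ht2 j (show u ∈ Reg j from ⟨hu, hj⟩))
      exact ⟨(θ u, n, some (j, k)), rfl, by simpa using hn, ⟨hu, hj⟩, hk⟩
  · rintro ⟨z, n, o⟩ S hS hSm
    have hSK : S ⊆ K := fun u hu => (hS hu).1
    have hz : ∀ u ∈ S, θ u = z := fun u hu => (hS hu).2.1
    refine ⟨(measure_mono fun u hu => (hS hu).2.2.1).trans_lt measure_closedBall_lt_top,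
      ⟨z, hz⟩, ?_⟩
    rcases o with _ | ⟨j, k⟩
    -- The trivial slices of a critical piece need some point of `X` as a constant map; an empty
    -- piece offers none and counts as regular.
    · rcases S.eq_empty_or_nonempty with rfl | ⟨u₀, -⟩
      · exact nonempty_sliceData_of_regular hSm (hf.mono hSK) hz hg (hge.mono hSK) (by simp)
          (sideForm 0) (by simp) (C := 0) (by simp)
      refine ⟨SliceData.ofCritical ?_ (f u₀)⟩
      filter_upwards [ae_uniqueDiffWithinAt S, ae_restrict_mem hSm] with u h1 h2
      have h3 := (hS h2).2.2.2
      rw [fderivWithin_congr (hge.mono hSK) (hge (hSK h2)), h3.1.fderivWithin h1, h3.2]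
    · obtain ⟨C, hC⟩ := ht3 j k
      have h3 : ∀ u ∈ S, u ∈ Reg j ∩ t j k := fun u hu => (hS hu).2.2.2
      exact nonempty_sliceData_of_regular hSm (hf.mono hSK) hz hg (hge.mono hSK)
        (fun u hu => (h3 u hu).1.1) (sideForm j) (fun u hu => (h3 u hu).1.2)
        fun u hu v hv => hC u (h3 u hu) v (h3 v hv)

variable [MeasurableSpace X] [BorelSpace X]

/-- Every parametrized current has a tame parametrization by pieces which have slices. -/
lemma RectParam.exists_sliceable (P : RectParam m X 2) {τ : X → ℝ} (hτ : LipschitzWith 1 τ) :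
    ∃ P' : RectParam m X 2, P'.IsTame ∧
      (∀ q, Nonempty (SliceData (m := m) τ (P'.dom q) (P'.map q) (P'.mult q))) ∧
      P'.toCurrent = P.toCurrent ∧
      ∀ (w : X → ℝ) (c : ℝ), Measurable w → (∀ x, |w x| ≤ c) →
        ∀ α, P'.pair w α = P.pair w α := by
  obtain ⟨P', h1, h2, h3⟩ := P.exists_refinement
    (fun f θ S => volume S < ⊤ ∧ (∃ z : ℤ, ∀ u ∈ S, θ u = z) ∧
      Nonempty (SliceData (m := m) τ S f θ)) fun i => by
    obtain ⟨c, hc⟩ := P.lipschitz i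
    exact exists_partition_sliceData hτ (P.measurableSet_dom i) hc (P.measurable_mult i)
  exact ⟨P', fun q => ⟨(h1 q).1, (h1 q).2.1⟩, fun q => (h1 q).2.2, h2, h3⟩

end Decomposition

/-! ### Separability of the space of `1`-forms -/

lemma euclidean_eq_sum {m : ℕ} (w : Euc m) : w = ∑ b, w b • EuclideanSpace.single b (1 : ℝ) := by
  ext j
  simp [Pi.single_apply]

lemma norm_le_sum_abs {m : ℕ} (w : Euc m) : ‖w‖ ≤ ∑ b, |w b| := by
  conv_lhs => rw [euclidean_eq_sum w]
  refine (norm_sum_le _ _).trans (Finset.sum_le_sum fun b _ => ?_)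
  simp [norm_smul]

section Separability

variable {m : ℕ} {X : Type*} [EMetricSpace X] [ChartedSpace (Euc m) X] [IsManifold (𝓡 m) ∞ X]
  [RiemannianBundle (fun x : X => TangentSpace (𝓡 m) x)] {ε : ℝ}

namespace ChartPatch

variable {x₀ : X} (p : ChartPatch m ε x₀)

lemma lin_dcoord (b : Fin m) (x : X) (v : TangentSpace (𝓡 m) x) :
    TestForm.lin (p.dcoord b) x v = dAt p.coord x v b := p.dcoord_apply b x fun _ => v

/-- The sum of the absolute values of the components of a tangent vector. -/
def coordSum (x : X) (v : TangentSpace (𝓡 m) x) : ℝ := ∑ b, |TestForm.lin (p.dcoord b) x v|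

lemma coordSum_nonneg (x : X) (v : TangentSpace (𝓡 m) x) : 0 ≤ p.coordSum x v :=
  Finset.sum_nonneg fun _ _ => abs_nonneg _

lemma norm_dAt_coord_le (x : X) (v : TangentSpace (𝓡 m) x) :
    ‖dAt p.coord x v‖ ≤ p.coordSum x v := by
  simp only [coordSum, lin_dcoord]
  exact norm_le_sum_abs (dAt p.coord x v)

/-- The coefficients of a `1`-form in a coordinate patch. -/
def coef (α : TestForm m X 1) (b : Fin m) (x : X) : ℝ :=
  chartRep α.1 x₀ (p.coord x) fun _ => EuclideanSpace.single b (1 : ℝ)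

lemma lin_eq_sum_coef (α : TestForm m X 1) {x : X} (hx : x ∈ closure p.dom)
    (v : TangentSpace (𝓡 m) x) :
    TestForm.lin α x v = ∑ b, dAt p.coord x v b * p.coef α b x := by
  have h1 : TestForm.lin α x v = chartRep α.1 x₀ (p.coord x) fun _ => dAt p.coord x v :=
    p.form_apply α.1 hx fun _ => v
  set L : Euc m →ₗ[ℝ] ℝ := (TestForm.lin α ((extChartAt (𝓡 m) x₀).symm (p.coord x))).comp
    (mfderiv 𝓘(ℝ, Euc m) (𝓡 m) (extChartAt (𝓡 m) x₀).symm (p.coord x)).toLinearMap with hL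
  have h2 : ∀ w : Euc m, (chartRep α.1 x₀ (p.coord x) fun _ => w) = L w := fun w =>
    chartRep_apply α.1 x₀ (p.coord x) fun _ => w
  rw [h1, h2]
  conv_lhs => rw [euclidean_eq_sum (dAt p.coord x v)]
  rw [map_sum]
  refine Finset.sum_congr rfl fun b _ => ?_
  rw [map_smul, smul_eq_mul, coef, h2]

lemma continuousOn_coef (α : TestForm m X 1) (b : Fin m) :
    ContinuousOn (p.coef α b) (closure p.dom) := by
  have h1 : ContinuousOn (fun x => chartRep α.1 x₀ (p.coord x)) (closure p.dom) :=
    (α.2.1 x₀).continuousOn.comp p.contMDiff_coord.continuous.continuousOn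
      fun x hx => p.coord_mem_target hx
  exact continuous_alternatingMap_eval.comp_continuousOn (h1.prodMk continuousOn_const)

lemma exists_lin_le_coordSum (α : TestForm m X 1) :
    ∃ C : ℝ, 0 ≤ C ∧ ∀ x ∈ p.dom, ∀ v : TangentSpace (𝓡 m) x,
      |TestForm.lin α x v| ≤ C * p.coordSum x v := by
  obtain ⟨C, hC, h⟩ := p.exists_lin_le α
  exact ⟨C, hC, fun x hx v => (h x hx v).trans
    (mul_le_mul_of_nonneg_left (p.norm_dAt_coord_le x v) hC)⟩

/-- The `1`-forms supported in a coordinate patch are separable. -/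
lemma exists_countable_dense [SecondCountableTopology X] : ∃ 𝒟 : Set (TestForm m X 1),
    𝒟.Countable ∧ ∀ α : TestForm m X 1, (∀ x ∉ p.dom, α.1 x = 0) → ∀ δ : ℝ, 0 < δ → ∃ β ∈ 𝒟,
      ∀ (x : X) (v : TangentSpace (𝓡 m) x), |TestForm.lin (α - β) x v| ≤ δ * p.coordSum x v := by
  have : CompactSpace (closure p.dom) := isCompact_iff_compactSpace.1 p.isCompact_closure
  -- Forms are recorded by their coefficients on the compact closure of the patch. The space of
  -- continuous functions there is separable, so the image of the forms vanishing off the patch has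
  -- a countable dense subset consisting of such forms.
  set E : TestForm m X 1 → C(closure p.dom, Fin m → ℝ) := fun α =>
    ⟨fun x b => p.coef α b x, continuous_pi fun b => (p.continuousOn_coef α b).domRestrict⟩ with hE
  set D : Set (TestForm m X 1) := {α | ∀ x ∉ p.dom, α.1 x = 0} with hD
  obtain ⟨t, ht, htc, htd⟩ :=
    (TopologicalSpace.IsSeparable.of_separableSpace (E '' D)).exists_countable_dense_subset
  have ht' : ∀ y ∈ t, ∃ α ∈ D, E α = y := fun y hy => ht hy
  choose! g hg hgE using ht'
  refine ⟨g '' t, htc.image g, fun α hα δ hδ => ?_⟩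
  obtain ⟨y, hy, hd⟩ := Metric.mem_closure_iff.1 (htd (mem_image_of_mem E hα)) δ hδ
  refine ⟨g y, mem_image_of_mem g hy, fun x v => ?_⟩
  have e : TestForm.lin (α - g y) x v = TestForm.lin α x v - TestForm.lin (g y) x v := rfl
  rw [e]
  by_cases hx : x ∈ p.dom
  · have hx' := subset_closure hx
    rw [p.lin_eq_sum_coef α hx', p.lin_eq_sum_coef (g y) hx', ← Finset.sum_sub_distrib, coordSum,
      Finset.mul_sum]
    refine (Finset.abs_sum_le_sum_abs _ _).trans (Finset.sum_le_sum fun b _ => ?_)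
    rw [← mul_sub, abs_mul, lin_dcoord, mul_comm]
    refine mul_le_mul_of_nonneg_right ?_ (abs_nonneg _)
    have h1 : dist (E α) (E (g y)) < δ := by rwa [hgE y hy]
    have h2 := (ContinuousMap.dist_apply_le_dist (f := E α) (g := E (g y)) ⟨x, hx'⟩).trans h1.le
    exact (dist_le_pi_dist (E α ⟨x, hx'⟩) (E (g y) ⟨x, hx'⟩) b).trans h2
  · rw [TestForm.lin_eq_zero (hα x hx), TestForm.lin_eq_zero (hg y hy x hx), sub_zero, abs_zero]
    exact mul_nonneg hδ.le (p.coordSum_nonneg x v)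

end ChartPatch

/-- Domination of a `1`-form by coordinate forms. -/
lemma TestForm.exists_lin_le_sum (p : ∀ x : X, ChartPatch m ε x) {s : Set X}
    (hcov : ⋃ x ∈ s, (p x).dom = univ) (α : TestForm m X 1) :
    ∃ (J : Finset X) (C : ℝ), ↑J ⊆ s ∧ 0 ≤ C ∧ ∀ (x : X) (v : TangentSpace (𝓡 m) x),
      |TestForm.lin α x v| ≤ C * ∑ j ∈ J, (p j).coordSum x v := by
  choose C hC h using fun j => (p j).exists_lin_le_coordSum α
  obtain ⟨J, hJs, hJf, hJ⟩ := α.2.2.elim_finite_subcover_image (b := s)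
    (fun j _ => (p j).isOpen_dom) (by rw [hcov]; exact subset_univ _)
  refine ⟨hJf.toFinset, ∑ j ∈ hJf.toFinset, C j, by simpa using hJs,
    Finset.sum_nonneg fun j _ => hC j, fun x v => ?_⟩
  have h0 : 0 ≤ ∑ j ∈ hJf.toFinset, (p j).coordSum x v :=
    Finset.sum_nonneg fun j _ => (p j).coordSum_nonneg x v
  by_cases hx : α.1 x = 0
  · rw [TestForm.lin_eq_zero hx, abs_zero]
    exact mul_nonneg (Finset.sum_nonneg fun j _ => hC j) h0
  · obtain ⟨j, hj, hxj⟩ := mem_iUnion₂.1 (hJ (subset_closure hx))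
    have hj' : j ∈ hJf.toFinset := by simpa using hj
    refine (h j x hxj v).trans (mul_le_mul ?_ ?_ ((p j).coordSum_nonneg x v)
      (Finset.sum_nonneg fun j _ => hC j))
    · exact Finset.single_le_sum (fun i _ => hC i) hj'
    · exact Finset.single_le_sum (fun i _ => (p i).coordSum_nonneg x v) hj'

/-- A functional which vanishes on a dense set of forms and is controlled by the coefficients
vanishes. -/
lemma TestForm.functional_eq_zero [SecondCountableTopology X] (p : ∀ x : X, ChartPatch m ε x)
    {s : Set X} (hcov : ⋃ x ∈ s, (p x).dom = univ) {𝒟 : X → Set (TestForm m X 1)}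
    (h𝒟 : ∀ j, ∀ α : TestForm m X 1, (∀ x ∉ (p j).dom, α.1 x = 0) → ∀ δ : ℝ, 0 < δ → ∃ β ∈ 𝒟 j,
      ∀ (x : X) (v : TangentSpace (𝓡 m) x), |TestForm.lin (α - β) x v| ≤ δ * (p j).coordSum x v)
    (F : TestForm m X 1 →ₗ[ℝ] ℝ) (h0 : ∀ j ∈ s, ∀ β ∈ 𝒟 j, F β = 0)
    (hM : ∀ j ∈ s, ∃ M : ℝ, ∀ δ : ℝ, 0 < δ → ∀ α : TestForm m X 1,
      (∀ (x : X) (v : TangentSpace (𝓡 m) x), |TestForm.lin α x v| ≤ δ * (p j).coordSum x v) →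
        |F α| ≤ M * δ) : F = 0 := by
  have key : ∀ j ∈ s, ∀ α : TestForm m X 1, (∀ x ∉ (p j).dom, α.1 x = 0) → F α = 0 := by
    intro j hj α hα
    obtain ⟨M, hM'⟩ := hM j hj
    have h1 : ∀ δ : ℝ, 0 < δ → |F α| ≤ M * δ := fun δ hδ => by
      obtain ⟨β, hβ, h⟩ := h𝒟 j α hα δ hδ
      have h2 : F (α - β) = F α := (map_sub F α β).trans (by rw [h0 j hj β hβ, sub_zero])
      rw [← h2]
      exact hM' δ hδ _ h
    by_contra hne
    have hpos : 0 < |F α| := abs_pos.2 hne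
    have h2 := h1 (|F α| / (2 * (|M| + 1))) (by positivity)
    have h3 : M * (|F α| / (2 * (|M| + 1))) ≤ |F α| / 2 := by
      rw [mul_div_assoc', div_le_div_iff₀ (by positivity) two_pos]
      nlinarith [le_abs_self M, abs_nonneg M]
    linarith
  ext α
  obtain ⟨J, χ, hχ, -, -, h3, h4⟩ := TestForm.exists_eq_sum_fmul α (fun j : s => (p j).dom)
    (fun j => (p j).isOpen_dom) fun x _ => by
      rw [iUnion_coe_set, hcov]; exact mem_univ x
  rw [h4, map_sum]
  refine Finset.sum_eq_zero fun j _ => key j j.2 _ fun x hx => ?_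
  by_contra hne
  exact hx (h3 j ((TestForm.closure_fmul_subset α (hχ j)) (subset_closure hne)).1)

variable [IsContinuousRiemannianBundle (Euc m) (fun x : X => TangentSpace (𝓡 m) x)]
  [IsRiemannianManifold (𝓡 m) X]

/-- The coordinate differentials are compactly supported, hence bounded on all of `X`. This turns
closeness of coefficients into closeness in comass. -/
lemma ChartPatch.exists_coordSum_le {x₀ : X} (p : ChartPatch m ε x₀) :
    ∃ C : ℝ, 0 ≤ C ∧ ∀ (x : X) (v : TangentSpace (𝓡 m) x), p.coordSum x v ≤ C * ‖v‖ := by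
  have h : ∀ b, ∃ C : ℝ, 0 ≤ C ∧ ∀ (x : X) (v : TangentSpace (𝓡 m) x),
      |TestForm.lin (p.dcoord b) x v| ≤ C * ‖v‖ := by
    intro b
    obtain ⟨C, hC, h⟩ := exists_dAt_le_of_isCompact (p.contMDiff_coord_apply b) (p.dcoord b).2.2
    refine ⟨C, C.coe_nonneg, fun x v => ?_⟩
    by_cases hx : (p.dcoord b).1 x = 0
    · rw [TestForm.lin_eq_zero hx, abs_zero]
      positivity
    · have h1 := h x (subset_closure hx) v
      rwa [p.dAt_coord_apply, ← p.lin_dcoord] at h1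
  choose C hC h using h
  refine ⟨∑ b, C b, Finset.sum_nonneg fun b _ => hC b, fun x v => ?_⟩
  rw [coordSum, Finset.sum_mul]
  exact Finset.sum_le_sum fun b _ => h b x v

end Separability

lemma locallyIntegrable_of_forall_mul {F : ℝ → ℝ} (h : ∀ ψ : ℝ → ℝ, Continuous ψ →
    HasCompactSupport ψ → Integrable fun t => ψ t * F t) : LocallyIntegrable F := by
  rw [locallyIntegrable_iff]
  intro K hK
  obtain ⟨ψ, h1, -, h2, -⟩ := exists_continuous_one_zero_of_isCompact hK isClosed_empty
    (disjoint_empty K)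
  refine ((h ψ ψ.continuous h2).integrableOn (s := K)).congr ?_
  filter_upwards [ae_restrict_mem hK.measurableSet] with t ht
  rw [h1 ht]
  simp

/-! ### Almost every slice is rectifiable -/

section Slices

variable {m : ℕ} {X : Type*} [EMetricSpace X] [ChartedSpace (Euc m) X] [IsManifold (𝓡 m) ∞ X]
  [RiemannianBundle (fun x : X => TangentSpace (𝓡 m) x)]
  [IsContinuousRiemannianBundle (Euc m) (fun x : X => TangentSpace (𝓡 m) x)]
  [IsRiemannianManifold (𝓡 m) X] [SecondCountableTopology X]

namespace SliceData

variable {τ : X → ℝ} {S : Set (Euc 2)} {f : Euc 2 → X} {θ : Euc 2 → ℤ}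
  (σ : SliceData (m := m) τ S f θ)

/-- The density of a slice. -/
def push (t : ℝ) (α : TestForm m X 1) : Euc 1 → ℝ :=
  pushDensity (σ.dom t) (σ.map t) (fun _ => σ.mult) α

lemma aestronglyMeasurable_push (t : ℝ) (α : TestForm m X 1) :
    AEStronglyMeasurable (σ.push t α) (volume.restrict (σ.dom t)) := by
  obtain ⟨c, hc⟩ := σ.lipschitz t
  exact (aestronglyMeasurable_form_pAt (σ.measurableSet_dom t) hc α _).const_mul _

lemma abs_push_le {t : ℝ} {α : TestForm m X 1} {ι : Type*} {J : Finset ι} {β : ι → TestForm m X 1}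
    {C : ℝ} (h : ∀ (x : X) (v : TangentSpace (𝓡 m) x),
      |TestForm.lin α x v| ≤ C * ∑ j ∈ J, |TestForm.lin (β j) x v|) (s : Euc 1) :
    |σ.push t α s| ≤ C * ∑ j ∈ J, |σ.push t (β j) s| := by
  simp only [push, pushDensity_one, abs_mul, ← Finset.mul_sum]
  rw [mul_left_comm]
  exact mul_le_mul_of_nonneg_left (h _ _) (abs_nonneg _)

end SliceData

variable [MeasurableSpace X] [BorelSpace X] {P : RectParam m X 2} {τ : X → ℝ}
  (σ : ∀ q, SliceData (m := m) τ (P.dom q) (P.map q) (P.mult q))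

/-- The slices of each piece have `L¹` norms, integrated over `t`, bounded by the integral of the
wedge density; these bounds are summable over the pieces, so sums and integrals can be exchanged.
The exceptional null set depends on `α`. -/
lemma ae_summable_slices (hτ : LipschitzWith 1 τ) (α : TestForm m X 1) :
    (∀ᵐ t, (∀ q, IntegrableOn ((σ q).push t α) ((σ q).dom t)) ∧
      Summable fun q => ∫ s in (σ q).dom t, |(σ q).push t α s|) ∧
    Integrable (fun t => ∑' q, ∫ s in (σ q).dom t, (σ q).push t α s) ∧
    ∀ ψ : ℝ → ℝ, Continuous ψ → HasCompactSupport ψ →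
      ∑' q, ∫ u in P.dom q, ψ (τ (P.map q u)) *
        wedgeDensity (τ ∘ P.map q) (P.dom q) (P.map q) (P.mult q) α u =
      ∫ t, ψ t * ∑' q, ∫ s in (σ q).dom t, (σ q).push t α s := by
  have := P.countable_index
  choose h1 h2 h3 h4 h5 using fun q => (σ q).spec α (P.integrableOn_wedgeDensity hτ α q)
  have hs : Summable fun q => ∫ t, ∫ s in (σ q).dom t, |(σ q).push t α s| :=
    Summable.of_nonneg_of_le (fun q => integral_nonneg fun t => integral_nonneg fun s => abs_nonneg _)
      h3 (P.summable_wedgeDensity hτ α)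
  have habs : ∀ q t, ‖∫ s in (σ q).dom t, |(σ q).push t α s|‖ =
      ∫ s in (σ q).dom t, |(σ q).push t α s| := fun q t =>
    Real.norm_of_nonneg (integral_nonneg fun s => abs_nonneg _)
  have hle : ∀ q t, ‖∫ s in (σ q).dom t, (σ q).push t α s‖ ≤
      ∫ s in (σ q).dom t, |(σ q).push t α s| := fun q t => norm_integral_le_integral_norm _
  have hs' : Summable fun q => ∫ t, ‖∫ s in (σ q).dom t, (σ q).push t α s‖ :=
    Summable.of_nonneg_of_le (fun q => integral_nonneg fun t => norm_nonneg _)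
      (fun q => integral_mono (h4 q).norm (h2 q) (hle q)) hs
  refine ⟨?_, (integrable_tsum_of_summable h4 hs').2, fun ψ hψ hc => ?_⟩
  · have h6 := (integrable_tsum_of_summable h2 (by
      refine hs.congr fun q => ?_
      exact integral_congr_ae (Filter.Eventually.of_forall fun t => (habs q t).symm))).1
    filter_upwards [ae_all_iff.2 h1, h6] with t h7 h8
    exact ⟨h7, h8.congr fun q => habs q t⟩
  · obtain ⟨C, hC⟩ := hc.exists_bound_of_continuous hψ
    have h6 : ∀ q, Integrable fun t => ψ t * ∫ s in (σ q).dom t, (σ q).push t α s := fun q =>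
      (h4 q).bdd_mul hψ.aestronglyMeasurable (Filter.Eventually.of_forall hC)
    have h7 : Summable fun q => ∫ t, ‖ψ t * ∫ s in (σ q).dom t, (σ q).push t α s‖ := by
      refine Summable.of_nonneg_of_le (fun q => integral_nonneg fun t => norm_nonneg _)
        (fun q => ?_) (hs'.mul_left C)
      rw [← integral_const_mul]
      refine integral_mono (h6 q).norm ((h4 q).norm.const_mul C) fun t => ?_
      simp only [norm_mul]
      exact mul_le_mul_of_nonneg_right (hC t) (norm_nonneg _)
    have h8 := hasSum_integral_of_summable_integral_norm h6 h7
    simp only [tsum_mul_left] at h8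
    rw [← h8.tsum_eq]
    exact tsum_congr fun q => h5 q ψ hψ hc

/-- The right-hand side is minus that of the slicing identity with `Ψ = upperPrimitive ψ` and `c₀ =
∫ ψ`. -/
lemma integral_mul_slice (P : RectParam m X 2) (hτ : Continuous τ) {ψ : ℝ → ℝ} (hψ : Continuous ψ)
    (hc : HasCompactSupport ψ) (α : TestForm m X 1) :
    Integrable (fun t => ψ t * P.slice τ t α) ∧ ∫ t, ψ t * P.slice τ t α =
      P.pair (fun x => upperPrimitive ψ (τ x)) (TestForm.d 1 α) -
        (∫ t, ψ t) * P.toCurrent.boundary α := by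
  obtain ⟨h1, h2⟩ := P.integral_mul_pair_sublevel hτ hψ hc (TestForm.d 1 α)
  have h3 : Integrable fun t => ψ t * P.toCurrent.boundary α :=
    (hψ.integrable_of_hasCompactSupport hc).mul_const _
  simp only [RectParam.slice, mul_sub]
  exact ⟨h1.sub h3, by rw [integral_sub h1 h3, h2, integral_mul_const]⟩

/-- Both sides are locally integrable in `t` and, by the slicing identity, have the same integral
against every smooth `ψ` with compact support in `(0, ∞)`. -/
lemma ae_slice_eq (hP : P.IsTame) (hτ : LipschitzWith 1 τ)
    (hsupp : P.toCurrent.boundary.support ⊆ {x | τ x ≤ 0}) (α : TestForm m X 1) :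
    ∀ᵐ t, 0 < t → ∑' q, ∫ s in (σ q).dom t, (σ q).push t α s = P.slice τ t α := by
  obtain ⟨-, h2, h3⟩ := ae_summable_slices σ hτ α
  have hsl : LocallyIntegrable fun t => P.slice τ t α :=
    locallyIntegrable_of_forall_mul fun ψ hψ hc => (integral_mul_slice P hτ.continuous hψ hc α).1
  have h4 := isOpen_Ioi.ae_eq_zero_of_integral_contDiff_smul_eq_zero (U := Ioi (0 : ℝ))
    (f := fun t => ∑' q, (∫ s in (σ q).dom t, (σ q).push t α s) - P.slice τ t α) (μ := volume)
    ((h2.locallyIntegrable.sub hsl).locallyIntegrableOn _) fun ψ hψ hc hs => ?_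
  · filter_upwards [h4] with t ht ht0
    exact sub_eq_zero.1 (ht ht0)
  -- The support of `ψ` stays away from `0`, so the primitive is constant on `(-∞, r]`, as the
  -- slicing identity requires near the support of the boundary.
  obtain ⟨r, hr, hr0⟩ : ∃ r > 0, ∀ t ≤ r, ψ t = 0 := by
    have h5 : (tsupport ψ)ᶜ ∈ 𝓝 (0 : ℝ) :=
      (isClosed_tsupport ψ).isOpen_compl.mem_nhds fun h => lt_irrefl (0 : ℝ) (hs h)
    obtain ⟨r, hr, hball⟩ := Metric.mem_nhds_iff.1 h5
    refine ⟨r / 2, half_pos hr, fun t ht => ?_⟩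
    by_contra hne
    have h6 : t ∈ tsupport ψ := subset_tsupport ψ hne
    have h7 : 0 < t := hs h6
    exact hball (by rw [Metric.mem_ball, dist_zero_right, Real.norm_of_nonneg h7.le]; linarith) h6
  have hψc := hψ.continuous
  obtain ⟨C, hC⟩ := hc.exists_bound_of_continuous hψc
  have h8 := hP.tsum_integral_wedgeDensity hτ hsupp (contDiff_upperPrimitive hψ hc)
    (abs_upperPrimitive_le hψc hc) hr (c₀ := ∫ t, ψ t)
    (fun s hs => upperPrimitive_eq_integral fun t ht => hr0 t (ht.trans hs)) (κ := C.toNNReal)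
    (fun t => by
      rw [deriv_upperPrimitive hψc hc, abs_neg]
      exact (hC t).trans (Real.le_coe_toNNReal C)) α
  obtain ⟨h9, h10⟩ := integral_mul_slice P hτ.continuous hψc hc α
  have h11 : Integrable fun t => ψ t * ∑' q, ∫ s in (σ q).dom t, (σ q).push t α s :=
    h2.bdd_mul hψc.aestronglyMeasurable (Filter.Eventually.of_forall hC)
  simp only [smul_eq_mul, mul_sub]
  rw [integral_sub h11 h9, ← h3 ψ hψc hc, h10, sub_eq_zero, ← neg_inj, ← tsum_neg, neg_sub, ← h8]
  refine tsum_congr fun q => ?_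
  rw [← integral_neg]
  simp only [deriv_upperPrimitive hψc hc, neg_mul]

/-- The slices at `t` are integrable and summable on a form. -/
def SlicesConverge (t : ℝ) (α : TestForm m X 1) : Prop :=
  (∀ q, IntegrableOn ((σ q).push t α) ((σ q).dom t)) ∧
    Summable fun q => ∫ s in (σ q).dom t, |(σ q).push t α s|

variable {σ}

/-- Every form is dominated by finitely many coordinate differentials taken from countably many
patches, so convergence for these at a given `t` yields convergence for all forms at that `t`. -/
lemma SlicesConverge.of_dominated {t : ℝ} {α : TestForm m X 1} {ι : Type*} {J : Finset ι}
    {β : ι → TestForm m X 1} {C : ℝ} (hβ : ∀ j ∈ J, SlicesConverge σ t (β j))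
    (h : ∀ (x : X) (v : TangentSpace (𝓡 m) x),
      |TestForm.lin α x v| ≤ C * ∑ j ∈ J, |TestForm.lin (β j) x v|) :
    SlicesConverge σ t α ∧ ∑' q, ∫ s in (σ q).dom t, |(σ q).push t α s| ≤
      C * ∑ j ∈ J, ∑' q, ∫ s in (σ q).dom t, |(σ q).push t (β j) s| := by
  have h1 : ∀ q, IntegrableOn (fun s => C * ∑ j ∈ J, |(σ q).push t (β j) s|) ((σ q).dom t) :=
    fun q => (integrable_finsetSum _ fun j hj => ((hβ j hj).1 q).abs).const_mul _
  have h2 : ∀ q, IntegrableOn ((σ q).push t α) ((σ q).dom t) := fun q =>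
    (h1 q).mono' ((σ q).aestronglyMeasurable_push t α)
      (Filter.Eventually.of_forall fun s => (σ q).abs_push_le h s)
  have h3 : ∀ q, ∫ s in (σ q).dom t, |(σ q).push t α s| ≤
      C * ∑ j ∈ J, ∫ s in (σ q).dom t, |(σ q).push t (β j) s| := fun q => by
    rw [← integral_finsetSum _ fun j hj => ((hβ j hj).1 q).abs, ← integral_const_mul]
    exact integral_mono (h2 q).abs (h1 q) fun s => (σ q).abs_push_le h s
  have h4 : Summable fun q => C * ∑ j ∈ J, ∫ s in (σ q).dom t, |(σ q).push t (β j) s| :=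
    (summable_sum fun j hj => (hβ j hj).2).mul_left C
  have h5 := Summable.of_nonneg_of_le (fun q => integral_nonneg fun s => abs_nonneg _) h3 h4
  refine ⟨⟨h2, h5⟩, (h5.tsum_le_tsum h3 h4).trans ?_⟩
  rw [tsum_mul_left, Summable.tsum_finsetSum fun j hj => (hβ j hj).2]

/-- The slice at `t` as a parametrized current. -/
def sliceParam {t : ℝ} (h : ∀ α, SlicesConverge σ t α) : RectParam m X 1 where
  index := P.index
  countable_index := P.countable_index
  dom q := (σ q).dom t
  map q := (σ q).map t
  mult q _ := (σ q).mult
  measurableSet_dom q := (σ q).measurableSet_dom t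
  lipschitz q := (σ q).lipschitz t
  measurable_mult _ := measurable_const
  integrable α q := (h α).1 q
  summable α := (h α).2

lemma abs_sliceParam_le {t : ℝ} (h : ∀ α, SlicesConverge σ t α) (α : TestForm m X 1) :
    |(sliceParam h).toCurrent α| ≤ ∑' q, ∫ s in (σ q).dom t, |(σ q).push t α s| := by
  have h1 : ∀ q, ‖∫ s in (σ q).dom t, (σ q).push t α s‖ ≤
      ∫ s in (σ q).dom t, |(σ q).push t α s| := fun q => norm_integral_le_integral_norm _
  exact tsum_of_norm_bounded (h α).2.hasSum h1

/-- Almost all slices of a rectifiable current by the level sets of a Lipschitz function are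
rectifiable. -/
lemma RectParam.ae_exists_slice (P : RectParam m X 2) (hfin : P.toCurrent.mass < ⊤)
    (hτ : LipschitzWith 1 τ) (hsupp : P.toCurrent.boundary.support ⊆ {x | τ x ≤ 0}) :
    ∀ᵐ t, 0 < t → ∃ S : RectParam m X 1, ∀ α, S.toCurrent α = P.slice τ t α := by
  obtain ⟨P', hP', hσ, hc, hpair⟩ := P.exists_sliceable hτ
  have hsl : ∀ t α, P'.slice τ t α = P.slice τ t α := fun t α => by
    rw [slice, slice, hc, hpair _ 1 (measurable_one.indicator (measurableSet_sublevel hτ.continuous t))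
      fun x => ?_]
    by_cases hx : x ∈ {x | τ x < t}
    · simp [indicator_of_mem hx]
    · simp [indicator_of_notMem hx]
  have σ := fun q => (hσ q).some
  have p : ∀ x : X, ChartPatch m 1 x := fun x => (nonempty_chartPatch one_pos x).some
  obtain ⟨s, hs, hcov⟩ := exists_countable_cover_chartPatch p
  choose 𝒟 h𝒟c h𝒟 using fun j => (p j).exists_countable_dense
  have hm := (monotone_sublevelMass P hfin hτ.continuous).ae_differentiableAt
  have h1 : ∀ᵐ t, ∀ j ∈ s, ∀ b, SlicesConverge σ t ((p j).dcoord b) :=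
    (ae_ball_iff hs).2 fun j _ => ae_all_iff.2 fun b => (ae_summable_slices σ hτ _).1
  -- Only countably many forms are used, so one null set of `t` suffices for all of them.
  have h2 : ∀ᵐ t, ∀ j ∈ s, ∀ β ∈ 𝒟 j, 0 < t →
      ∑' q, ∫ s in (σ q).dom t, (σ q).push t β s = P'.slice τ t β :=
    (ae_ball_iff hs).2 fun j _ => (ae_ball_iff (h𝒟c j)).2 fun β _ =>
      ae_slice_eq σ hP' hτ (by rwa [hc]) β
  filter_upwards [h1, h2, hm] with t ht1 ht2 ht3 ht0
  have hall : ∀ α, SlicesConverge σ t α := fun α => by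
    obtain ⟨J, C, hJ, -, h⟩ := TestForm.exists_lin_le_sum p hcov α
    refine (SlicesConverge.of_dominated (J := J ×ˢ (Finset.univ : Finset (Fin m)))
      (β := fun j => (p j.1).dcoord j.2) (C := C) (fun j hj => ?_) fun x v => ?_).1
    · exact ht1 j.1 (hJ (Finset.mem_product.1 hj).1) j.2
    · rw [Finset.sum_product]
      exact h x v
  refine ⟨sliceParam hall, fun α => ?_⟩
  set T : Current m X 1 :=
    (P.restrict {x | τ x < t} (measurableSet_sublevel hτ.continuous t)).toCurrent.boundary -
      P.toCurrent.boundary with hT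
  have hTα : ∀ α, T α = P.slice τ t α := fun α => by
    rw [slice, P.pair_sublevel_eq hτ.continuous]; rfl
  have hF := TestForm.functional_eq_zero p hcov h𝒟 ((sliceParam hall).toCurrent - T)
    (fun j hj β hβ => ?_) fun j hj => ?_
  · have := LinearMap.congr_fun hF α
    rw [← hTα]
    exact sub_eq_zero.1 this
  · have e : (sliceParam hall).toCurrent β = T β :=
      (ht2 j hj β hβ ht0).trans ((hsl t β).trans (hTα β).symm)
    exact sub_eq_zero.2 e
  · obtain ⟨C, hC, hCle⟩ := (p j).exists_coordSum_le
    set N := ∑ b, ∑' q, ∫ s in (σ q).dom t, |(σ q).push t ((p j).dcoord b) s| with hN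
    -- A form with coefficients at most `δ` has value at most `δ N` on the parametrized slice by
    -- domination. It has comass at most `δ (C + 1)`, so on `T` the mass bound for slices applies.
    -- The difference is therefore continuous in the coefficients, and it vanishes on the dense
    -- family.
    refine ⟨N + (C + 1) * deriv (P.sublevelMass τ hτ.continuous) t, fun δ hδ α hα => ?_⟩
    have hA : |(sliceParam hall).toCurrent α| ≤ δ * N :=
      (abs_sliceParam_le hall α).trans
        (SlicesConverge.of_dominated (fun b _ => ht1 j hj b) hα).2
    have hc0 : 0 < δ * (C + 1) := by positivity
    have hco : ComassLE ((δ * (C + 1))⁻¹ • α) 1 := fun x v hv => by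
      have e : ((δ * (C + 1))⁻¹ • α).1 x v = (δ * (C + 1))⁻¹ * TestForm.lin α x (v 0) := by
        rw [← TestForm.apply_eq_lin]; rfl
      rw [e, abs_mul, abs_of_pos (inv_pos.2 hc0), inv_mul_le_iff₀ hc0, mul_one]
      refine (hα x (v 0)).trans (mul_le_mul_of_nonneg_left ?_ hδ.le)
      refine (hCle x (v 0)).trans ?_
      nlinarith [hv 0, norm_nonneg (v 0)]
    have hB := P.abs_slice_le hfin hτ hsupp ht0 ht3.hasDerivAt hco
    rw [← hTα, map_smul, smul_eq_mul, abs_mul, abs_of_pos (inv_pos.2 hc0), inv_mul_le_iff₀ hc0] at hB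
    have e : ((sliceParam hall).toCurrent - T) α = (sliceParam hall).toCurrent α - T α := rfl
    rw [e]
    refine (abs_sub _ _).trans ?_
    linarith

end Slices

/-! ### Integrating the differential inequality -/

/-- A differential inequality for monotone functions. -/
lemma ofReal_mul_exp_lintegral_le {f : ℝ → ℝ} (hf : Monotone f) {a b : ℝ} (hab : a < b)
    (ha : 0 ≤ f a) {φ : ℝ → ℝ≥0} {Q : ℝ≥0} (hQ : 0 < Q)
    (h : ∀ᵐ r, r ∈ Ioo a b → f r ≤ Q * φ r * deriv f r) :
    ENNReal.ofReal (f a) *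
        EReal.exp (((Q : ℝ≥0∞)⁻¹ * ∫⁻ r in Ioo a b, (φ r : ℝ≥0∞)⁻¹ : ℝ≥0∞) : EReal) ≤
      ENNReal.ofReal (f b) := by
  -- If `f a = 0`, the left side is zero even for an infinite exponential; otherwise `f` is positive
  -- on `[a, b]` and has a logarithm.
  rcases ha.eq_or_lt with h0 | h0
  · rw [← h0, ENNReal.ofReal_zero, zero_mul]
    exact zero_le
  set g : ℝ → ℝ := fun r => Real.log (f r) with hg
  have hpos : ∀ r, a ≤ r → 0 < f r := fun r hr => h0.trans_le (hf hr)
  have hgm : MonotoneOn g (uIcc a b) := fun x hx y _ hxy => by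
    rw [uIcc_of_le hab.le] at hx
    exact Real.log_le_log (hpos x hx.1) (hf hxy)
  have hgi : IntegrableOn (deriv g) (Ioo a b) :=
    ((intervalIntegrable_iff_integrableOn_Ioc_of_le hab.le).1
      hgm.intervalIntegrable_deriv).mono_set Ioo_subset_Ioc_self
  -- Only an inequality holds, since a monotone function may have jumps or a singular part; it is in
  -- the useful direction.
  have hgI : ∫ r in Ioo a b, deriv g r ≤ g b - g a := by
    have h1 := hgm.intervalIntegral_deriv_mem_uIcc
    have h2 : g a ≤ g b := hgm left_mem_uIcc right_mem_uIcc hab.le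
    rw [uIcc_of_le (sub_nonneg.2 h2), intervalIntegral.integral_of_le hab.le,
      integral_Ioc_eq_integral_Ioo] at h1
    exact h1.2
  have hae : ∀ᵐ r ∂(volume.restrict (Ioo a b)), 0 ≤ deriv g r ∧
      (Q : ℝ≥0∞)⁻¹ * (φ r : ℝ≥0∞)⁻¹ ≤ ENNReal.ofReal (deriv g r) := by
    rw [ae_restrict_iff' measurableSet_Ioo]
    filter_upwards [h, hf.ae_differentiableAt] with r h1 h2 hr
    have h3 := h1 hr
    have h4 := hpos r hr.1.le
    have h5 : deriv g r = deriv f r / f r := deriv.log h2 h4.ne'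
    have h6 : 0 ≤ deriv f r := hf.deriv_nonneg
    -- As `f r > 0`, the inequality excludes `φ r = 0` at almost every `r`.
    have h7 : 0 < (Q : ℝ) * φ r := by
      by_contra hn
      have : (Q : ℝ) * φ r * deriv f r ≤ 0 := mul_nonpos_of_nonpos_of_nonneg (not_lt.1 hn) h6
      linarith
    refine ⟨by rw [h5]; positivity, ?_⟩
    have h8 : (Q : ℝ≥0∞)⁻¹ * (φ r : ℝ≥0∞)⁻¹ = ENNReal.ofReal ((Q : ℝ) * φ r)⁻¹ := by
      rw [← ENNReal.mul_inv (Or.inr ENNReal.coe_ne_top) (Or.inl ENNReal.coe_ne_top),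
        ENNReal.ofReal_inv_of_pos h7, ← ENNReal.coe_mul, ← NNReal.coe_mul, ENNReal.ofReal_coe_nnreal]
    rw [h8, h5]
    refine ENNReal.ofReal_le_ofReal ?_
    rw [inv_eq_one_div, div_le_div_iff₀ h7 h4]
    linarith
  have hQt : (Q : ℝ≥0∞)⁻¹ ≠ ⊤ := ENNReal.inv_ne_top.2 (ENNReal.coe_ne_zero.2 hQ.ne')
  have hle : (Q : ℝ≥0∞)⁻¹ * ∫⁻ r in Ioo a b, (φ r : ℝ≥0∞)⁻¹ ≤ ENNReal.ofReal (g b - g a) := by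
    rw [← lintegral_const_mul' _ _ hQt]
    refine (lintegral_mono_ae (hae.mono fun r hr => hr.2)).trans ?_
    rw [← ofReal_integral_eq_lintegral_ofReal hgi (hae.mono fun r hr => hr.1)]
    exact ENNReal.ofReal_le_ofReal hgI
  have hb0 := hpos b hab.le
  have hgab : 0 ≤ g b - g a := sub_nonneg.2 (hgm left_mem_uIcc right_mem_uIcc hab.le)
  calc ENNReal.ofReal (f a) *
        EReal.exp (((Q : ℝ≥0∞)⁻¹ * ∫⁻ r in Ioo a b, (φ r : ℝ≥0∞)⁻¹ : ℝ≥0∞) : EReal)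
      ≤ ENNReal.ofReal (f a) * EReal.exp ((ENNReal.ofReal (g b - g a) : ℝ≥0∞) : EReal) := by
        gcongr
        exact EReal.coe_ennreal_le_coe_ennreal_iff.2 hle
    _ = ENNReal.ofReal (f b) := by
        rw [EReal.coe_ennreal_ofReal, max_eq_left hgab, EReal.exp_coe, ← ENNReal.ofReal_mul ha,
          Real.exp_sub, Real.exp_log hb0, Real.exp_log h0, mul_div_cancel₀ _ h0.ne']

/-! ### The truncated distance -/

section TruncatedDistance

variable {X : Type*} [EMetricSpace X] (L : Set X) (c : ℝ)

/-- The truncation of the distance to a set. -/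
def truncDist (x : X) : ℝ := (min (Metric.infEDist x L) (ENNReal.ofReal c)).toReal

/-- Truncation gives a real-valued function even where the distance to `L` is infinite. Points at
infinite distance from each other impose no condition; otherwise the triangle inequality survives
the truncation. -/
lemma lipschitzWith_truncDist : LipschitzWith 1 (truncDist L c) := by
  have hne : ∀ x, min (Metric.infEDist x L) (ENNReal.ofReal c) ≠ ⊤ := fun x =>
    ((min_le_right _ _).trans_lt ENNReal.ofReal_lt_top).ne
  have key : ∀ x y, edist x y ≠ ⊤ → truncDist L c x ≤ truncDist L c y + (edist x y).toReal := by
    intro x y hxy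
    rw [truncDist, truncDist, ← ENNReal.toReal_add (hne y) hxy]
    refine ENNReal.toReal_mono (ENNReal.add_ne_top.2 ⟨hne y, hxy⟩) ?_
    rw [min_add]
    exact min_le_min Metric.infEDist_le_infEDist_add_edist le_self_add
  intro x y
  rw [ENNReal.coe_one, one_mul]
  by_cases hxy : edist x y = ⊤
  · rw [hxy]; exact le_top
  have h1 := key x y hxy
  have h2 := key y x (by rwa [edist_comm])
  rw [edist_comm y x] at h2
  rw [edist_dist, Real.dist_eq, ← ENNReal.ofReal_toReal hxy]
  exact ENNReal.ofReal_le_ofReal (abs_sub_le_iff.2 ⟨by linarith, by linarith⟩)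

lemma setOf_truncDist_lt {r : ℝ} (hr : r ≤ c) :
    {x | truncDist L c x < r} = nhd L (ENNReal.ofReal r) := by
  ext x
  have hne : min (Metric.infEDist x L) (ENNReal.ofReal c) ≠ ⊤ :=
    ((min_le_right _ _).trans_lt ENNReal.ofReal_lt_top).ne
  simp only [nhd, mem_ofPred_eq, truncDist]
  rw [← ENNReal.lt_ofReal_iff_toReal_lt hne, min_lt_iff,
    or_iff_left (not_lt.2 (ENNReal.ofReal_le_ofReal hr))]

lemma truncDist_of_mem {x : X} (hx : x ∈ L) : truncDist L c x = 0 := by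
  simp [truncDist, Metric.infEDist_zero_of_mem hx]

end TruncatedDistance

/-! ### Supports of boundaries and restrictions -/

section Supports

variable {m n : ℕ} {X : Type*} [EMetricSpace X] [ChartedSpace (Euc m) X] [IsManifold (𝓡 m) ∞ X]

lemma Current.support_boundary_subset (T : Current m X (n + 1)) : T.boundary.support ⊆ T.support := by
  intro x hx U hU hxU
  obtain ⟨α, hα, h⟩ := hx U hU hxU
  exact ⟨TestForm.d n α, (closure_minimal (extD_support α.1) isClosed_closure).trans hα, h⟩

/-- A form supported in `{r < τ}` pairs to zero with the restriction. Only the closed sublevel set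
is obtained, so slices at `r` are later filled at a radius `r' > r`. -/
lemma RectParam.support_restrict_subset [SecondCountableTopology X] [MeasurableSpace X] [BorelSpace X]
    (P : RectParam m X n) {τ : X → ℝ} (hτ : Continuous τ) (r : ℝ) :
    (P.restrict {x | τ x < r} (measurableSet_sublevel hτ r)).toCurrent.support ⊆ {x | τ x ≤ r} := by
  intro x hx
  by_contra hcon
  obtain ⟨α, hα, h⟩ := hx {y | r < τ y} (isOpen_lt continuous_const hτ)
    (show r < τ x from not_le.1 hcon)
  refine h ?_
  rw [P.toCurrent_restrict]
  have h1 : ∀ i u, ({x | τ x < r}.indicator (1 : X → ℝ) (P.map i u)) *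
      pushDensity (P.dom i) (P.map i) (P.mult i) α u = 0 := by
    intro i u
    by_cases h0 : α.1 (P.map i u) = 0
    · rw [pushDensity_eq_zero h0, mul_zero]
    · have h2 : r < τ (P.map i u) := hα (subset_closure h0)
      rw [indicator_of_notMem (show P.map i u ∉ {x | τ x < r} from not_lt.2 h2.le), zero_mul]
  simp [pair, h1]

end Supports

/-! ### Comparison with fillings of slices -/

section Comparison

variable {m : ℕ} {X : Type*} [EMetricSpace X] [ChartedSpace (Euc m) X] [IsManifold (𝓡 m) ∞ X]
  [RiemannianBundle (fun x : X => TangentSpace (𝓡 m) x)]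

lemma homologyClass_eq_iff {A : Set X} {γ γ' : Current m X 1} (hγ : γ ∈ oneCycles m A)
    (hγ' : γ' ∈ oneCycles m A) :
    homologyClass γ hγ = homologyClass γ' hγ' ↔ γ' - γ ∈ boundaries m 1 A := by
  rw [homologyClass, homologyClass, QuotientAddGroup.eq, AddSubgroup.mem_addSubgroupOf]
  change -γ + γ' ∈ _ ↔ _
  rw [neg_add_eq_sub]

/-- The homology class of a cycle which is homologous to a cycle in `L` is determined by the
retraction `η`. -/
lemma sub_mem_boundaries {L U : Set X} (hLU : L ⊆ U) {η : H₁ m U →+ H₁ m L}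
    (hη : ∀ c, η (inclusionMap hLU c) = c) {γ γ' δ : Current m X 1} (hγ : γ ∈ oneCycles m U)
    (hγ' : γ' ∈ oneCycles m L) (hδ : δ ∈ oneCycles m L)
    (h : homologyClass γ' hγ' = η (homologyClass γ hγ)) (hb : γ - δ ∈ boundaries m 1 U) :
    γ' - δ ∈ boundaries m 1 L := by
  have h1 : homologyClass δ (oneCycles_mono hLU hδ) = homologyClass γ hγ :=
    (homologyClass_eq_iff _ _).2 hb
  have h2 : inclusionMap hLU (homologyClass δ hδ) = homologyClass δ (oneCycles_mono hLU hδ) := rfl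
  rw [← homologyClass_eq_iff hδ hγ', h, ← h1, ← h2, hη]

variable [SecondCountableTopology X] [MeasurableSpace X] [BorelSpace X]
  [IsContinuousRiemannianBundle (Euc m) (fun x : X => TangentSpace (𝓡 m) x)]
  [IsRiemannianManifold (𝓡 m) X]

/-- The comparison of the restriction of a quasiminimizing current with the fillings of its
slices. -/
lemma IsQuasiminimizing.sublevelMass_le {L : Set X} {R : ℝ≥0∞} {hR : 0 < R} {φ : ℝ → ℝ≥0}
    (hφ : IsRelativeFillingFunction m L hR φ) {Q : ℝ≥0} {C : Current m X 2}
    (hC : IsQuasiminimizing L Q C) {b : ℝ} (hb : ENNReal.ofReal b < R) {P : RectParam m X 2}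
    (hP : P.toCurrent = C)
    (hPr : ∀ B (hB : MeasurableSet B), C.restrict B = (P.restrict B hB).toCurrent) {r r' f' : ℝ}
    (hr : 0 < r) (hrr' : r < r') (hr' : r' ≤ b)
    (hf : HasDerivAt (P.sublevelMass (truncDist L b) (lipschitzWith_truncDist L b).continuous) f' r)
    {S : RectParam m X 1} (hS : ∀ α, S.toCurrent α = P.slice (truncDist L b) r α) :
    P.sublevelMass (truncDist L b) (lipschitzWith_truncDist L b).continuous r ≤ Q * φ r' * f' := by
  set τ := truncDist L b with hτdef
  have hτ : LipschitzWith 1 τ := lipschitzWith_truncDist L b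
  have hτc := hτ.continuous
  obtain ⟨hC1, hC2, hC3, hC4⟩ := hC
  have hfin : P.toCurrent.mass < ⊤ := by rw [hP]; exact hC1.2
  have hLτ : L ⊆ {x | τ x ≤ 0} := fun x hx => (truncDist_of_mem L b hx).le
  have hsupp : P.toCurrent.boundary.support ⊆ {x | τ x ≤ 0} := by rw [hP]; exact hC3.trans hLτ
  obtain ⟨η, hη, hfill⟩ := hφ
  have hrR : ENNReal.ofReal r' < R := (ENNReal.ofReal_le_ofReal hr').trans_lt hb
  have hm := measurableSet_sublevel hτc r
  set Cr : Current m X 2 := (P.restrict {x | τ x < r} hm).toCurrent with hCr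
  have hCrfin : Cr.mass < ⊤ := (P.mass_restrict_sublevel_le hτc r).trans_lt hfin
  have hCrR : Cr.IsRectifiable := ⟨⟨_, rfl⟩, hCrfin⟩
  have hCrr : C.restrict {x | τ x < r} = Cr := hPr _ hm
  have hsub : {x | τ x ≤ r} ⊆ nhd L (ENNReal.ofReal r') := by
    rw [← setOf_truncDist_lt L b hr']
    exact fun x hx => lt_of_le_of_lt hx hrr'
  have hCrs : Cr.support ⊆ nhd L (ENNReal.ofReal r') :=
    (P.support_restrict_subset hτc r).trans hsub
  set T : Current m X 1 := S.toCurrent with hT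
  have hTeq : T = Cr.boundary - C.boundary := by
    ext α
    rw [hS, RectParam.slice, P.pair_sublevel_eq hτc, hP]
    rfl
  have hf0 : 0 ≤ f' := by
    rw [← hf.deriv]
    exact (RectParam.monotone_sublevelMass P hfin hτc).deriv_nonneg
  have hTm : T.mass ≤ ENNReal.ofReal f' := by
    refine iSup₂_le fun α hα => ENNReal.ofReal_le_ofReal ?_
    rw [hS]
    exact (le_abs_self _).trans (P.abs_slice_le hfin hτ hsupp hr hf hα)
  have hTcyc : T ∈ oneCycles m (nhd L (ENNReal.ofReal r')) := by
    refine ⟨⟨⟨S, rfl⟩, hTm.trans_lt ENNReal.ofReal_lt_top⟩, ?_, ?_⟩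
    · rw [hTeq, sub_eq_add_neg]
      refine (Current.support_add _ _).trans (union_subset ?_ ?_)
      · exact (Current.support_boundary_subset _).trans hCrs
      · rw [Current.support_neg]
        exact hC3.trans (subset_nhd L (ENNReal.ofReal_pos.2 (hr.trans hrr')))
    · rw [hTeq, sub_eq_add_neg, Current.boundary_add, Current.boundary_neg,
        Current.boundary_boundary, Current.boundary_boundary, neg_zero, add_zero]
  have hδ : -C.boundary ∈ oneCycles m L :=
    neg_mem (show C.boundary ∈ oneCycles m L from ⟨hC2, hC3, Current.boundary_boundary C⟩)
  -- The difference is the boundary of the restricted current `Cr`, so `T` is homologous in the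
  -- neighbourhood to the cycle `-∂C` in `L`.
  have hTb : T - -C.boundary ∈ boundaries m 1 (nhd L R) := by
    have e : T - -C.boundary = Cr.boundary := by rw [hTeq, sub_neg_eq_add, sub_add_cancel]
    have hsR := hCrs.trans (nhd_mono L hrR.le)
    rw [e]
    refine ⟨?_, (Current.support_boundary_subset _).trans hsR, Cr, hCrR, hsR, rfl⟩
    have h1 : Cr.boundary = T + C.boundary := by rw [hTeq, sub_add_cancel]
    rw [h1]
    exact hTcyc.1.add hC2
  have hmass : ∀ ε : ℝ, 0 < ε → Cr.mass ≤ Q * (φ r' * ENNReal.ofReal f' + ENNReal.ofReal ε) := by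
    intro ε hε
    obtain ⟨γ', hγ', C', hC'1, hC'2, hC'3, hC'4⟩ := hfill ε hε r' (hr.trans hrr') hrR T hTcyc
    have h1 := sub_mem_boundaries (subset_nhd L hR) hη _ hγ' hδ hC'2 hTb
    have h2 : (C.restrict {x | τ x < r} - C').boundary ∈ boundaries m 1 L := by
      rw [hCrr, sub_eq_add_neg, Current.boundary_add, Current.boundary_neg, hC'3]
      -- The boundary of `Cr - C'` is `γ' + ∂C`, which bounds in `L` since `η` returns the class of
      -- `-∂C`; hence `C'` is an admissible competitor.
      have e : Cr.boundary + -(T - γ') = γ' - -C.boundary := by rw [hTeq]; abel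
      rwa [e]
    have h3 := hC4 {x | τ x < r} hm (fun x hx => lt_of_le_of_lt (hLτ hx) hr) C' hC'1 h2
    rw [hCrr] at h3
    refine h3.trans ?_
    gcongr
    refine hC'4.le.trans ?_
    gcongr
  have hreal : ∀ ε : ℝ, 0 < ε → P.sublevelMass τ hτc r ≤ Q * (φ r' * f' + ε) := by
    intro ε hε
    have h1 := hmass ε hε
    have e : (Q : ℝ≥0∞) * (φ r' * ENNReal.ofReal f' + ENNReal.ofReal ε) =
        ENNReal.ofReal (Q * (φ r' * f' + ε)) := by
      rw [ENNReal.ofReal_mul Q.coe_nonneg, ENNReal.ofReal_add (by positivity) hε.le,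
        ENNReal.ofReal_mul (φ r').coe_nonneg, ENNReal.ofReal_coe_nnreal, ENNReal.ofReal_coe_nnreal]
    rw [e] at h1
    exact ENNReal.toReal_le_of_le_ofReal (by positivity) h1
  refine le_of_forall_pos_le_add fun ε hε => ?_
  have h1 := hreal (ε / (Q + 1)) (by positivity)
  have h2 : (Q : ℝ) * (ε / (Q + 1)) ≤ ε := by
    rw [mul_div_assoc', div_le_iff₀ (by positivity)]
    nlinarith [Q.coe_nonneg]
  nlinarith

end Comparison

end RectCurrent

end

theorem proposition2p14 {m : ℕ} {X : Type*} [EMetricSpace X] [SecondCountableTopology X]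
    [MeasurableSpace X] [BorelSpace X]
    [ChartedSpace (EuclideanSpace ℝ (Fin m)) X] [IsManifold (𝓡 m) ((⊤ : ℕ∞) : WithTop ℕ∞) X]
    [RiemannianBundle (fun x : X => TangentSpace (𝓡 m) x)]
    [IsContMDiffRiemannianBundle (𝓡 m) ((⊤ : ℕ∞) : WithTop ℕ∞) (EuclideanSpace ℝ (Fin m))
      (fun x : X => TangentSpace (𝓡 m) x)]
    [IsRiemannianManifold (𝓡 m) X]
    (L : Set X) {R : ℝ≥0∞} (hR : 0 < R)
    (φ : ℝ → ℝ≥0) (hφ : RectCurrent.IsRelativeFillingFunction m L hR φ)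
    (hmono : MonotoneOn φ {r : ℝ | 0 ≤ r ∧ ENNReal.ofReal r < R})
    {Q : ℝ≥0} (hQ : 1 ≤ Q)
    (C : RectCurrent.Current m X 2) (hC : RectCurrent.IsQuasiminimizing L Q C)
    {a b : ℝ} (ha : 0 < a) (hab : a < b) (hb : ENNReal.ofReal b < R) :
    (C.restrict (RectCurrent.nhd L (ENNReal.ofReal a))).mass *
        EReal.exp (((Q : ℝ≥0∞)⁻¹ * ∫⁻ r in Ioo a b, (φ r : ℝ≥0∞)⁻¹ : ℝ≥0∞) : EReal) ≤
      (C.restrict (RectCurrent.nhd L (ENNReal.ofReal b))).mass := by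
  have : IsContinuousRiemannianBundle (EuclideanSpace ℝ (Fin m))
      (fun x : X => TangentSpace (𝓡 m) x) := by
    obtain ⟨g, hg, h⟩ := IsContMDiffRiemannianBundle.exists_contMDiff (IB := 𝓡 m) (n := ∞)
      (F := EuclideanSpace ℝ (Fin m)) (E := fun x : X => TangentSpace (𝓡 m) x)
    exact ⟨g, hg.continuous, h⟩
  have hC1 := hC.1.1
  -- This must be the parametrization chosen in the definition of `C.restrict`, so that restrictions
  -- of `C` and of `P` agree by unfolding.
  set P := hC1.choose with hPdef
  have hP : P.toCurrent = C := hC1.choose_spec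
  have hPr : ∀ B (hB : MeasurableSet B), C.restrict B = (P.restrict B hB).toCurrent := fun B hB =>
    dif_pos ⟨hC1, hB⟩
  have hfin : P.toCurrent.mass < ⊤ := by rw [hP]; exact hC.1.2
  have hτ := RectCurrent.lipschitzWith_truncDist L b
  set τ := RectCurrent.truncDist L b with hτdef
  set f := P.sublevelMass τ hτ.continuous with hf
  have hfm : Monotone f := RectCurrent.RectParam.monotone_sublevelMass P hfin hτ.continuous
  have hmass : ∀ r ≤ b, (C.restrict (RectCurrent.nhd L (ENNReal.ofReal r))).mass =
      ENNReal.ofReal (f r) := by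
    intro r hr
    rw [← RectCurrent.setOf_truncDist_lt L b hr,
      hPr _ (RectCurrent.measurableSet_sublevel hτ.continuous r), hf,
      RectCurrent.RectParam.sublevelMass, ENNReal.ofReal_toReal]
    exact ((P.mass_restrict_sublevel_le hτ.continuous r).trans_lt hfin).ne
  have hsupp : P.toCurrent.boundary.support ⊆ {x | τ x ≤ 0} := by
    rw [hP]
    exact hC.2.2.1.trans fun x hx => (RectCurrent.truncDist_of_mem L b hx).le
  -- A monotone function has at most countably many discontinuities from the right. Right continuity
  -- is what allows replacing `φ r'` by `φ r`.
  have hφc : ∀ᵐ r : ℝ, r ∈ Ioo a b → ContinuousWithinAt φ (Ioo a b ∩ Ioi r) r := by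
    have h1 : MonotoneOn φ (Ioo a b) := hmono.mono fun r hr =>
      ⟨(ha.trans hr.1).le, (ENNReal.ofReal_le_ofReal hr.2.le).trans_lt hb⟩
    filter_upwards [h1.countable_not_continuousWithinAt_Ioi.ae_notMem volume] with r hr hrab
    by_contra hn
    exact hr ⟨hrab, hn⟩
  rw [hmass a hab.le, hmass b le_rfl]
  refine RectCurrent.ofReal_mul_exp_lintegral_le hfm hab ENNReal.toReal_nonneg
    (one_pos.trans_le hQ) ?_
  filter_upwards [hφc, hfm.ae_differentiableAt, P.ae_exists_slice hfin hτ hsupp] with r h1 h2 h3 hr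
  have hr0 : 0 < r := ha.trans hr.1
  obtain ⟨S, hS⟩ := h3 hr0
  have : (𝓝[Ioo a b ∩ Ioi r] r).NeBot := by
    rw [nhdsWithin_inter_of_mem (mem_nhdsWithin_of_mem_nhds (Ioo_mem_nhds hr.1 hr.2))]
    infer_instance
  have h4 : Filter.Tendsto (fun r' => (Q : ℝ) * φ r' * deriv f r) (𝓝[Ioo a b ∩ Ioi r] r)
      (𝓝 (Q * φ r * deriv f r)) :=
    ((NNReal.tendsto_coe.2 (h1 hr)).const_mul _).mul_const _
  -- The comparison holds at every `r'` in `(r, b)`, and the bound passes to the limit as `r'`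
  -- decreases to `r`.
  refine ge_of_tendsto h4 ?_
  filter_upwards [self_mem_nhdsWithin] with r' hr'
  exact hC.sublevelMass_le hφ hb hP hPr hr0 hr'.2 hr'.1.2.le h2.hasDerivAt hS
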